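/- Let $n\ge 5$ be odd. The table $T(4,n,\infty)$ is the $4$-gon in $\mathbb{C}\cong\mathbb{R}^2$, with counterclockwise consecutive side vectors $I_1,I_2,I_3,I_4$, whose interior angles are $\pi/2$ between $I_1$ and $I_2$, $\pi/n$ between $I_2$ and $I_3$, and $\pi/n$ between $I_3$ and $I_4$ (so the remaining angle is $\tfrac{3\pi}{2}-\tfrac{2\pi}{n}$), scaled such that $|I_4|=1$, with $|I_3|=2(\cos(\pi/n)+\cos(\pi/4))$, and rotated such that $I_1$ is horizontal. For a compact polygon $P\subset\mathbb{C}$ let $G\subset O_2(\mathbb{R})$ be the group generated by the linear parts $\sigma_s$ of the reflections in the sides $s$ of $P$. The translation surface obtained by unfolding $P$ is the quotient of $\coprod_{g\in G} gP$ in which, for each $g\in G$ and each side $s$ of $P$, the side $g(s)$ of $gP$ is glued by a translation to the side $g\sigma_s(s)$ of $g\sigma_sP$, and polygons $gP$, $hP$ that differ by a translation are identified by that translation; its translation charts are the local homeomorphisms to $\mathbb{C}$ obtained by integrating the one-form $dz$ of the polygons $gP$, and its singular points are the points lying in no such chart. Let $X(4,n,\infty)$ be the translation surface obtained by unfolding $T(4,n,\infty)$.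 The affine group of a translation surface $X$ is the group of all $A\in SL_2(\mathbb{R})$ for which there is a homeomorphism of $X$ that preserves the set of singular points and is, in the translation charts, locally of the form $z\mapsto Az+b$. $X$ is a Veech surface if the image of its affine group in $PSL_2(\mathbb{R})$ is a lattice, that is, a discrete subgroup $\Gamma$ such that $\mathbb{H}/\Gamma$ has finite hyperbolic area. An $(m,n,p)$-triangle group $\Delta(m,n,p)$ is a discrete subgroup of $PSL_2(\mathbb{R})$ generated by the images of $M_1,M_2,M_3\in SL_2(\mathbb{R})$ with $M_1M_2M_3=-1$ and traces $2\cos(\pi/m)$, $2\cos(\pi/n)$, $2\cos(\pi/p)$, where $\pi/\infty=0$. Then the table $T(4,n,\infty)$ exists, and the affine group of $X(4,n,\infty)$ contains $$R=\begin{pmatrix}\cos(\pi/n)&-\sin(\pi/n)\\ \sin(\pi/n)&\cos(\pi/n)\end{pmatrix}\quad\text{and}\quad T=\begin{pmatrix}1&2\,\dfrac{\cos(\pi/n)+\cos(\pi/4)}{\sin(\pi/n)}\\0&1\end{pmatrix}.$$ The images of $R$ and $T$ in $PSL_2(\mathbb{R})$ generate a triangle group $\Delta(4,n,\infty)$. In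 particular, $X(4,n,\infty)$ is a Veech surface. -/

import Mathlib

open scoped Topology MatrixGroups

/-! ### Translation structures and affine groups -/

/-- A translation structure (possibly with singular points) on a topological space `X`: a family of
local coordinates with values in `ℂ` any two of which differ locally by a translation.  The points
lying in no chart are the singular points. -/
structure TranslationStructure (X : Type*) [TopologicalSpace X] where
  charts : Set (OpenPartialHomeomorph X ℂ)
  compatible : ∀ e ∈ charts, ∀ e' ∈ charts, ∀ x, x ∈ e.source → x ∈ e'.source →
    ∀ᶠ y in 𝓝 x, e' y - e' x = e y - e x

/-- The `ℝ`-linear action of a real `2 × 2` matrix on `ℂ`, identified with `ℝ²` by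
`z = (re z, im z)`. -/
def linAct (A : SL(2, ℝ)) (z : ℂ) : ℂ :=
  ⟨A.1 0 0 * z.re + A.1 0 1 * z.im, A.1 1 0 * z.re + A.1 1 1 * z.im⟩

theorem linAct_one (z : ℂ) : linAct 1 z = z := by
  apply Complex.ext <;> simp [linAct]

theorem linAct_mul (A B : SL(2, ℝ)) (z : ℂ) : linAct (A * B) z = linAct A (linAct B z) := by
  apply Complex.ext <;> simp [linAct, Matrix.mul_apply, Fin.sum_univ_two] <;> ring

namespace TranslationStructure

variable {X : Type*} [TopologicalSpace X] (S : TranslationStructure X)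

/-- A regular (i.e. non-singular) point: one that lies in the domain of a chart. -/
def IsRegular (x : X) : Prop := ∃ e ∈ S.charts, x ∈ e.source

/-- `φ` is an affine homeomorphism with derivative (matrix part) `A`: it preserves the set of
regular points, and in the charts it is locally of the form `z ↦ A z + b`. -/
def IsAffineWith (φ : X ≃ₜ X) (A : SL(2, ℝ)) : Prop :=
  (∀ x, S.IsRegular (φ x) ↔ S.IsRegular x) ∧
  ∀ e ∈ S.charts, ∀ e' ∈ S.charts, ∀ x, x ∈ e.source → φ x ∈ e'.source →
    ∀ᶠ y in 𝓝 x, e' (φ y) - e' (φ x) = linAct A (e y - e x)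

/-- The affine group `SL(X, ω)`: the derivatives of the orientation preserving affine
homeomorphisms. -/
def affineGroup : Subgroup SL(2, ℝ) where
  carrier := {A | ∃ φ : X ≃ₜ X, S.IsAffineWith φ A}
  one_mem' := by
    refine ⟨Homeomorph.refl X, fun x => Iff.rfl, fun e he e' he' x hx hx' => ?_⟩
    filter_upwards [S.compatible e he e' he' x hx hx'] with y hy
    rw [linAct_one]
    exact hy
  mul_mem' := by
    rintro A B ⟨φ, hφ, hφ'⟩ ⟨ψ, hψ, hψ'⟩
    refine ⟨ψ.trans φ, fun x => (hφ (ψ x)).trans (hψ x), fun e he e' he' x hx hx' => ?_⟩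
    obtain ⟨f, hf, hxf⟩ := (hψ x).2 ⟨e, he, hx⟩
    filter_upwards [hψ' e he f hf x hx hxf,
      ψ.continuous.continuousAt.eventually (hφ' f hf e' he' (ψ x) hxf hx')] with y h1 h2
    rw [linAct_mul, ← h1, ← h2]
    rfl
  inv_mem' := by
    rintro A ⟨φ, hφ, hφ'⟩
    refine ⟨φ.symm, fun x => ?_, fun e he e' he' x hx hx' => ?_⟩
    · rw [← hφ (φ.symm x), φ.apply_symm_apply]
    · have h := hφ' e' he' e he (φ.symm x) hx' (by simpa using hx)
      filter_upwards [φ.symm.continuous.continuousAt.eventually h] with y hy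
      rw [φ.apply_symm_apply, φ.apply_symm_apply] at hy
      rw [hy, ← linAct_mul, inv_mul_cancel, linAct_one]

end TranslationStructure

/-! ### Fuchsian groups, triangle groups and Veech surfaces -/

/-- `PSL₂(ℝ)`, with the quotient topology. -/
abbrev PSLTwoR : Type := Matrix.ProjectiveSpecialLinearGroup (Fin 2) ℝ

/-- The projection `SL₂(ℝ) → PSL₂(ℝ)`. -/
def toPSL : SL(2, ℝ) →* PSLTwoR := QuotientGroup.mk' (Subgroup.center SL(2, ℝ))

/-- A Fuchsian group is a discrete subgroup of `PSL₂(ℝ)`. -/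
def IsFuchsian (Γ : Subgroup PSLTwoR) : Prop := DiscreteTopology Γ

/-- A lattice in `PSL₂(ℝ)`: a discrete subgroup `Γ` such that `ℍ/Γ` has finite hyperbolic area,
that is, the `Γ`-translates of some measurable set of finite hyperbolic area cover `ℍ`
(`MeasureTheory.volume` on `ℍ` is the hyperbolic area). -/
def IsLatticePSL (Γ : Subgroup PSLTwoR) : Prop :=
  IsFuchsian Γ ∧ ∃ F : Set UpperHalfPlane, MeasurableSet F ∧ MeasureTheory.volume F < ⊤ ∧
    ∀ z : UpperHalfPlane, ∃ g : SL(2, ℝ), toPSL g ∈ Γ ∧ g • z ∈ F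

/-- The angle `π / m`, with `π / ∞ = 0`. -/
noncomputable def piDiv : ℕ∞ → ℝ
  | ⊤ => 0
  | (m : ℕ) => Real.pi / m

/-- `Γ` is an `(m, n, p)`-triangle group: a Fuchsian group generated by (the classes of) matrices
`M₁, M₂, M₃` of traces `2cos(π/m)`, `2cos(π/n)`, `2cos(π/p)` whose product is trivial in `PSL₂(ℝ)`.
The lifts to `SL₂(ℝ)` are normalized to have non-negative traces; the product of the lifts around
the corners of a hyperbolic triangle with angles `π/m`, `π/n`, `π/p` is then `-1`. -/
def IsTriangleGroup (m n p : ℕ∞) (Γ : Subgroup PSLTwoR) : Prop :=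
  IsFuchsian Γ ∧ ∃ M₁ M₂ M₃ : SL(2, ℝ),
    M₁ * M₂ * M₃ = -1 ∧
    M₁.1.trace = 2 * Real.cos (piDiv m) ∧
    M₂.1.trace = 2 * Real.cos (piDiv n) ∧
    M₃.1.trace = 2 * Real.cos (piDiv p) ∧
    Γ = Subgroup.closure {toPSL M₁, toPSL M₂, toPSL M₃}

namespace TranslationStructure

variable {X : Type*} [TopologicalSpace X] (S : TranslationStructure X)

/-- The projective affine group `PSL(X, ω)`. -/
def projAffineGroup : Subgroup PSLTwoR := S.affineGroup.map toPSL

/-- A Veech surface: the projective affine group is a lattice in `PSL₂(ℝ)`. -/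
def IsVeech : Prop := IsLatticePSL S.projAffineGroup

end TranslationStructure

/-! ### Unfolding a polygon

The polygon is given by its closed region `P ⊆ ℂ` and its cyclically ordered vertices `p`; the
`i`-th side joins `p i` to `p (i + 1)`. -/

section Unfolding

variable {N : ℕ} [NeZero N]

/-- The `i`-th side. -/
def side (p : Fin N → ℂ) (i : Fin N) : Set ℂ := segment ℝ (p i) (p (i + 1))

/-- The linear part of the reflection in the `i`-th side. -/
noncomputable def sideReflection (p : Fin N → ℂ) (i : Fin N) : ℂ ≃ₗᵢ[ℝ] ℂ :=
  (Submodule.span ℝ {p (i + 1) - p i}).reflection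

/-- The subgroup of `O₂(ℝ)` generated by the linear parts of the reflections in the sides. -/
noncomputable def reflectionGroup (p : Fin N → ℂ) : Subgroup (ℂ ≃ₗᵢ[ℝ] ℂ) :=
  Subgroup.closure (Set.range (sideReflection p))

/-- The disjoint union of the polygons `g P`, for `g` in the reflection group.  The pair `⟨g, x⟩`
stands for the point `g x` of `g P`. -/
abbrev Copies (P : Set ℂ) (p : Fin N → ℂ) : Type := (_ : reflectionGroup p) × P

/-- The identifications.  `glue`: the polygon `g σᵢ P` is the mirror image of `g P` in the side
`g sᵢ`, and the two corresponding sides are glued by a translation.  `translate`: polygons `g P` and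
`h P` that differ by a translation are the same polygon (so that only one representative of each
translation class counts). -/
inductive UnfoldRel (P : Set ℂ) (p : Fin N → ℂ) : Copies P p → Copies P p → Prop
  | glue (g h : reflectionGroup p) (i : Fin N) (hgh : h.1 = g.1 * sideReflection p i)
      (x : P) (hx : x.1 ∈ side p i) : UnfoldRel P p ⟨g, x⟩ ⟨h, x⟩
  | translate (g h : reflectionGroup p) (t : ℂ)
      (ht : (fun z => g.1 z) '' P = (fun z => h.1 z + t) '' P)
      (x y : P) (hxy : g.1 x.1 = h.1 y.1 + t) : UnfoldRel P p ⟨g, x⟩ ⟨h, y⟩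

/-- The surface obtained by unfolding the polygon, with the quotient topology. -/
def Unfolding (P : Set ℂ) (p : Fin N → ℂ) : Type := Quot (UnfoldRel P p)

instance (P : Set ℂ) (p : Fin N → ℂ) : TopologicalSpace (Unfolding P p) :=
  inferInstanceAs (TopologicalSpace (Quot (UnfoldRel P p)))

/-- The point of the unfolded surface given by the point `g x` of the polygon `g P`. -/
def Unfolding.mk {P : Set ℂ} {p : Fin N → ℂ} (g : reflectionGroup p) (x : P) : Unfolding P p :=
  Quot.mk _ ⟨g, x⟩

/-- The charts of the translation structure are all the local homeomorphisms to `ℂ` obtained by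
integrating the one-form `dz` of the polygons `g P`. -/
def IsTranslationChart {P : Set ℂ} {p : Fin N → ℂ} (e : OpenPartialHomeomorph (Unfolding P p) ℂ) :
    Prop :=
  ∀ (g : reflectionGroup p) (x : P), Unfolding.mk g x ∈ e.source →
    ∀ᶠ y in 𝓝 x, e (Unfolding.mk g y) - e (Unfolding.mk g x) = g.1 (y : ℂ) - g.1 (x : ℂ)

theorem IsTranslationChart.compatible {P : Set ℂ} {p : Fin N → ℂ}
    {e e' : OpenPartialHomeomorph (Unfolding P p) ℂ}
    (he : IsTranslationChart e) (he' : IsTranslationChart e') (x : Unfolding P p)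
    (hx : x ∈ e.source) (hx' : x ∈ e'.source) :
    ∀ᶠ y in 𝓝 x, e' y - e' x = e y - e x := by
  have hq : Topology.IsQuotientMap (Quot.mk (UnfoldRel P p)) := isQuotientMap_quot_mk
  let U : Set (Unfolding P p) :=
    {y | y ∈ e.source ∧ y ∈ e'.source ∧ e' y - e' x = e y - e x}
  have hU : IsOpen U := by
    refine hq.isOpen_preimage.1 (isOpen_iff_mem_nhds.2 ?_)
    rintro ⟨g, z⟩ ⟨h1, h2, h3⟩
    have hc : Continuous fun y : P => (Unfolding.mk g y : Unfolding P p) :=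
      hq.continuous.comp continuous_sigmaMk
    have k : ∀ᶠ y in 𝓝 z, Unfolding.mk g y ∈ U := by
      filter_upwards [he g z h1, he' g z h2, hc.continuousAt.eventually (e.open_source.mem_nhds h1),
        hc.continuousAt.eventually (e'.open_source.mem_nhds h2)] with y a b c d
      refine ⟨c, d, ?_⟩
      have h3' : e' (Unfolding.mk g z) - e' x = e (Unfolding.mk g z) - e x := h3
      linear_combination b - a + h3'
    rw [Sigma.nhds_mk]
    exact k
  filter_upwards [hU.mem_nhds ⟨hx, hx', by simp⟩] with y hy using hy.2.2

/-- The translation structure of the unfolded surface. -/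
def unfoldingStructure (P : Set ℂ) (p : Fin N → ℂ) : TranslationStructure (Unfolding P p) where
  charts := {e | IsTranslationChart e}
  compatible _ he _ he' x hx hx' := IsTranslationChart.compatible he he' x hx hx'

end Unfolding

/-! ### The billiard table `T(4, n, ∞)` -/

/-- The vertices `p 0, p 1, p 2, p 3`, in counterclockwise order, of the table `T(4, n, ∞)`.  With
the sides `I₁ = p 1 - p 0`, `I₂ = p 2 - p 1`, `I₃ = p 3 - p 2`, `I₄ = p 0 - p 3`, the interior
angles are `α = π/2` (between `I₁` and `I₂`), `β = π/n` (between `I₂` and `I₃`) and `γ = π/n`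
(between `I₃` and `I₄`).  The remaining angle at `p 0` is reflex. The table is scaled so that
`|I₄| = 1`, has `|I₃| = 2(cos(π/n) + cos(π/4))`, and is rotated so that `I₁` is horizontal. -/
structure IsTableFour (n : ℕ) (p : Fin 4 → ℂ) : Prop where
  angle_one : Complex.arg ((p 0 - p 1) / (p 2 - p 1)) = Real.pi / 2
  angle_two : Complex.arg ((p 1 - p 2) / (p 3 - p 2)) = Real.pi / n
  angle_three : Complex.arg ((p 2 - p 3) / (p 0 - p 3)) = Real.pi / n
  norm_four : ‖p 0 - p 3‖ = 1
  norm_three : ‖p 3 - p 2‖ = 2 * (Real.cos (Real.pi / n) + Real.cos (Real.pi / 4))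
  horizontal : (p 1 - p 0).im = 0

/-- The closed region bounded by a `4`-gon whose only possible reflex angle is at `p 0`: the
diagonal from `p 0` cuts it into two triangles. -/
def tableRegion (p : Fin 4 → ℂ) : Set ℂ :=
  convexHull ℝ {p 0, p 1, p 2} ∪ convexHull ℝ {p 0, p 2, p 3}

/-- The translation surface obtained by unfolding the `4`-gon with vertices `p`. -/
abbrev tableSurface (p : Fin 4 → ℂ) :
    TranslationStructure (Unfolding (tableRegion p) p) :=
  unfoldingStructure (tableRegion p) p

/-! ### The matrices `R` and `T` -/

noncomputable def matR (n : ℕ) : SL(2, ℝ) :=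
  ⟨!![Real.cos (Real.pi / n), -Real.sin (Real.pi / n);
      Real.sin (Real.pi / n), Real.cos (Real.pi / n)], by
    rw [Matrix.det_fin_two_of]
    linarith [Real.cos_sq_add_sin_sq (Real.pi / n)]⟩

noncomputable def matT (n : ℕ) : SL(2, ℝ) :=
  ⟨!![1, 2 * ((Real.cos (Real.pi / n) + Real.cos (Real.pi / 4)) / Real.sin (Real.pi / n));
      0, 1], by simp [Matrix.det_fin_two_of]⟩

/-! Geometry of the surface. Cut the table along the perpendicular dropped from `p 0` to the side
joining `p 2` and `p 3`. This gives a quadrilateral with angle π/n at `p 2` and a right triangle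
with angle π/n at `p 3`. Since `n` is odd, the reflections in the sides generate the whole dihedral
group of order 4n, which has two parity classes of 2n elements. The copies belonging to one parity
class close up around the two vertices to a semi-regular 2n-gon and a regular n-gon. Hence the
unfolding is glued from four polygons `poly n i`: two n-gons for i = 0, 3 and two 2n-gons for i = 1,
2. The even sides of polygon i are glued to the opposite sides of polygon i + 1, and the side
lengths are proportional to the weights 1, √2, 1. The agreement of the two gluings is
`placeMap_glue` and `eqvGen_of_placeMap_eq`; that the table has no symmetries (`eq_one_of_isometry`)
is needed because unfolding also identifies polygons that differ by a translation.

The two matrices. `R` is realised by left multiplication with a rotation of the dihedral group. For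
`T`, the four polygons are sliced horizontally; the slices fit together to horizontal cylinders that
pass alternately through polygons i and i + 1. Because (1, √2, 1) is an eigenvector of the path with
three vertices for the eigenvalue √2 = 2 cos(π/4), all cylinders have the same ratio of
circumference to height (`two_mul_stDist`), namely the upper right entry of `T`. The simultaneous
Dehn twist is therefore affine with derivative `T` (`isAffineWith_twist`).

Discreteness. An affine map with lower left entry c ≠ 0 sends the core curve of a cylinder to a
closed path of slope proportional to |c|, which must cross a whole cylinder. So |c| is bounded below
(`affineGroup_gap`). Conjugating by `1`, `R`, `R²` shows that an element close to the identity
preserves three directions and is scalar (`isFuchsian_map_of_gap`).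

Finite area and the triangle group. The translates of a half strip of finite area under `R` and `T`
alone cover the half plane (`exists_smul_mem_cuspRegion`), and the trace of `T R⁻¹` is -2 cos(π/4)
(`isTriangleGroup_closure`).

Topologies and charts are compared through `CellFamily.Refines`: polygons of the unfolding, the four
polygons, and the cylinders refine one another, so they define the same open sets and the same
translation charts. -/

/-! ### Families of plane cells in a space -/

/-- A family of plane regions `S i` with maps `c i` (relevant on `S i` only) to a space `X`. -/
structure CellFamily (X : Type*) where
  ι : Type
  S : ι → Set ℂ
  c : ι → ℂ → X

namespace CellFamily

variable {X : Type*}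

/-- Locally, the cells of `A` are finite unions of translated pieces of cells of `B`. -/
def Refines (A B : CellFamily X) : Prop :=
  ∀ i, ∀ z ∈ A.S i, ∃ F : Set (B.ι × ℂ), F.Finite ∧ ∀ᶠ z' in 𝓝[A.S i] z, ∃ f ∈ F,
    z + f.2 ∈ B.S f.1 ∧ z' + f.2 ∈ B.S f.1 ∧
      A.c i z = B.c f.1 (z + f.2) ∧ A.c i z' = B.c f.1 (z' + f.2)

/-- A set is open with respect to the family. -/
def OpenIn (A : CellFamily X) (U : Set X) : Prop :=
  ∀ i, ∀ z ∈ A.S i, A.c i z ∈ U → ∀ᶠ z' in 𝓝[A.S i] z, A.c i z' ∈ U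

/-- A function which is locally a translation on each cell. -/
def TransOn (A : CellFamily X) (f : X → ℂ) (U : Set X) : Prop :=
  ∀ i, ∀ z ∈ A.S i, A.c i z ∈ U → ∀ᶠ z' in 𝓝[A.S i] z, f (A.c i z') - f (A.c i z) = z' - z

theorem eventually_translate {S : Set ℂ} {z t : ℂ} {Q : ℂ → Prop}
    (h : ∀ᶠ w in 𝓝[S] (z + t), Q w) : ∀ᶠ z' in 𝓝 z, z' + t ∈ S → Q (z' + t) := by
  rw [eventually_nhdsWithin_iff] at h
  have hc : Continuous fun z' : ℂ => z' + t := by fun_prop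
  exact hc.continuousAt.eventually h

/-- The translated cell containing a nearby point also contains the base point. A property that
holds near each base point of `B` therefore pulls back along finitely many translations at once. -/
theorem Refines.eventually_finite {A B : CellFamily X} (h : A.Refines B) {i : A.ι} {z : ℂ}
    (hz : z ∈ A.S i) {Q : B.ι → ℂ → ℂ → Prop}
    (hQ : ∀ j t, z + t ∈ B.S j → A.c i z = B.c j (z + t) →
      ∀ᶠ w in 𝓝[B.S j] (z + t), Q j (z + t) w) :
    ∃ F : Set (B.ι × ℂ), F.Finite ∧ ∀ᶠ z' in 𝓝[A.S i] z, ∃ f ∈ F,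
      z + f.2 ∈ B.S f.1 ∧ z' + f.2 ∈ B.S f.1 ∧
      A.c i z = B.c f.1 (z + f.2) ∧ A.c i z' = B.c f.1 (z' + f.2) ∧
      Q f.1 (z + f.2) (z' + f.2) := by
  obtain ⟨F, hF, hev⟩ := h i z hz
  refine ⟨F, hF, ?_⟩
  have h1 : ∀ᶠ z' in 𝓝 z, ∀ f ∈ F, z + f.2 ∈ B.S f.1 → A.c i z = B.c f.1 (z + f.2) →
      z' + f.2 ∈ B.S f.1 → Q f.1 (z + f.2) (z' + f.2) := by
    rw [Filter.eventually_all_finite hF]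
    intro f _
    by_cases h1 : z + f.2 ∈ B.S f.1
    · by_cases h2 : A.c i z = B.c f.1 (z + f.2)
      · filter_upwards [eventually_translate (hQ f.1 f.2 h1 h2)] with z' hz' _ _ using hz'
      · exact Filter.Eventually.of_forall fun _ _ h3 => absurd h3 h2
    · exact Filter.Eventually.of_forall fun _ h3 => absurd h3 h1
  filter_upwards [hev, nhdsWithin_le_nhds h1] with z' ⟨f, hf, a, b, c, d⟩ h2
  exact ⟨f, hf, a, b, c, d, h2 f hf a c b⟩

theorem Refines.eventually {A B : CellFamily X} (h : A.Refines B) {i : A.ι} {z : ℂ}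
    (hz : z ∈ A.S i) {Q : B.ι → ℂ → ℂ → Prop}
    (hQ : ∀ j t, z + t ∈ B.S j → A.c i z = B.c j (z + t) →
      ∀ᶠ w in 𝓝[B.S j] (z + t), Q j (z + t) w) :
    ∀ᶠ z' in 𝓝[A.S i] z, ∃ j t, z + t ∈ B.S j ∧ z' + t ∈ B.S j ∧
      A.c i z = B.c j (z + t) ∧ A.c i z' = B.c j (z' + t) ∧ Q j (z + t) (z' + t) := by
  obtain ⟨F, _, hev⟩ := h.eventually_finite hz hQ
  filter_upwards [hev] with z' ⟨f, _, hf⟩ using ⟨f.1, f.2, hf⟩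

theorem Refines.exists_eq {A B : CellFamily X} (h : A.Refines B) {i : A.ι} {z : ℂ}
    (hz : z ∈ A.S i) : ∃ j, ∃ w ∈ B.S j, A.c i z = B.c j w := by
  have := h.eventually hz (Q := fun _ _ _ => True) (fun _ _ _ _ => by simp)
  obtain ⟨j, t, h1, _, h2, _⟩ := this.self_of_nhdsWithin hz
  exact ⟨j, z + t, h1, h2⟩

theorem Refines.trans {A B C : CellFamily X} (h : A.Refines B) (h' : B.Refines C) :
    A.Refines C := by
  classical
  intro i z hz
  have key : ∀ f : B.ι × ℂ, ∃ F : Set (C.ι × ℂ), F.Finite ∧ (z + f.2 ∈ B.S f.1 →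
      ∀ᶠ w in 𝓝[B.S f.1] (z + f.2), ∃ f' ∈ F, z + f.2 + f'.2 ∈ C.S f'.1 ∧ w + f'.2 ∈ C.S f'.1 ∧
        B.c f.1 (z + f.2) = C.c f'.1 (z + f.2 + f'.2) ∧
        B.c f.1 w = C.c f'.1 (w + f'.2)) := by
    intro f
    by_cases hf : z + f.2 ∈ B.S f.1
    · obtain ⟨F, hF, h2⟩ := h' f.1 (z + f.2) hf
      exact ⟨F, hF, fun _ => h2⟩
    · exact ⟨∅, Set.finite_empty, fun h3 => absurd h3 hf⟩
  choose K hK1 hK2 using key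
  obtain ⟨F, hF, hev⟩ := h i z hz
  -- Pieces of pieces: the translation vectors add up.
  refine ⟨⋃ f ∈ F, (fun q : C.ι × ℂ => (q.1, f.2 + q.2)) '' K f,
    hF.biUnion fun f _ => (hK1 f).image _, ?_⟩
  have h1 : ∀ᶠ z' in 𝓝 z, ∀ f ∈ F, z + f.2 ∈ B.S f.1 → z' + f.2 ∈ B.S f.1 →
      ∃ f' ∈ K f, z + f.2 + f'.2 ∈ C.S f'.1 ∧ z' + f.2 + f'.2 ∈ C.S f'.1 ∧
        B.c f.1 (z + f.2) = C.c f'.1 (z + f.2 + f'.2) ∧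
        B.c f.1 (z' + f.2) = C.c f'.1 (z' + f.2 + f'.2) := by
    rw [Filter.eventually_all_finite hF]
    intro f _
    by_cases h1 : z + f.2 ∈ B.S f.1
    · filter_upwards [eventually_translate (hK2 f h1)] with z' hz' _ using hz'
    · exact Filter.Eventually.of_forall fun _ h3 => absurd h3 h1
  filter_upwards [hev, nhdsWithin_le_nhds h1] with z' ⟨f, hf, a, b, c, d⟩ h2
  obtain ⟨f', hf', a', b', c', d'⟩ := h2 f hf a b
  refine ⟨(f'.1, f.2 + f'.2), ?_, ?_⟩
  · simp only [Set.mem_iUnion]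
    exact ⟨f, hf, f', hf', rfl⟩
  · simp only [← add_assoc]
    exact ⟨a', b', c.trans c', d.trans d'⟩

/-- Together with `transOn` this is the purpose of refinements: two families refining each other
have the same open sets and the same functions that are locally translations. -/
theorem Refines.openIn {A B : CellFamily X} (h : A.Refines B) {U : Set X} (hU : B.OpenIn U) :
    A.OpenIn U := by
  intro i z hz hzU
  have := h.eventually hz (Q := fun j _ w => B.c j w ∈ U)
    (fun j t h1 h2 => hU j _ h1 (h2 ▸ hzU))
  filter_upwards [this] with z' ⟨j, t, _, _, _, h4, h5⟩
  rw [h4]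
  exact h5

theorem Refines.transOn {A B : CellFamily X} (h : A.Refines B) {U : Set X} {f : X → ℂ}
    (hU : B.TransOn f U) : A.TransOn f U := by
  intro i z hz hzU
  have := h.eventually hz (Q := fun j w w' => f (B.c j w') - f (B.c j w) = w' - w)
    (fun j t h1 h2 => hU j _ h1 (h2 ▸ hzU))
  filter_upwards [this] with z' ⟨j, t, _, _, h3, h4, h5⟩
  rw [h4, h3, h5]
  ring

end CellFamily

/-! ### The cells of the unfolded surface -/

section UnfoldingCells

variable {N : ℕ} [NeZero N] {P : Set ℂ} {p : Fin N → ℂ}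

open Classical in
/-- The family of the polygons `g P`. -/
noncomputable def unfoldingCells (P : Set ℂ) (p : Fin N → ℂ) [Nonempty P] :
    CellFamily (Unfolding P p) where
  ι := reflectionGroup p
  S g := (fun z => g.1 z) '' P
  -- Only the values on `g P` matter; elsewhere an arbitrary point is taken.
  c g z := if h : g.1.symm z ∈ P then Unfolding.mk g ⟨_, h⟩ else
    Unfolding.mk g (Classical.choice inferInstance)

theorem unfoldingCells_c [Nonempty P] (g : reflectionGroup p) (x : P) :
    (unfoldingCells P p).c g (g.1 x) = Unfolding.mk g x := by
  simp [unfoldingCells]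

theorem Unfolding.exists_mk (x : Unfolding P p) : ∃ g y, x = Unfolding.mk g y := by
  obtain ⟨⟨g, y⟩, rfl⟩ := Quot.exists_rep x
  exact ⟨g, y, rfl⟩

theorem unfoldingCells_mem [Nonempty P] (g : reflectionGroup p) (x : P) :
    g.1 x ∈ (unfoldingCells P p).S g := ⟨x, x.2, rfl⟩

theorem unfoldingCells_eventually [Nonempty P] (g : reflectionGroup p) (x : P) (Q : ℂ → Prop) :
    (∀ᶠ z in 𝓝[(unfoldingCells P p).S g] (g.1 x), Q z) ↔ ∀ᶠ y : P in 𝓝 x, Q (g.1 (y : ℂ)) := by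
  have h1 : 𝓝[(unfoldingCells P p).S g] (g.1 (x : ℂ)) = Filter.map (fun z => g.1 z) (𝓝[P] (x : ℂ)) :=
    (g.1.toHomeomorph.isEmbedding.map_nhdsWithin_eq P x).symm
  rw [h1, Filter.eventually_map, ← map_nhds_subtype_val x, Filter.eventually_map]

theorem Unfolding.continuous_mk (g : reflectionGroup p) :
    Continuous fun y : P => (Unfolding.mk g y : Unfolding P p) :=
  (isQuotientMap_quot_mk (r := UnfoldRel P p)).continuous.comp continuous_sigmaMk

theorem Unfolding.isOpen_iff {U : Set (Unfolding P p)} :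
    IsOpen U ↔ ∀ (g : reflectionGroup p) (x : P), Unfolding.mk g x ∈ U →
      ∀ᶠ y in 𝓝 x, Unfolding.mk g y ∈ U := by
  constructor
  · intro h g x hx
    exact (Unfolding.continuous_mk g).continuousAt.eventually (h.mem_nhds hx)
  · intro h
    refine (isQuotientMap_quot_mk (r := UnfoldRel P p)).isOpen_preimage.1
      (isOpen_iff_mem_nhds.2 ?_)
    rintro ⟨g, z⟩ hz
    rw [Sigma.nhds_mk]
    exact h g z hz

theorem isOpen_iff_openIn [Nonempty P] {U : Set (Unfolding P p)} :
    IsOpen U ↔ (unfoldingCells P p).OpenIn U := by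
  rw [Unfolding.isOpen_iff]
  constructor
  · rintro h (g : reflectionGroup p) _ ⟨x, hx, rfl⟩ hU
    have h2 := h g ⟨x, hx⟩ (unfoldingCells_c g ⟨x, hx⟩ ▸ hU)
    refine (unfoldingCells_eventually g ⟨x, hx⟩ _).2 ?_
    filter_upwards [h2] with y hy
    rwa [unfoldingCells_c]
  · intro h g x hx
    have h2 := (unfoldingCells_eventually g x _).1
      (h g (g.1 x) (unfoldingCells_mem g x) (by rwa [unfoldingCells_c]))
    filter_upwards [h2] with y hy
    rwa [unfoldingCells_c] at hy

theorem isTranslationChart_iff [Nonempty P] {e : OpenPartialHomeomorph (Unfolding P p) ℂ} :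
    IsTranslationChart e ↔ (unfoldingCells P p).TransOn e e.source := by
  constructor
  · rintro h (g : reflectionGroup p) _ ⟨x, hx, rfl⟩ hU
    have h2 := h g ⟨x, hx⟩ (unfoldingCells_c g ⟨x, hx⟩ ▸ hU)
    refine (unfoldingCells_eventually g ⟨x, hx⟩ _).2 ?_
    filter_upwards [h2] with y hy
    rw [unfoldingCells_c, unfoldingCells_c g ⟨x, hx⟩]
    exact hy
  · intro h g x hx
    have h2 := (unfoldingCells_eventually g x _).1
      (h g (g.1 x) (unfoldingCells_mem g x) (by rwa [unfoldingCells_c]))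
    filter_upwards [h2] with y hy
    rwa [unfoldingCells_c, unfoldingCells_c] at hy

/-- A neighbourhood of a point of the surface is swept out by neighbourhoods of the corresponding
points of the polygons. -/
theorem Unfolding.eventually_nhds [Finite (reflectionGroup p)]
    (htr : ∀ a b, UnfoldRel P p a b → a.2 = b.2 ∧
      (a.1 = b.1 ∨ ∃ i, a.2.1 ∈ side p i ∧ b.1.1 = a.1.1 * sideReflection p i))
    (g₀ : reflectionGroup p) (x : P) {Q : reflectionGroup p → P → Prop}
    (hQ : ∀ g, Unfolding.mk g x = Unfolding.mk g₀ x → ∀ᶠ y in 𝓝 x, Q g y) :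
    ∀ᶠ y in 𝓝 (Unfolding.mk g₀ x : Unfolding P p), ∃ g y', Unfolding.mk g x = Unfolding.mk g₀ x ∧
      y = Unfolding.mk g y' ∧ Q g y' := by
  have h1 : ∀ᶠ y in 𝓝 x, ∀ g : reflectionGroup p,
      (Unfolding.mk g x : Unfolding P p) = Unfolding.mk g₀ x → Q g y := by
    rw [Filter.eventually_all]
    intro g
    by_cases h : (Unfolding.mk g x : Unfolding P p) = Unfolding.mk g₀ x
    · filter_upwards [hQ g h] with y hy _ using hy
    · exact Filter.Eventually.of_forall fun _ h3 => absurd h3 h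
  have h2 : ∀ᶠ y : P in 𝓝 x, ∀ i : Fin N, (y : ℂ) ∈ side p i → (x : ℂ) ∈ side p i := by
    rw [Filter.eventually_all]
    intro i
    by_cases h : (x : ℂ) ∈ side p i
    · exact Filter.Eventually.of_forall fun _ _ => h
    · have hc : IsClosed (side p i) := by
        unfold side
        rw [← convexHull_pair (𝕜 := ℝ)]
        exact (((Set.finite_singleton _).insert _).isCompact_convexHull ℝ).isClosed
      have : ∀ᶠ y : P in 𝓝 x, (y : ℂ) ∉ side p i :=
        continuous_subtype_val.continuousAt.eventually (hc.isOpen_compl.mem_nhds h)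
      filter_upwards [this] with y hy h3 using absurd h3 hy
  obtain ⟨O, hO, hOo, hxO⟩ := eventually_nhds_iff.1 (h1.and h2)
  -- `W` is saturated for the gluings: a side containing a point of `O` also contains `x`, so
  -- crossing it does not change the class of `x`. Thus `W` descends to an open set of the surface.
  let W : Copies P p → Prop := fun a =>
    (Unfolding.mk a.1 x : Unfolding P p) = Unfolding.mk g₀ x ∧ a.2 ∈ O
  have hW : ∀ a b, UnfoldRel P p a b → (W a ↔ W b) := by
    rintro ⟨g, y⟩ ⟨h, y'⟩ hr
    obtain ⟨rfl, hr⟩ := htr _ _ hr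
    rcases hr with hr | ⟨i, hi, hr⟩
    · simp only at hr
      subst hr
      rfl
    · simp only at hi hr
      have hxi : y ∈ O → (Unfolding.mk g x : Unfolding P p) = Unfolding.mk h x := fun hy =>
        Quot.sound (UnfoldRel.glue g h i hr x ((hO y hy).2 i hi))
      constructor
      · rintro ⟨a, b⟩
        exact ⟨(hxi b).symm.trans a, b⟩
      · rintro ⟨a, b⟩
        exact ⟨(hxi b).trans a, b⟩
  let W' : Unfolding P p → Prop := Quot.lift W fun a b h => propext (hW a b h)
  have hop : IsOpen {y | W' y} := by
    rw [Unfolding.isOpen_iff]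
    rintro g y ⟨hy1, hy2⟩
    filter_upwards [hOo.mem_nhds hy2] with y' hy' using ⟨hy1, hy'⟩
  filter_upwards [hop.mem_nhds (show W' (Unfolding.mk g₀ x) from ⟨rfl, hxO⟩)] with y hy
  obtain ⟨g, y', rfl⟩ := Unfolding.exists_mk y
  exact ⟨g, y', hy.1, rfl, (hO y' hy.2).1 g hy.1⟩

end UnfoldingCells

/-! ### Linear maps and shears of the plane -/

theorem linAct_sub (A : SL(2, ℝ)) (z w : ℂ) : linAct A (z - w) = linAct A z - linAct A w := by
  apply Complex.ext <;> simp [linAct] <;> ring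

theorem continuous_linAct (A : SL(2, ℝ)) : Continuous (linAct A) := by
  have h : linAct A = fun z : ℂ => ((A.1 0 0 * z.re + A.1 0 1 * z.im : ℝ) : ℂ) +
      ((A.1 1 0 * z.re + A.1 1 1 * z.im : ℝ) : ℂ) * Complex.I := by
    funext z
    apply Complex.ext <;> simp [linAct]
  rw [h]
  fun_prop

/-- The action of a matrix on the plane, as a homeomorphism. -/
noncomputable def linActHomeomorph (A : SL(2, ℝ)) : ℂ ≃ₜ ℂ where
  toFun := linAct A
  invFun := linAct A⁻¹
  left_inv z := by rw [← linAct_mul, inv_mul_cancel, linAct_one]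
  right_inv z := by rw [← linAct_mul, mul_inv_cancel, linAct_one]
  continuous_toFun := continuous_linAct A
  continuous_invFun := continuous_linAct A⁻¹

/-- The horizontal shear with slope `s`. -/
noncomputable def shear (s : ℝ) (z : ℂ) : ℂ := z + ((s * z.im : ℝ) : ℂ)

theorem shear_im (s : ℝ) (z : ℂ) : (shear s z).im = z.im := by
  simp only [shear, Complex.add_im, Complex.ofReal_im, add_zero]

theorem continuous_shear (s : ℝ) : Continuous (shear s) := by
  unfold shear
  fun_prop

theorem shear_sub (s : ℝ) (z w : ℂ) : shear s z - shear s w = shear s (z - w) := by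
  simp only [shear, Complex.sub_im]
  push_cast
  ring

theorem shear_shear_neg (s : ℝ) (z : ℂ) : shear s (shear (-s) z) = z := by
  simp only [shear]
  simp

/-! ### Decompositions into horizontal strips -/

/-- A family of maps from closed horizontal strips of heights `hgt i`, periodic with periods
`τ * hgt i`, and injective modulo the periods away from the boundary. -/
structure StripData (X : Type*) (τ : ℝ) where
  ι : Type
  hgt : ι → ℝ
  c : ι → ℂ → X
  hgt_pos : ∀ i, 0 < hgt i
  periodic : ∀ i z, 0 ≤ z.im → z.im ≤ hgt i → c i (z + ((τ * hgt i : ℝ) : ℂ)) = c i z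
  inj : ∀ i j z w, 0 < z.im → z.im < hgt i → 0 ≤ w.im → w.im ≤ hgt j → c i z = c j w →
    i = j ∧ ∃ m : ℤ, w = z + ((m * (τ * hgt i) : ℝ) : ℂ)

namespace StripData

variable {X : Type*} {τ : ℝ} (B : StripData X τ)

/-- The closed strip. -/
def strip (i : B.ι) : Set ℂ := {z | 0 ≤ z.im ∧ z.im ≤ B.hgt i}

/-- The strips as a family of cells. -/
def cells : CellFamily X := ⟨B.ι, B.strip, B.c⟩

theorem periodic_int (i : B.ι) {z : ℂ} (hz : z ∈ B.strip i) (m : ℤ) :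
    B.c i (z + ((m * (τ * B.hgt i) : ℝ) : ℂ)) = B.c i z := by
  have key : ∀ m : ℤ, B.c i (z + (((m + 1 : ℤ) * (τ * B.hgt i) : ℝ) : ℂ)) =
      B.c i (z + ((m * (τ * B.hgt i) : ℝ) : ℂ)) := by
    intro m
    rw [← B.periodic i (z + ((m * (τ * B.hgt i) : ℝ) : ℂ))]
    · congr 1
      push_cast
      ring
    · simpa only [Complex.add_im, Complex.ofReal_im, add_zero] using hz.1
    · simpa only [Complex.add_im, Complex.ofReal_im, add_zero] using hz.2
  induction m with
  | zero => simp
  | succ m ih => rw [key, ih]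
  | pred m ih =>
    have := key (-m - 1)
    rw [sub_add_cancel, ih] at this
    exact this.symm

theorem shear_mem {i : B.ι} {z : ℂ} (s : ℝ) (hz : z ∈ B.strip i) : shear s z ∈ B.strip i := by
  simpa only [strip, Set.mem_ofPred_eq, shear_im] using hz

/-- The shear moves the lower edge by zero and the upper edge by `k` periods. The twist thus fixes
the boundary of every strip pointwise, which is why the shears of different strips fit together. -/
theorem c_shear_of_boundary (k : ℤ) {i : B.ι} {z : ℂ} (hz : z ∈ B.strip i)
    (h : ¬ (0 < z.im ∧ z.im < B.hgt i)) : B.c i (shear (k * τ) z) = B.c i z := by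
  rcases hz.1.eq_or_lt with h0 | h0
  · simp [shear, ← h0]
  · have h1 : z.im = B.hgt i := le_antisymm hz.2 (not_lt.1 fun h2 => h ⟨h0, h2⟩)
    rw [← B.periodic_int i hz k, shear, h1, mul_assoc]

theorem c_shear_congr_of_interior (k : ℤ) {i j : B.ι} {z w : ℂ} (hz0 : 0 < z.im)
    (hz1 : z.im < B.hgt i) (hw : w ∈ B.strip j) (h : B.c i z = B.c j w) :
    B.c i (shear (k * τ) z) = B.c j (shear (k * τ) w) := by
  obtain ⟨rfl, m, hm⟩ := B.inj i j z w hz0 hz1 hw.1 hw.2 h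
  have hi : w.im = z.im := by rw [hm]; simp
  rw [← B.periodic_int i (B.shear_mem (k * τ) ⟨hz0.le, hz1.le⟩) m]
  congr 1
  simp only [shear, hi]
  rw [hm]
  ring

/-- Interior points are identified only by periods, which commute with the shear; boundary points do
not move at all, so identifications among them need not be known. -/
theorem c_shear_congr (k : ℤ) {i j : B.ι} {z w : ℂ} (hz : z ∈ B.strip i)
    (hw : w ∈ B.strip j) (h : B.c i z = B.c j w) :
    B.c i (shear (k * τ) z) = B.c j (shear (k * τ) w) := by
  by_cases h1 : 0 < z.im ∧ z.im < B.hgt i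
  · exact B.c_shear_congr_of_interior k h1.1 h1.2 hw h
  by_cases h2 : 0 < w.im ∧ w.im < B.hgt j
  · exact (B.c_shear_congr_of_interior k h2.1 h2.2 hz h.symm).symm
  rw [B.c_shear_of_boundary k hz h1, B.c_shear_of_boundary k hw h2, h]

/-- The strips cover the space. -/
def Covers : Prop := ∀ x, ∃ i, ∃ z ∈ B.strip i, x = B.c i z

variable {B}

/-- The `k`-fold simultaneous Dehn twist. -/
noncomputable def twist (hB : B.Covers) (k : ℤ) (x : X) : X :=
  B.c (hB x).choose (shear (k * τ) (hB x).choose_spec.choose)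

theorem twist_c (hB : B.Covers) (k : ℤ) {i : B.ι} {z : ℂ} (hz : z ∈ B.strip i) :
    twist hB k (B.c i z) = B.c i (shear (k * τ) z) :=
  B.c_shear_congr k (hB (B.c i z)).choose_spec.choose_spec.1 hz
    (hB (B.c i z)).choose_spec.choose_spec.2.symm

theorem twist_twist_neg (hB : B.Covers) (k : ℤ) (x : X) : twist hB k (twist hB (-k) x) = x := by
  obtain ⟨i, z, hz, rfl⟩ := hB x
  rw [twist_c hB _ hz, twist_c hB _ (B.shear_mem _ hz)]
  push_cast
  rw [neg_mul, shear_shear_neg]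

theorem eventually_shear (s : ℝ) {i : B.ι} {z : ℂ} {Q : ℂ → Prop}
    (h : ∀ᶠ w in 𝓝[B.strip i] (shear s z), Q w) : ∀ᶠ w in 𝓝[B.strip i] z, Q (shear s w) :=
  (((continuous_shear s).continuousWithinAt (s := B.strip i) (x := z)).tendsto_nhdsWithin
    fun _ hw => B.shear_mem s hw).eventually h

section Topology

variable [TopologicalSpace X]

/-- The topology of the space is the one given by the strips. -/
def Generates (B : StripData X τ) : Prop := ∀ U : Set X, IsOpen U ↔ B.cells.OpenIn U

theorem continuous_twist (hB : B.Covers) (hg : B.Generates) (k : ℤ) :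
    Continuous (twist hB k) := by
  refine continuous_def.2 fun U hU => (hg _).2 ?_
  intro i z hz hzU
  have h1 : B.c i (shear (k * τ) z) ∈ U := by
    rw [← twist_c hB k hz]
    exact hzU
  have h2 := eventually_shear (k * τ) ((hg U).1 hU i _ (B.shear_mem (k * τ) hz) h1)
  filter_upwards [h2, eventually_mem_nhdsWithin] with w hw hwS
  show twist hB k (B.c i w) ∈ U
  rw [twist_c hB k hwS]
  exact hw

/-- The twist as a homeomorphism. -/
noncomputable def twistHomeomorph (hB : B.Covers) (hg : B.Generates) (k : ℤ) : X ≃ₜ X where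
  toFun := twist hB k
  invFun := twist hB (-k)
  left_inv x := by
    have := twist_twist_neg hB (-k) x
    rwa [neg_neg] at this
  right_inv x := twist_twist_neg hB k x
  continuous_toFun := continuous_twist hB hg k
  continuous_invFun := continuous_twist hB hg (-k)

/-- If the charts of a translation structure are exactly those that are translations on the
strips, then the twist is affine. -/
theorem isAffineWith_twist (S : TranslationStructure X) (hB : B.Covers) (hg : B.Generates)
    (hS : ∀ e, e ∈ S.charts ↔ B.cells.TransOn e e.source) (k : ℤ) (A : SL(2, ℝ))
    (hA : ∀ z, linAct A z = shear (k * τ) z) :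
    S.IsAffineWith (twistHomeomorph hB hg k) A := by
  -- A chart at `x`, precomposed with the inverse twist and corrected by `A`, is a chart at the
  -- image of `x`.
  have reg : ∀ (k : ℤ) (A : SL(2, ℝ)) (_ : ∀ z, linAct A z = shear (k * τ) z) (x : X),
      S.IsRegular x → S.IsRegular (twist hB k x) := by
    rintro k A hA x ⟨e, he, hx⟩
    let e' : OpenPartialHomeomorph X ℂ :=
      ((twistHomeomorph hB hg k).symm.toOpenPartialHomeomorph.trans e).trans
        (linActHomeomorph A).toOpenPartialHomeomorph
    have hval : ∀ y, e' y = linAct A (e (twist hB (-k) y)) := fun y => rfl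
    have hsrc : ∀ y, y ∈ e'.source ↔ twist hB (-k) y ∈ e.source := by
      intro y
      simp [e', twistHomeomorph]
    refine ⟨e', (hS e').2 ?_, ?_⟩
    · intro i z hz hzs
      have h0 := (hsrc _).1 hzs
      change twist hB (-k) (B.c i z) ∈ e.source at h0
      rw [twist_c hB _ hz] at h0
      have h1 := eventually_shear _ ((hS e).1 he i _ (B.shear_mem _ hz) h0)
      filter_upwards [h1, eventually_mem_nhdsWithin] with w hw hwS
      show e' (B.c i w) - e' (B.c i z) = _
      rw [hval, hval, twist_c hB _ hz, twist_c hB _ hwS, ← linAct_sub]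
      change e (B.c i _) - e (B.c i _) = _ at hw
      rw [hw, shear_sub, hA]
      push_cast
      rw [neg_mul, shear_shear_neg]
    · rw [hsrc]
      have := twist_twist_neg hB (-k) x
      rw [neg_neg] at this
      rwa [this]
  refine ⟨fun x => ⟨fun h => ?_, reg k A hA x⟩, ?_⟩
  · have hA' : ∀ z, linAct A⁻¹ z = shear ((-k : ℤ) * τ) z := by
      intro z
      have h1 : linAct A (shear ((-k : ℤ) * τ) z) = z := by
        rw [hA]
        push_cast
        rw [neg_mul, shear_shear_neg]
      nth_rewrite 1 [← h1]
      rw [← linAct_mul, inv_mul_cancel, linAct_one]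
    have := reg (-k) A⁻¹ hA' _ h
    rwa [show twist hB (-k) ((twistHomeomorph hB hg k) x) = x from
      (twistHomeomorph hB hg k).symm_apply_apply x] at this
  · intro e he e' he' x hx hx'
    let φ := twist hB k
    have hφ : Continuous φ := continuous_twist hB hg k
    -- The affine formula is known only cell by cell. Its locus is open for the strips, hence open
    -- in the space.
    let U : Set X := {y | y ∈ e.source ∧ φ y ∈ e'.source ∧
      e' (φ y) - e' (φ x) = linAct A (e y - e x)}
    have hU : IsOpen U := by
      refine (hg U).2 ?_
      rintro i z hz ⟨h1, h2, h3⟩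
      have h4 : B.c i (shear (k * τ) z) ∈ e'.source := by
        rw [← twist_c hB k hz]
        exact h2
      have h5 := eventually_shear _ ((hS e').1 he' i _ (B.shear_mem _ hz) h4)
      have h6 := (hg _).1 (e.open_source.inter (e'.open_source.preimage hφ)) i z hz ⟨h1, h2⟩
      filter_upwards [h5, h6, (hS e).1 he i z hz h1, eventually_mem_nhdsWithin] with w a b d hwS
      refine ⟨b.1, b.2, ?_⟩
      change e' (φ (B.c i w)) - e' (φ x) = linAct A (e (B.c i w) - e x)
      change e' (φ (B.c i z)) - e' (φ x) = linAct A (e (B.c i z) - e x) at h3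
      have ew : φ (B.c i w) = B.c i (shear (k * τ) w) := twist_c hB k hwS
      have ez : φ (B.c i z) = B.c i (shear (k * τ) z) := twist_c hB k hz
      rw [ez] at h3
      rw [ew]
      change e' (B.c i _) - e' (B.c i _) = _ at a
      change e (B.c i _) - e (B.c i _) = _ at d
      rw [shear_sub, ← hA (w - z), ← d] at a
      have h7 : linAct A (e (B.c i w) - e x) =
          linAct A (e (B.c i w) - e (B.c i z)) + linAct A (e (B.c i z) - e x) := by
        simp only [linAct_sub]
        ring
      rw [h7, ← a, ← h3]
      ring
    filter_upwards [hU.mem_nhds ⟨hx, hx', by simp [linAct, Complex.ext_iff]⟩] with y hy using hy.2.2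

end Topology

end StripData

/-! ### Charts in the interior of the strips, and the height function. -/

namespace StripData

variable {X : Type*} {τ : ℝ} {B : StripData X τ}

section Topology

variable [TopologicalSpace X]

/-- Interior points of a strip have no representatives other than their period translates. The
preimage of the image of `V` in the strips is therefore a union of translates of `V`. -/
theorem isOpen_image (hg : B.Generates) {i : B.ι} {V : Set ℂ} (hV : IsOpen V)
    (hVi : ∀ z ∈ V, 0 < z.im ∧ z.im < B.hgt i) : IsOpen (B.c i '' V) := by
  refine (hg _).2 ?_
  rintro (j : B.ι) w ⟨hw0, hw1⟩ ⟨v, hv, hvw⟩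
  obtain ⟨rfl, m, rfl⟩ := B.inj i j v w (hVi v hv).1 (hVi v hv).2 hw0 hw1 hvw
  refine nhdsWithin_le_nhds ?_
  have hc : Continuous fun w : ℂ => w - ((m * (τ * B.hgt i) : ℝ) : ℂ) := by fun_prop
  have h1 : ∀ᶠ w' in 𝓝 (v + ((m * (τ * B.hgt i) : ℝ) : ℂ)),
      w' - ((m * (τ * B.hgt i) : ℝ) : ℂ) ∈ V :=
    hc.continuousAt.eventually (hV.mem_nhds (by simpa using hv))
  filter_upwards [h1] with w' hw'
  refine ⟨_, hw', ?_⟩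
  have h2 := B.periodic_int i ⟨(hVi _ hw').1.le, (hVi _ hw').2.le⟩ m
  rw [sub_add_cancel] at h2
  exact h2.symm

theorem exists_chart (hτ : 0 < τ) (hg : B.Generates) {i : B.ι} {z : ℂ} (hz0 : 0 < z.im)
    (hz1 : z.im < B.hgt i) :
    ∃ e : OpenPartialHomeomorph X ℂ, B.c i z ∈ e.source ∧ B.cells.TransOn e e.source := by
  have hW : 0 < τ * B.hgt i := mul_pos hτ (B.hgt_pos i)
  set W := τ * B.hgt i with hWdef
  -- An open window one period wide: two of its points differ by less than `W`, so the integer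
  -- provided by `inj` is zero.
  let V : Set ℂ := {w | (0 < w.im ∧ w.im < B.hgt i) ∧ (z.re - W / 2 < w.re ∧ w.re < z.re + W / 2)}
  have hV : IsOpen V :=
    ((isOpen_lt continuous_const Complex.continuous_im).inter
      (isOpen_lt Complex.continuous_im continuous_const)).inter
    ((isOpen_lt continuous_const Complex.continuous_re).inter
      (isOpen_lt Complex.continuous_re continuous_const))
  have hVi : ∀ w ∈ V, 0 < w.im ∧ w.im < B.hgt i := fun w hw => hw.1
  have hinj : Set.InjOn (B.c i) V := by
    intro v hv w hw h
    obtain ⟨-, m, rfl⟩ := B.inj i i v w hv.1.1 hv.1.2 hw.1.1.le hw.1.2.le h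
    have h1 := hw.2.1
    have h2 := hw.2.2
    have h3 := hv.2.1
    have h4 := hv.2.2
    rw [Complex.add_re, Complex.ofReal_re, ← hWdef] at h1 h2
    have h5 : (m : ℝ) < 1 := by nlinarith
    have h6 : (-1 : ℝ) < m := by nlinarith
    have h7 : m = 0 := by
      have h5' : m < 1 := by exact_mod_cast h5
      have h6' : -1 < m := by exact_mod_cast h6
      omega
    simp [h7]
  let E : PartialEquiv ℂ X := hinj.toPartialEquiv
  have hE : E.source = V := rfl
  have hcont : ContinuousOn E E.source := by
    refine continuousOn_iff'.2 fun U hU => ?_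
    refine ⟨(B.c i ⁻¹' U) ∩ V, ?_, ?_⟩
    · rw [isOpen_iff_mem_nhds]
      rintro w ⟨hwU, hwV⟩
      have h1 := (hg U).1 hU i w ⟨hwV.1.1.le, hwV.1.2.le⟩ hwU
      rw [eventually_nhdsWithin_iff] at h1
      filter_upwards [h1, hV.mem_nhds hwV] with w' a b
      exact ⟨a ⟨b.1.1.le, b.1.2.le⟩, b⟩
    · rw [hE, Set.inter_assoc, Set.inter_self]
      rfl
  have hopen : IsOpenMap (E.source.domRestrict E) := by
    intro O hO
    obtain ⟨O', hO', rfl⟩ := isOpen_induced_iff.1 hO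
    have h1 : E.source.domRestrict E '' (Subtype.val ⁻¹' O') = B.c i '' (O' ∩ V) := by
      ext x
      constructor
      · rintro ⟨⟨w, hw⟩, hw', rfl⟩
        exact ⟨w, ⟨hw', hw⟩, rfl⟩
      · rintro ⟨w, ⟨hw', hw⟩, rfl⟩
        exact ⟨⟨w, hw⟩, hw', rfl⟩
    rw [h1]
    exact isOpen_image hg (hO'.inter hV) fun w hw => hVi w hw.2
  let e := (OpenPartialHomeomorph.ofContinuousOpenRestrict E hcont hopen hV).symm
  have hinv : ∀ w ∈ V, e (B.c i w) = w := fun w hw => E.left_inv hw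
  have hzV : z ∈ V := ⟨⟨hz0, hz1⟩, by linarith, by linarith⟩
  refine ⟨e, ⟨z, hzV, rfl⟩, ?_⟩
  rintro (j : B.ι) w ⟨hw0, hw1⟩ ⟨v, hv, hvw⟩
  obtain ⟨rfl, m, rfl⟩ := B.inj i j v w hv.1.1 hv.1.2 hw0 hw1 hvw
  have hval : ∀ u ∈ V, e (B.c i (u + ((m * (τ * B.hgt i) : ℝ) : ℂ))) = u := by
    intro u hu
    rw [B.periodic_int i ⟨hu.1.1.le, hu.1.2.le⟩ m, hinv u hu]
  refine nhdsWithin_le_nhds ?_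
  have hc : Continuous fun w : ℂ => w - ((m * (τ * B.hgt i) : ℝ) : ℂ) := by fun_prop
  have h1 : ∀ᶠ w' in 𝓝 (v + ((m * (τ * B.hgt i) : ℝ) : ℂ)),
      w' - ((m * (τ * B.hgt i) : ℝ) : ℂ) ∈ V :=
    hc.continuousAt.eventually (hV.mem_nhds (by simpa using hv))
  filter_upwards [h1] with w' hw'
  have h2 := hval _ hw'
  rw [sub_add_cancel] at h2
  change e (B.c i w') - e (B.c i _) = _
  rw [h2, hval v hv]
  ring

end Topology

open Classical in
/-- The height of a point above the bottom of its strip, which is `0` for points on the boundary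
of the strips. -/
noncomputable def height (B : StripData X τ) (x : X) : ℝ :=
  if h : ∃ i z, (0 < z.im ∧ z.im < B.hgt i) ∧ x = B.c i z then h.choose_spec.choose.im else 0

theorem height_c {i : B.ι} {z : ℂ} (hz : 0 < z.im ∧ z.im < B.hgt i) : B.height (B.c i z) = z.im := by
  have h : ∃ j w, (0 < w.im ∧ w.im < B.hgt j) ∧ B.c i z = B.c j w := ⟨i, z, hz, rfl⟩
  rw [height, dif_pos h]
  obtain ⟨h1, h2⟩ := h.choose_spec.choose_spec
  obtain ⟨-, m, hm⟩ := B.inj _ _ _ _ hz.1 hz.2 h1.1.le h1.2.le h2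
  rw [hm]
  simp

theorem height_of_not {x : X} (h : ¬ ∃ i z, (0 < z.im ∧ z.im < B.hgt i) ∧ x = B.c i z) :
    B.height x = 0 := dif_neg h

end StripData

/-- A real function which is locally constant to the right, and to the left is locally constant or
drops by at least `η`, is constant or has dropped by at least `η`. -/
theorem eq_or_le_sub_of_local {d : ℝ → ℝ} {η : ℝ} (hη : 0 < η)
    (h : ∀ t₀, ∀ᶠ t in 𝓝 t₀, (t₀ ≤ t → d t = d t₀) ∧ (t ≤ t₀ → d t₀ = d t ∨ d t₀ ≤ d t - η))
    {T : ℝ} (hT : 0 ≤ T) : d T = d 0 ∨ d T ≤ d 0 - η := by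
  let s : Set ℝ := {t | d t = d 0 ∨ d t ≤ d 0 - η}
  -- Real induction along `[0, T]`: both local conditions make `s` closed, and the condition on the
  -- right lets it be continued.
  have hs : IsClosed s := by
    rw [isClosed_iff_frequently]
    intro t₀ ht₀
    obtain ⟨t, ht, h1, h2⟩ := (ht₀.and_eventually (h t₀)).exists
    rcases le_total t₀ t with h3 | h3
    · rw [Set.mem_ofPred_eq, ← h1 h3]
      exact ht
    · rcases ht with ht | ht <;> rcases h2 h3 with h4 | h4
      · exact Or.inl (h4.trans ht)
      · exact Or.inr (by linarith)
      · exact Or.inr (by linarith)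
      · exact Or.inr (by linarith)
  have key : Set.Icc 0 T ⊆ s := by
    refine IsClosed.Icc_subset_of_forall_exists_gt (hs.inter isClosed_Icc) (Or.inl rfl) ?_
    rintro t ⟨ht, -⟩ y hy
    have h1 : ∀ᶠ t' in 𝓝[>] t, t' ∈ Set.Ioc t y := Ioc_mem_nhdsGT hy
    obtain ⟨t', h2, h3⟩ := (h1.and (nhdsWithin_le_nhds (h t))).exists
    refine ⟨t', ?_, h2⟩
    show d t' = d 0 ∨ d t' ≤ d 0 - η
    rw [h3.1 h2.1.le]
    exact ht
  exact key ⟨hT, le_rfl⟩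

/-! ### Closed paths crossing the strips, and the gap for the lower left entries. -/

namespace StripData

variable {X : Type*} {τ : ℝ} {B : StripData X τ}

/-- A closed path that is straight of slope `a > 0` with respect to the strips has to cross one of
them. -/
theorem le_of_closed_path {η a T : ℝ} (hη : 0 < η) (hB : ∀ i, η ≤ B.hgt i) (ha : 0 < a)
    (hT : 0 < T) {γ : ℝ → X} (hγ : γ T = γ 0)
    (hloc : ∀ t₀, ∀ᶠ t in 𝓝 t₀, ∃ j, ∃ z ∈ B.strip j, ∃ w ∈ B.strip j, γ t₀ = B.c j z ∧
      γ t = B.c j w ∧ w.im - z.im = a * (t - t₀)) : η ≤ a * T := by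
  have hsmall : ∀ t₀ δ : ℝ, 0 < δ → ∀ᶠ t in 𝓝 t₀, |a * (t - t₀)| < δ := by
    intro t₀ δ hδ
    have hc : Continuous fun t : ℝ => |a * (t - t₀)| := by fun_prop
    exact hc.continuousAt.eventually (gt_mem_nhds (by simpa using hδ))
  -- The height minus `a t` is constant while the path climbs inside a strip and drops by the height
  -- of the strip when the path reaches its top, since the height is zero on boundaries. Without a
  -- drop, closedness would give `a * T = 0`.
  have key := eq_or_le_sub_of_local (d := fun t => B.height (γ t) - a * t) hη ?_ hT.le
  · simp only [hγ, mul_zero, sub_zero] at key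
    have := mul_pos ha hT
    rcases key with h | h <;> linarith
  intro t₀
  by_cases hinner : ∃ i z, (0 < z.im ∧ z.im < B.hgt i) ∧ γ t₀ = B.c i z
  · obtain ⟨i, z, hz, hγz⟩ := hinner
    filter_upwards [hloc t₀, hsmall t₀ z.im hz.1, hsmall t₀ (B.hgt i - z.im) (by linarith)] with
      t ⟨j, v, hv, w, hw, h1, h2, h3⟩ h4 h5
    obtain ⟨rfl, m, hm⟩ := B.inj i j z v hz.1 hz.2 hv.1 hv.2 (hγz.symm.trans h1)
    have him : v.im = z.im := by rw [hm]; simp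
    rw [abs_lt] at h4 h5
    have e1 : B.height (γ t) = w.im := by
      rw [h2, height_c ⟨by linarith, by linarith⟩]
    have e2 : B.height (γ t₀) = z.im := by rw [hγz, height_c hz]
    have : B.height (γ t) - a * t = B.height (γ t₀) - a * t₀ := by
      rw [e1, e2]
      linarith
    exact ⟨fun _ => this, fun _ => Or.inl this.symm⟩
  · have e0 := height_of_not hinner
    filter_upwards [hloc t₀, hsmall t₀ η hη] with t ⟨j, v, hv, w, hw, h1, h2, h3⟩ h4
    rw [abs_lt] at h4
    have hj := hB j
    have hv' : v.im = 0 ∨ v.im = B.hgt j := by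
      by_contra hcon
      rw [not_or] at hcon
      exact hinner ⟨j, v, ⟨lt_of_le_of_ne hv.1 (Ne.symm hcon.1), lt_of_le_of_ne hv.2 hcon.2⟩, h1⟩
    simp only [e0]
    constructor
    · intro ht
      rcases ht.eq_or_lt with rfl | ht
      · rw [e0]
      have hp : 0 < a * (t - t₀) := mul_pos ha (by linarith)
      -- A rising path can leave a boundary point only from a lower edge, and can arrive at one only
      -- from below an upper edge.
      have hv0 : v.im = 0 := by
        rcases hv' with h | h
        · exact h
        · have := hw.2
          linarith
      rw [h2, height_c ⟨by linarith, by linarith⟩]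
      linarith
    · intro ht
      rcases ht.eq_or_lt with rfl | ht
      · rw [e0]
        exact Or.inl rfl
      have hp : a * (t - t₀) < 0 := mul_neg_of_pos_of_neg ha (by linarith)
      have hv0 : v.im = B.hgt j := by
        rcases hv' with h | h
        · have := hw.1
          linarith
        · exact h
      right
      rw [h2, height_c ⟨by linarith, by linarith⟩]
      linarith

/-- The lower left entries of the derivatives of affine homeomorphisms are bounded away from zero
unless they vanish. -/
theorem affineGroup_gap [TopologicalSpace X] (S : TranslationStructure X) (hτ : 0 < τ) (hg : B.Generates)
    (hS : ∀ e, e ∈ S.charts ↔ B.cells.TransOn e e.source)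
    (hloc : ∀ e ∈ S.charts, ∀ x ∈ e.source, ∀ᶠ y in 𝓝 x, ∃ j, ∃ z ∈ B.strip j, ∃ w ∈ B.strip j,
      x = B.c j z ∧ y = B.c j w ∧ e y - e x = w - z)
    {η : ℝ} (hη : 0 < η) (hB : ∀ i, η ≤ B.hgt i) (i : B.ι) {A : SL(2, ℝ)}
    (hA : A ∈ S.affineGroup) : A.1 1 0 = 0 ∨ η ≤ |A.1 1 0| * (τ * B.hgt i) := by
  obtain ⟨φ, hφ1, hφ2⟩ := hA
  by_cases h0 : A.1 1 0 = 0
  · exact Or.inl h0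
  right
  -- The orientation of the core curve is chosen so that its image climbs.
  obtain ⟨σ, hσ⟩ : ∃ σ : ℝ, (σ = 1 ∨ σ = -1) ∧ σ * A.1 1 0 = |A.1 1 0| := by
    rcases lt_or_gt_of_ne h0 with h | h
    · exact ⟨-1, Or.inr rfl, by rw [abs_of_neg h]; ring⟩
    · exact ⟨1, Or.inl rfl, by rw [abs_of_pos h]; ring⟩
  have hi := B.hgt_pos i
  let z₀ : ℂ := ⟨0, B.hgt i / 2⟩
  -- The core curve of strip `i`, which closes up after the length `τ * B.hgt i`.
  let β : ℝ → ℂ := fun u => z₀ + ((σ * u : ℝ) : ℂ)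
  have hβim : ∀ u, (β u).im = B.hgt i / 2 := fun u => by simp [β, z₀]
  have hβ0 : ∀ u, 0 < (β u).im := fun u => by rw [hβim]; linarith
  have hβ1 : ∀ u, (β u).im < B.hgt i := fun u => by rw [hβim]; linarith
  have hβc : Continuous β := by fun_prop
  have hβmem : ∀ u, β u ∈ B.strip i := fun u => ⟨(hβ0 u).le, (hβ1 u).le⟩
  refine le_of_closed_path (B := B) (γ := fun u => φ (B.c i (β u))) hη hB (abs_pos.2 h0)
    (mul_pos hτ hi) ?_ ?_
  · congr 1
    rcases hσ.1 with rfl | rfl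
    · have := B.periodic_int i (hβmem 0) 1
      rw [← this]
      congr 1
      simp [β]
    · have := B.periodic_int i (hβmem 0) (-1)
      rw [← this]
      congr 1
      simp [β]
  · intro t₀
    obtain ⟨e, hes, het⟩ := exists_chart hτ hg (hβ0 t₀) (hβ1 t₀)
    have he : e ∈ S.charts := (hS e).2 het
    obtain ⟨e', he', hes'⟩ := (hφ1 (B.c i (β t₀))).2 ⟨e, he, hes⟩
    have hcont : Filter.Tendsto (fun u => B.c i (β u)) (𝓝 t₀) (𝓝 (B.c i (β t₀))) := by
      intro U hU
      obtain ⟨O, hOU, hO, hmem⟩ := mem_nhds_iff.1 hU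
      have h1 := (hg O).1 hO i (β t₀) (hβmem t₀) hmem
      rw [eventually_nhdsWithin_iff] at h1
      rw [Filter.mem_map]
      filter_upwards [hβc.continuousAt.eventually h1] with u hu using hOU (hu (hβmem u))
    have h1 := hcont.eventually (hφ2 e he e' he' _ hes hes')
    have h2 := ((φ.continuous.tendsto _).comp hcont).eventually (hloc e' he' _ hes')
    have h3 := het i (β t₀) (hβmem t₀) hes
    rw [eventually_nhdsWithin_iff] at h3
    filter_upwards [h1, h2, hβc.continuousAt.eventually h3] with t a ⟨j, z, hz, w, hw, b1, b2, b3⟩ d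
    refine ⟨j, z, hz, w, hw, b1, b2, ?_⟩
    have d' : e (B.c i (β t)) - e (B.c i (β t₀)) = β t - β t₀ := d (hβmem t)
    rw [d'] at a
    have b3' : e' (φ (B.c i (β t))) - e' (φ (B.c i (β t₀))) = w - z := b3
    rw [a] at b3'
    have h4 := congrArg Complex.im b3'
    rw [Complex.sub_im] at h4
    rw [← h4, ← hσ.2]
    simp [linAct, β]
    ring

end StripData

/-! ### Discreteness in `PSL₂(ℝ)` -/

theorem toPSL_eq_iff {A B : SL(2, ℝ)} (h : toPSL A = toPSL B) :
    ∃ r : ℝ, r ^ 2 = 1 ∧ ∀ i j, B.1 i j = r * A.1 i j := by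
  have h1 : A⁻¹ * B ∈ Subgroup.center SL(2, ℝ) := QuotientGroup.eq.1 h
  obtain ⟨r, hr, hr'⟩ := Matrix.SpecialLinearGroup.mem_center_iff.1 h1
  refine ⟨r, by simpa using hr, fun i j => ?_⟩
  have h2 : B = A * (A⁻¹ * B) := by group
  have h3 : B.1 = A.1 * Matrix.scalar (Fin 2) r := by
    rw [hr']
    exact congrArg Subtype.val h2
  rw [h3]
  simp [mul_comm]

theorem toPSL_eq_one_of_scalar {A : SL(2, ℝ)} (h1 : A.1 0 1 = 0) (h2 : A.1 1 0 = 0)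
    (h3 : A.1 0 0 = A.1 1 1) : toPSL A = 1 := by
  refine (QuotientGroup.eq_one_iff A).2 (Matrix.SpecialLinearGroup.mem_center_iff.2 ⟨A.1 0 0, ?_, ?_⟩)
  · have h := A.2
    rw [Matrix.det_fin_two, h1, ← h3] at h
    simp only [Fintype.card_fin]
    linarith
  · ext i j
    fin_cases i <;> fin_cases j <;> simp [h1, h2, h3]

/-- A group of matrices containing the rotation `R` whose lower left entries do not accumulate at
zero is discrete. -/
theorem isFuchsian_map_of_gap {n : ℕ} (hs : Real.sin (Real.pi / n) ≠ 0)
    (hc : Real.cos (Real.pi / n) ≠ 0) {Λ : Subgroup SL(2, ℝ)}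
    (hR : matR n ∈ Λ) {ε : ℝ} (hε : 0 < ε) (hΛ : ∀ A ∈ Λ, A.1 1 0 = 0 ∨ ε ≤ |A.1 1 0|) :
    IsFuchsian (Λ.map toPSL) := by
  set R := matR n with hRdef
  -- `f k A = 0` says that `A` preserves the line at angle `-kπ/n`. For k = 0, 1, 2 these lines are
  -- distinct because the sine and cosine of `π/n` do not vanish, and a matrix preserving three
  -- lines is scalar.
  let f : ℕ → SL(2, ℝ) → ℝ := fun k A => (R ^ k * A * (R ^ k)⁻¹).1 1 0
  have hf : ∀ k, Continuous (f k) := fun k =>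
    ((continuous_subtype_val (p := fun M : Matrix (Fin 2) (Fin 2) ℝ => M.det = 1)).matrix_elem
      1 0).comp ((continuous_const.mul continuous_id).mul continuous_const)
  let U : Set SL(2, ℝ) := {A | |f 0 A| < ε ∧ |f 1 A| < ε ∧ |f 2 A| < ε}
  have hU : IsOpen U := by
    refine (isOpen_lt (hf 0).abs continuous_const).inter
      ((isOpen_lt (hf 1).abs continuous_const).inter (isOpen_lt (hf 2).abs continuous_const))
  have hV : IsOpen (toPSL '' U) := QuotientGroup.isOpenMap_coe U hU
  have h1U : (1 : SL(2, ℝ)) ∈ U := by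
    have : ∀ k, f k 1 = 0 := fun k => by
      simp only [f, mul_one, mul_inv_cancel]
      simp
    simp [U, this, hε]
  have key : ∀ B ∈ Λ, toPSL B ∈ toPSL '' U → toPSL B = 1 := by
    rintro B hB ⟨A, hA, hAB⟩
    -- `A` need not lie in `Λ`, but it equals `B` up to sign, so the conjugates of `B` have lower
    -- left entries of the same absolute value and the gap applies to them.
    have hz : ∀ k, |f k A| < ε → f k B = 0 := by
      intro k hk
      have h1 : toPSL (R ^ k * A * (R ^ k)⁻¹) = toPSL (R ^ k * B * (R ^ k)⁻¹) := by
        simp only [map_mul, hAB]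
      obtain ⟨r, hr, hr'⟩ := toPSL_eq_iff h1
      have h2 : |f k B| = |f k A| := by
        have : f k B = r * f k A := hr' 1 0
        have hr1 : |r| = 1 := by
          rcases mul_self_eq_one_iff.1 (by rw [← hr]; ring : r * r = 1) with h | h <;> simp [h]
        rw [this, abs_mul, hr1, one_mul]
      rcases hΛ _ (Λ.mul_mem (Λ.mul_mem (Λ.pow_mem hR k) hB) (Λ.inv_mem (Λ.pow_mem hR k))) with
        h | h
      · exact h
      · exact absurd (h.trans_lt (h2.trans_lt hk)) (lt_irrefl _)
    have z0 := hz 0 hA.1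
    have z1 := hz 1 hA.2.1
    have z2 := hz 2 hA.2.2
    set s := Real.sin (Real.pi / n)
    set c := Real.cos (Real.pi / n)
    have hcs : c ^ 2 + s ^ 2 = 1 := Real.cos_sq_add_sin_sq _
    simp only [f, pow_zero, pow_one, pow_two, inv_one, mul_one, one_mul] at z0 z1 z2
    have hR00 : R.1 0 0 = c := rfl
    have hR01 : R.1 0 1 = -s := rfl
    have hR10 : R.1 1 0 = s := rfl
    have hR11 : R.1 1 1 = c := rfl
    simp only [Matrix.SpecialLinearGroup.coe_mul, Matrix.SpecialLinearGroup.coe_inv,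
      Matrix.adjugate_fin_two, Matrix.mul_apply, Fin.sum_univ_two, Matrix.of_apply,
      Matrix.cons_val', Matrix.cons_val_zero, Matrix.cons_val_one, Matrix.empty_val',
      Matrix.cons_val_fin_one, hR00, hR01, hR10, hR11, z0] at z1 z2
    have e1 : c * (B.1 0 0 - B.1 1 1) = s * B.1 0 1 := by
      have : s * (c * (B.1 0 0 - B.1 1 1) - s * B.1 0 1) = 0 := by linear_combination z1
      rcases mul_eq_zero.1 this with h | h
      · exact absurd h hs
      · linarith
    have e2 : B.1 0 0 - B.1 1 1 = 0 := by
      have h5 : (2 * s * c) * ((c ^ 2 - s ^ 2) * (B.1 0 0 - B.1 1 1) - 2 * s * c * B.1 0 1) = 0 := by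
        linear_combination z2
      have h6 : s * (c * (B.1 0 0 - B.1 1 1)) * (c ^ 2 + s ^ 2) = 0 := by
        linear_combination (-1 / 2) * h5 + 2 * s * c ^ 2 * e1
      rw [hcs, mul_one] at h6
      exact (mul_eq_zero.1 ((mul_eq_zero.1 h6).resolve_left hs)).resolve_left hc
    rw [e2, mul_zero] at e1
    exact toPSL_eq_one_of_scalar ((mul_eq_zero.1 e1.symm).resolve_left hs) z0 (by linarith)
  refine discreteTopology_of_isOpen_singleton_one (isOpen_induced_iff.2 ⟨_, hV, ?_⟩)
  ext ⟨x, hx⟩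
  constructor
  · intro h
    obtain ⟨B, hB, rfl⟩ := hx
    exact Subtype.ext (key B hB h)
  · intro h
    have h2 : x = 1 := congrArg Subtype.val h
    subst h2
    exact ⟨1, h1U, map_one _⟩

theorem IsFuchsian.mono {Γ Γ' : Subgroup PSLTwoR} (h : Γ ≤ Γ') (h' : IsFuchsian Γ') :
    IsFuchsian Γ :=
  DiscreteTopology.of_subset (s := (Γ' : Set PSLTwoR)) h' h

/-! ### The triangle group -/

theorem toPSL_neg_one : toPSL (-1) = 1 :=
  toPSL_eq_one_of_scalar (by simp) (by simp) (by simp)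

/-- With `τ` the upper right entry of `T`, the trace of `T R⁻¹` is `2 cos(π/n) - τ sin(π/n) = -2
cos(π/4)`. The sign in the first generator makes this trace positive and the product of the three
generators `-1`. -/
theorem isTriangleGroup_closure (n : ℕ) (hs : Real.sin (Real.pi / n) ≠ 0)
    (hF : IsFuchsian (Subgroup.closure {toPSL (matR n), toPSL (matT n)})) :
    IsTriangleGroup 4 n ⊤ (Subgroup.closure {toPSL (matR n), toPSL (matT n)}) := by
  refine ⟨hF, -(matT n * (matR n)⁻¹), matR n, (matT n)⁻¹, ?_, ?_, ?_, ?_, ?_⟩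
  · rw [neg_mul, inv_mul_cancel_right, neg_mul, mul_inv_cancel]
  · have h4 : piDiv 4 = Real.pi / 4 := by
      change piDiv ((4 : ℕ) : ℕ∞) = _
      simp [piDiv]
    rw [h4, Matrix.SpecialLinearGroup.coe_neg, Matrix.SpecialLinearGroup.coe_mul,
      Matrix.SpecialLinearGroup.coe_inv]
    simp [Matrix.trace_fin_two, matR, matT, Matrix.adjugate_fin_two]
    field_simp
    ring
  · change _ = 2 * Real.cos (Real.pi / n)
    simp [Matrix.trace_fin_two, matR]
    ring
  · have h4 : piDiv ⊤ = 0 := rfl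
    rw [h4, Matrix.SpecialLinearGroup.coe_inv]
    simp [Matrix.trace_fin_two, matT, Matrix.adjugate_fin_two]
    norm_num
  · have hneg : toPSL (-(matT n * (matR n)⁻¹)) = toPSL (matT n) * (toPSL (matR n))⁻¹ := by
      rw [← neg_one_mul, map_mul, toPSL_neg_one, one_mul, map_mul, map_inv]
    rw [hneg, map_inv]
    apply le_antisymm
    · rw [Subgroup.closure_le]
      rintro x (rfl | rfl)
      · exact Subgroup.subset_closure (by simp)
      · rw [← inv_inv (toPSL (matT n))]
        exact Subgroup.inv_mem _ (Subgroup.subset_closure (by simp))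
    · rw [Subgroup.closure_le]
      have hR : toPSL (matR n) ∈ Subgroup.closure {toPSL (matR n), toPSL (matT n)} :=
        Subgroup.subset_closure (by simp)
      have hT : toPSL (matT n) ∈ Subgroup.closure {toPSL (matR n), toPSL (matT n)} :=
        Subgroup.subset_closure (by simp)
      rintro x (rfl | rfl | rfl)
      · exact Subgroup.mul_mem _ hT (Subgroup.inv_mem _ hR)
      · exact hR
      · exact Subgroup.inv_mem _ hT

/-! ### Finite covolume -/

theorem im_specialLinear_smul (g : SL(2, ℝ)) (z : UpperHalfPlane) :
    (g • z).im = z.im / ((g.1 1 0 * z.re + g.1 1 1) ^ 2 + (g.1 1 0 * z.im) ^ 2) := by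
  have h := congrArg Complex.im (UpperHalfPlane.coe_specialLinearGroup_apply g z)
  have hd := g.2
  rw [Matrix.det_fin_two] at hd
  rw [UpperHalfPlane.coe_im] at h
  rw [h, Complex.div_im]
  simp only [Complex.normSq_apply, Complex.add_re, Complex.add_im, Complex.mul_re, Complex.mul_im,
    Algebra.algebraMap_self, RingHom.id_apply, Complex.ofReal_re, Complex.ofReal_im,
    UpperHalfPlane.coe_re, UpperHalfPlane.coe_im, zero_mul, sub_zero, add_zero]
  rw [← sub_div]
  congr 1
  · linear_combination z.im * hd
  · ring

theorem coe_matT_zpow_smul (n : ℕ) (m : ℤ) (z : UpperHalfPlane) :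
    ((matT n ^ m • z : UpperHalfPlane) : ℂ) =
      z + ((m * (matT n).1 0 1 : ℝ) : ℂ) := by
  have key : ∀ z : UpperHalfPlane, ((matT n • z : UpperHalfPlane) : ℂ) =
      z + (((matT n).1 0 1 : ℝ) : ℂ) := by
    intro z
    rw [UpperHalfPlane.coe_specialLinearGroup_apply]
    simp [matT]
  have key2 : ∀ m : ℤ, ((matT n ^ (m + 1) • z : UpperHalfPlane) : ℂ) =
      ((matT n ^ m • z : UpperHalfPlane) : ℂ) + (((matT n).1 0 1 : ℝ) : ℂ) := by
    intro m
    rw [← key, smul_smul, add_comm, zpow_one_add]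
  induction m with
  | zero => simp
  | succ m ih =>
    rw [key2, ih]
    push_cast
    ring
  | pred m ih =>
    have := key2 (-m - 1)
    rw [sub_add_cancel, ih] at this
    push_cast at this ⊢
    linear_combination -this

/-- A vertical half strip in the upper half plane. -/
def cuspRegion (w : ℝ) : Set UpperHalfPlane := {z | |z.re| ≤ w / 2 ∧ 1 / 2 ≤ z.im}

theorem measurableSet_cuspRegion (w : ℝ) : MeasurableSet (cuspRegion w) := by
  have h1 : Continuous fun z : UpperHalfPlane => |z.re| := by fun_prop
  exact ((isClosed_le h1 continuous_const).inter
    (isClosed_le continuous_const UpperHalfPlane.continuous_im)).measurableSet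

theorem volume_cuspRegion_lt_top (w : ℝ) : MeasureTheory.volume (cuspRegion w) < ⊤ := by
  rw [UpperHalfPlane.volume_eq_lintegral]
  -- The region lies in a product set, over which the hyperbolic area is a width times the integral
  -- of `y⁻²` from 1/2 to infinity.
  have himg : UpperHalfPlane.coe '' cuspRegion w ⊆
      Complex.measurableEquivRealProd ⁻¹' (Set.Icc (-(w / 2)) (w / 2) ×ˢ Set.Ici (1 / 2 : ℝ)) := by
    rintro _ ⟨z, ⟨h1, h2⟩, rfl⟩
    exact ⟨abs_le.1 h1, h2⟩
  refine (MeasureTheory.lintegral_mono_set himg).trans_lt ?_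
  let f : ℝ × ℝ → ENNReal := fun q => ((1 / ‖q.2‖₊) ^ 2 : NNReal)
  have h1 := (Complex.volume_preserving_equiv_real_prod.setLIntegral_comp_preimage_emb
    Complex.measurableEquivRealProd.measurableEmbedding f
    (Set.Icc (-(w / 2)) (w / 2) ×ˢ Set.Ici (1 / 2 : ℝ)))
  have h2 : (fun z : ℂ => (((1 / ‖z.im‖₊) ^ 2 : NNReal) : ENNReal)) =
      fun z => f (Complex.measurableEquivRealProd z) := by
    funext z
    rfl
  rw [h2, h1, MeasureTheory.Measure.volume_eq_prod, ← MeasureTheory.Measure.prod_restrict]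
  let g : ℝ → ENNReal := fun y => ((1 / ‖y‖₊) ^ 2 : NNReal)
  have hgm : Measurable g := by fun_prop
  have h3 := MeasureTheory.lintegral_prod_mul
    (μ := MeasureTheory.volume.restrict (Set.Icc (-(w / 2)) (w / 2)))
    (ν := MeasureTheory.volume.restrict (Set.Ici (1 / 2 : ℝ)))
    (f := fun _ => (1 : ENNReal)) (g := g) aemeasurable_const hgm.aemeasurable
  simp only [one_mul] at h3
  change ∫⁻ q : ℝ × ℝ, g q.2 ∂_ < ⊤
  rw [h3]
  refine ENNReal.mul_lt_top ?_ ?_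
  · simp
  · have h4 : MeasureTheory.IntegrableOn (fun y : ℝ => y ^ (-2 : ℝ)) (Set.Ioi (1 / 2)) :=
      integrableOn_Ioi_rpow_of_lt (by norm_num) (by norm_num)
    have h5 := h4.hasFiniteIntegral
    rw [MeasureTheory.restrict_Ioi_eq_restrict_Ici, MeasureTheory.HasFiniteIntegral] at h5
    refine lt_of_le_of_lt (MeasureTheory.setLIntegral_mono' measurableSet_Ici fun y hy => ?_) h5
    have hy0 : (0 : ℝ) < y := lt_of_lt_of_le (by norm_num) hy
    have h6 : (1 / ‖y‖₊) ^ 2 = ‖y ^ (-2 : ℝ)‖₊ := by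
      ext
      rw [Real.rpow_neg hy0.le, Real.rpow_two]
      simp
    simp only [g, h6]
    rfl

/-- Every point of the upper half plane can be moved into the cusp region by the group generated
by `R` and `T`. -/
theorem exists_smul_mem_cuspRegion (n : ℕ) (hs : 0 < Real.sin (Real.pi / n))
    (hc : Real.cos (Real.pi / 4) ≤ Real.cos (Real.pi / n)) {Λ : Subgroup SL(2, ℝ)}
    (hR : matR n ∈ Λ) (hT : matT n ∈ Λ) (z : UpperHalfPlane) :
    ∃ g ∈ Λ, g • z ∈ cuspRegion ((matT n).1 0 1) := by
  set s := Real.sin (Real.pi / n) with hsdef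
  set c := Real.cos (Real.pi / n) with hcdef
  have hcs : c ^ 2 + s ^ 2 = 1 := Real.cos_sq_add_sin_sq _
  set k := Real.cos (Real.pi / 4) with hkdef
  have hk : 0 < k := Real.cos_pos_of_mem_Ioo ⟨by linarith [Real.pi_pos], by linarith [Real.pi_pos]⟩
  have hc0 : 0 < c := hk.trans_le hc
  set τ := (matT n).1 0 1 with hτdef
  have hτ : τ = 2 * ((c + k) / s) := rfl
  have hτs : τ * s = 2 * (c + k) := by
    rw [hτ]
    field_simp
  have hτ0 : 0 < τ := by
    rw [hτ]
    positivity
  have hcent : ∀ z : UpperHalfPlane, ∃ g ∈ Λ, |(g • z).re| ≤ τ / 2 ∧ (g • z).im = z.im := by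
    intro z
    refine ⟨matT n ^ (-round (z.re / τ)), Λ.zpow_mem hT _, ?_, ?_⟩
    · have h1 := congrArg Complex.re (coe_matT_zpow_smul n (-round (z.re / τ)) z)
      rw [UpperHalfPlane.coe_re, Complex.add_re, Complex.ofReal_re, UpperHalfPlane.coe_re,
        ← hτdef] at h1
      rw [h1]
      have h2 := abs_sub_round (z.re / τ)
      have h3 : z.re + ((-round (z.re / τ) : ℤ) : ℝ) * τ = (z.re / τ - round (z.re / τ)) * τ := by
        push_cast
        field_simp
        ring
      rw [h3, abs_mul, abs_of_pos hτ0]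
      nlinarith
    · have h1 := congrArg Complex.im (coe_matT_zpow_smul n (-round (z.re / τ)) z)
      rw [UpperHalfPlane.coe_im, Complex.add_im, Complex.ofReal_im, UpperHalfPlane.coe_im,
        add_zero] at h1
      exact h1
  -- `q` bounds the square of the modulus of the denominator of `R⁻¹` (if `re ≥ 0`) or of `R` (if
  -- `re ≤ 0`) at points with `|re| ≤ τ / 2` and `im ≤ 1 / 2`. Indeed `s * τ / 2 = c + k ≤ 2 * c`
  -- gives `(s * |re| - c) ^ 2 ≤ c ^ 2`; this is where `k ≤ c` enters.
  set q := c ^ 2 + s ^ 2 / 4 with hq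
  have hq0 : 0 < q := by positivity
  have hq1 : q < 1 := by
    have : 0 < s ^ 2 := by positivity
    linarith
  have hstep : ∀ z : UpperHalfPlane, z.im < 1 / 2 → ∃ g ∈ Λ, q⁻¹ * z.im ≤ (g • z).im := by
    intro z hz
    obtain ⟨g, hg, hg1, hg2⟩ := hcent z
    set y := g • z with hy
    have hy0 := y.im_pos
    have key : ∀ σ : ℝ, (σ = 1 ∨ σ = -1) → 0 ≤ σ * y.re →
        (s * y.re - σ * c) ^ 2 + (s * y.im) ^ 2 ≤ q := by
      intro σ hσ h0
      have hσ2 : σ * σ = 1 := by rcases hσ with rfl | rfl <;> norm_num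
      have h1 : σ * y.re ≤ τ / 2 := by
        rcases hσ with rfl | rfl
        · linarith [(abs_le.1 hg1).2]
        · linarith [(abs_le.1 hg1).1]
      have h2 : (s * y.re - σ * c) ^ 2 = (s * (σ * y.re) - c) ^ 2 := by
        linear_combination (c ^ 2 - s ^ 2 * y.re ^ 2) * hσ2
      have h3 : (s * (σ * y.re) - c) ^ 2 ≤ c ^ 2 := by
        apply sq_le_sq'
        · nlinarith
        · nlinarith
      have h4 : (s * y.im) ^ 2 ≤ s ^ 2 / 4 := by
        have : s * y.im ≤ s / 2 := by nlinarith
        have h5 : 0 ≤ s * y.im := by positivity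
        nlinarith
      rw [h2]
      linarith
    have hfin : ∀ A ∈ Λ, (A.1 1 0 * y.re + A.1 1 1) ^ 2 + (A.1 1 0 * y.im) ^ 2 ≤ q →
        0 < (A.1 1 0 * y.re + A.1 1 1) ^ 2 + (A.1 1 0 * y.im) ^ 2 →
        ∃ g ∈ Λ, q⁻¹ * z.im ≤ (g • z).im := by
      intro A hA h1 h2
      refine ⟨A * g, Λ.mul_mem hA hg, ?_⟩
      rw [mul_smul, ← hy, im_specialLinear_smul, ← hg2, div_eq_mul_inv, mul_comm]
      exact mul_le_mul_of_nonneg_left (inv_anti₀ h2 h1) hy0.le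
    rcases le_total 0 y.re with h | h
    · refine hfin (matR n)⁻¹ (Λ.inv_mem hR) ?_ ?_ <;>
      rw [Matrix.SpecialLinearGroup.coe_inv, Matrix.adjugate_fin_two] <;>
      simp only [matR, Matrix.of_apply, Matrix.cons_val', Matrix.cons_val_zero, Matrix.cons_val_one,
        Matrix.cons_val_fin_one, ← hsdef, ← hcdef]
      · have := key 1 (Or.inl rfl) (by linarith)
        nlinarith
      · have : 0 < (s * y.im) ^ 2 := by positivity
        nlinarith [sq_nonneg (-s * y.re + c)]
    · refine hfin (matR n) hR ?_ ?_ <;>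
      simp only [matR, Matrix.of_apply, Matrix.cons_val', Matrix.cons_val_zero, Matrix.cons_val_one,
        Matrix.cons_val_fin_one, ← hsdef, ← hcdef]
      · have := key (-1) (Or.inr rfl) (by linarith)
        nlinarith
      · have : 0 < (s * y.im) ^ 2 := by positivity
        nlinarith [sq_nonneg (s * y.re + c)]
  -- Below height 1/2 each step multiplies the imaginary part by at least `q⁻¹ > 1`, so that height
  -- is passed after finitely many steps.
  have hiter : ∀ m : ℕ, ∃ g ∈ Λ, 1 / 2 ≤ (g • z).im ∨ (q⁻¹) ^ m * z.im ≤ (g • z).im := by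
    intro m
    induction m with
    | zero => exact ⟨1, Λ.one_mem, Or.inr (by simp)⟩
    | succ m ih =>
      obtain ⟨g, hg, h | h⟩ := ih
      · exact ⟨g, hg, Or.inl h⟩
      · by_cases h1 : 1 / 2 ≤ (g • z).im
        · exact ⟨g, hg, Or.inl h1⟩
        · obtain ⟨g', hg', h2⟩ := hstep (g • z) (not_le.1 h1)
          refine ⟨g' * g, Λ.mul_mem hg' hg, Or.inr ?_⟩
          rw [mul_smul, pow_succ, mul_comm _ q⁻¹, mul_assoc]
          exact (mul_le_mul_of_nonneg_left h (inv_pos.2 hq0).le).trans h2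
  obtain ⟨m, hm⟩ := pow_unbounded_of_one_lt (1 / 2 / z.im) ((one_lt_inv₀ hq0).2 hq1)
  have hz0 := z.im_pos
  obtain ⟨g, hg, h⟩ := hiter m
  have h' : 1 / 2 ≤ (g • z).im := by
    rcases h with h | h
    · exact h
    · rw [div_lt_iff₀ hz0] at hm
      exact hm.le.trans h
  obtain ⟨g', hg', h1, h2⟩ := hcent (g • z)
  refine ⟨g' * g, Λ.mul_mem hg' hg, ?_⟩
  rw [mul_smul]
  exact ⟨h1, h2 ▸ h'⟩

/-! ### Unfoldings decomposed into horizontal strips -/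

section UnfoldingStrips

variable {N : ℕ} [NeZero N] {P : Set ℂ} {p : Fin N → ℂ} [Nonempty P] {τ : ℝ}
  {B : StripData (Unfolding P p) τ}

theorem StripData.covers_of_refines (h : (unfoldingCells P p).Refines B.cells) : B.Covers := by
  intro x
  obtain ⟨g, y, rfl⟩ := Unfolding.exists_mk x
  obtain ⟨j, w, hw, h1⟩ := h.exists_eq (unfoldingCells_mem g y)
  rw [unfoldingCells_c] at h1
  exact ⟨j, w, hw, h1⟩

theorem StripData.generates_of_refines (h : (unfoldingCells P p).Refines B.cells)
    (h' : B.cells.Refines (unfoldingCells P p)) : B.Generates := fun _ =>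
  ⟨fun hU => h'.openIn (isOpen_iff_openIn.1 hU), fun hU => isOpen_iff_openIn.2 (h.openIn hU)⟩

theorem StripData.charts_of_refines (h : (unfoldingCells P p).Refines B.cells)
    (h' : B.cells.Refines (unfoldingCells P p)) (e : OpenPartialHomeomorph (Unfolding P p) ℂ) :
    e ∈ (unfoldingStructure P p).charts ↔ B.cells.TransOn e e.source :=
  ⟨fun he => h'.transOn (isTranslationChart_iff.1 he),
    fun he => isTranslationChart_iff.2 (h.transOn he)⟩

theorem StripData.mem_affineGroup_of_refines (h : (unfoldingCells P p).Refines B.cells)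
    (h' : B.cells.Refines (unfoldingCells P p)) {A : SL(2, ℝ)}
    (hA : ∀ z, linAct A z = shear τ z) : A ∈ (unfoldingStructure P p).affineGroup :=
  ⟨_, StripData.isAffineWith_twist _ (StripData.covers_of_refines h)
    (StripData.generates_of_refines h h') (StripData.charts_of_refines h h') 1 A
    (by simpa using hA)⟩

/-- One core curve is enough: the gap is `η` divided by the circumference of an arbitrary strip.
Finiteness of the group and `htr` guarantee that a neighbourhood of a point is swept out by finitely
many polygons, so that nearby points share a strip with it. -/
theorem StripData.gap_of_refines (h : (unfoldingCells P p).Refines B.cells)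
    (h' : B.cells.Refines (unfoldingCells P p)) [Finite (reflectionGroup p)]
    (htr : ∀ a b, UnfoldRel P p a b → a.2 = b.2 ∧
      (a.1 = b.1 ∨ ∃ i, a.2.1 ∈ side p i ∧ b.1.1 = a.1.1 * sideReflection p i))
    (hτ : 0 < τ) {η : ℝ} (hη : 0 < η) (hB : ∀ i, η ≤ B.hgt i) :
    ∃ ε : ℝ, 0 < ε ∧ ∀ A ∈ (unfoldingStructure P p).affineGroup,
      A.1 1 0 = 0 ∨ ε ≤ |A.1 1 0| := by
  obtain ⟨x⟩ := ‹Nonempty P›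
  obtain ⟨i, -⟩ := StripData.covers_of_refines h (Unfolding.mk 1 x)
  have hW : 0 < τ * B.hgt i := mul_pos hτ (B.hgt_pos i)
  refine ⟨η / (τ * B.hgt i), div_pos hη hW, fun A hA => ?_⟩
  have key := StripData.affineGroup_gap (unfoldingStructure P p) hτ
    (StripData.generates_of_refines h h') (StripData.charts_of_refines h h') ?_ hη hB i hA
  · rcases key with h1 | h1
    · exact Or.inl h1
    · exact Or.inr ((div_le_iff₀ hW).2 h1)
  · intro e he x hx
    obtain ⟨g₀, y₀, rfl⟩ := Unfolding.exists_mk x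
    have hQ : ∀ g, Unfolding.mk g y₀ = Unfolding.mk g₀ y₀ → ∀ᶠ y in 𝓝 y₀,
        ∃ j, ∃ z ∈ B.strip j, ∃ w ∈ B.strip j, Unfolding.mk g y₀ = B.c j z ∧
          Unfolding.mk g y = B.c j w ∧
          e (Unfolding.mk g y) - e (Unfolding.mk g y₀) = w - z := by
      intro g hg
      have h1 := he g y₀ (hg ▸ hx)
      have h2 := (unfoldingCells_eventually g y₀ _).1
        (h.eventually (unfoldingCells_mem g y₀) (Q := fun _ _ _ => True) (fun _ _ _ _ => by simp))
      filter_upwards [h1, h2] with y a ⟨j, t, b1, b2, b3, b4, _⟩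
      rw [unfoldingCells_c] at b3 b4
      refine ⟨j, _, b1, _, b2, b3, b4, ?_⟩
      rw [a]
      ring
    filter_upwards [Unfolding.eventually_nhds htr g₀ y₀ hQ] with y
      ⟨g, y', h1, h2, j, z, hz, w, hw, h3, h4, h5⟩
    subst h2
    rw [h1] at h3 h5
    exact ⟨j, z, hz, w, hw, h3, h4, h5⟩

end UnfoldingStrips

/-! ### Directions that are multiples of `π / n` -/

/-- The angle `j π / n`. -/
noncomputable def ang (n : ℕ) (j : ℤ) : ℝ := j * (Real.pi / n)

/-- The unit vector making the angle `j π / n` with the downward vertical. -/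
noncomputable def nv (n : ℕ) (j : ℤ) : ℂ := ⟨Real.sin (ang n j), -Real.cos (ang n j)⟩

/-- The unit vector making the angle `j π / n` with the horizontal. -/
noncomputable def tv (n : ℕ) (j : ℤ) : ℂ := ⟨Real.cos (ang n j), Real.sin (ang n j)⟩

/-- The Euclidean scalar product of the plane. -/
def dot (z w : ℂ) : ℝ := z.re * w.re + z.im * w.im

theorem ang_zero (n : ℕ) : ang n 0 = 0 := by simp [ang]

theorem ang_one (n : ℕ) : ang n 1 = Real.pi / n := by simp [ang]

theorem ang_add (n : ℕ) (i j : ℤ) : ang n (i + j) = ang n i + ang n j := by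
  simp only [ang]
  push_cast
  ring

theorem ang_sub (n : ℕ) (i j : ℤ) : ang n (i - j) = ang n i - ang n j := by
  simp only [ang]
  push_cast
  ring

theorem ang_neg (n : ℕ) (j : ℤ) : ang n (-j) = -ang n j := by
  simp only [ang]
  push_cast
  ring

section

variable {n : ℕ}

theorem ang_self (hn : 0 < n) : ang n n = Real.pi := by
  have : (n : ℝ) ≠ 0 := by positivity
  simp only [ang, Int.cast_natCast]
  field_simp

theorem ang_add_two_mul (hn : 0 < n) (j m : ℤ) :
    ang n (j + 2 * n * m) = ang n j + m * (2 * Real.pi) := by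
  have : (n : ℝ) ≠ 0 := by positivity
  simp only [ang]
  push_cast
  field_simp

theorem cos_ang_congr (hn : 0 < n) {i j : ℤ} (h : (2 * n : ℤ) ∣ i - j) :
    Real.cos (ang n i) = Real.cos (ang n j) := by
  obtain ⟨m, hm⟩ := h
  rw [show i = j + 2 * n * m by linarith, ang_add_two_mul hn, Real.cos_add_int_mul_two_pi]

theorem sin_ang_congr (hn : 0 < n) {i j : ℤ} (h : (2 * n : ℤ) ∣ i - j) :
    Real.sin (ang n i) = Real.sin (ang n j) := by
  obtain ⟨m, hm⟩ := h
  rw [show i = j + 2 * n * m by linarith, ang_add_two_mul hn, Real.sin_add_int_mul_two_pi]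

theorem nv_congr (hn : 0 < n) {i j : ℤ} (h : (2 * n : ℤ) ∣ i - j) : nv n i = nv n j := by
  simp only [nv, cos_ang_congr hn h, sin_ang_congr hn h]

theorem tv_congr (hn : 0 < n) {i j : ℤ} (h : (2 * n : ℤ) ∣ i - j) : tv n i = tv n j := by
  simp only [tv, cos_ang_congr hn h, sin_ang_congr hn h]

theorem cos_ang_add_self (hn : 0 < n) (j : ℤ) :
    Real.cos (ang n (j + n)) = -Real.cos (ang n j) := by
  rw [ang_add, ang_self hn, Real.cos_add_pi]

theorem sin_ang_add_self (hn : 0 < n) (j : ℤ) :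
    Real.sin (ang n (j + n)) = -Real.sin (ang n j) := by
  rw [ang_add, ang_self hn, Real.sin_add_pi]

theorem cos_ang_self_sub (hn : 0 < n) (j : ℤ) :
    Real.cos (ang n (n - j)) = -Real.cos (ang n j) := by
  rw [ang_sub, ang_self hn, Real.cos_pi_sub]

theorem sin_ang_self_sub (hn : 0 < n) (j : ℤ) :
    Real.sin (ang n (n - j)) = Real.sin (ang n j) := by
  rw [ang_sub, ang_self hn, Real.sin_pi_sub]

theorem nv_add_self (hn : 0 < n) (j : ℤ) : nv n (j + n) = -nv n j := by
  apply Complex.ext <;> simp [nv, cos_ang_add_self hn, sin_ang_add_self hn]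

theorem tv_add_self (hn : 0 < n) (j : ℤ) : tv n (j + n) = -tv n j := by
  apply Complex.ext <;> simp [tv, cos_ang_add_self hn, sin_ang_add_self hn]

theorem sin_ang_nonneg (hn : 0 < n) {j : ℤ} (h0 : 0 ≤ j) (h1 : j ≤ n) :
    0 ≤ Real.sin (ang n j) := by
  have hn' : (0 : ℝ) < n := by exact_mod_cast hn
  apply Real.sin_nonneg_of_nonneg_of_le_pi
  · have : (0 : ℝ) ≤ j := by exact_mod_cast h0
    unfold ang
    have := Real.pi_pos
    positivity
  · rw [← ang_self hn]
    have : (j : ℝ) ≤ n := by exact_mod_cast h1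
    unfold ang
    have := Real.pi_pos
    gcongr

theorem sin_ang_pos (hn : 0 < n) {j : ℤ} (h0 : 0 < j) (h1 : j < n) :
    0 < Real.sin (ang n j) := by
  have hn' : (0 : ℝ) < n := by exact_mod_cast hn
  apply Real.sin_pos_of_pos_of_lt_pi
  · have : (0 : ℝ) < j := by exact_mod_cast h0
    unfold ang
    have := Real.pi_pos
    positivity
  · rw [← ang_self hn]
    have : (j : ℝ) < n := by exact_mod_cast h1
    unfold ang
    have := Real.pi_pos
    have h2 : 0 < Real.pi / n := by positivity
    push_cast
    nlinarith

theorem cos_ang_le (hn : 0 < n) {j : ℤ} (hj : ¬ (2 * n : ℤ) ∣ j) :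
    Real.cos (ang n j) ≤ Real.cos (ang n 1) := by
  have hn' : (0 : ℝ) < n := by exact_mod_cast hn
  have hθ : 0 < Real.pi / n := div_pos Real.pi_pos hn'
  have key : ∀ r : ℤ, 1 ≤ r → r ≤ n → Real.cos (ang n r) ≤ Real.cos (ang n 1) := by
    intro r h1 h2
    have h1' : (1 : ℝ) ≤ r := by exact_mod_cast h1
    have h2' : (r : ℝ) ≤ n := by exact_mod_cast h2
    apply Real.cos_le_cos_of_nonneg_of_le_pi
    · rw [ang_one]
      exact hθ.le
    · rw [← ang_self hn]
      unfold ang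
      push_cast
      nlinarith
    · unfold ang
      push_cast
      nlinarith
  have hpos : (0 : ℤ) < 2 * n := by omega
  have h0 : 0 ≤ j % (2 * n) := Int.emod_nonneg _ hpos.ne'
  have h1 : j % (2 * n) < 2 * n := Int.emod_lt_of_pos _ hpos
  have h2 : j % (2 * n) ≠ 0 := fun h => hj (Int.dvd_of_emod_eq_zero h)
  have h3 : (2 * n : ℤ) ∣ j - j % (2 * n) := Int.dvd_self_sub_emod
  rw [cos_ang_congr hn h3]
  rcases le_or_gt (j % (2 * n)) n with h4 | h4
  · exact key _ (by omega) h4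
  · rw [← Real.cos_neg, ← ang_neg]
    have h5 : (2 * n : ℤ) ∣ -(j % (2 * n)) - (2 * n - j % (2 * n)) := ⟨-1, by ring⟩
    rw [cos_ang_congr hn h5]
    exact key _ (by omega) (by omega)

/-- For odd index differences the angle is at least `π/n`. This discards all but two of the
inequalities defining a polygon. -/
theorem cos_ang_le_of_odd (hn : 0 < n) {j : ℤ} (hj : Odd j) :
    Real.cos (ang n j) ≤ Real.cos (ang n 1) := by
  refine cos_ang_le hn fun h => ?_
  have h2 : (2 : ℤ) ∣ j := dvd_trans (Dvd.intro _ rfl) h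
  exact (Int.not_even_iff_odd.2 hj) (even_iff_two_dvd.2 h2)

theorem nv_add_one (j : ℤ) : nv n (j + 1) =
    Real.cos (ang n 1) * nv n j + Real.sin (ang n 1) * tv n j := by
  apply Complex.ext <;> simp [nv, tv, ang_add, Real.cos_add, Real.sin_add, -Complex.ofReal_cos,
    -Complex.ofReal_sin] <;> ring

theorem nv_sub_one (j : ℤ) : nv n (j - 1) =
    Real.cos (ang n 1) * nv n j - Real.sin (ang n 1) * tv n j := by
  apply Complex.ext <;> simp [nv, tv, ang_sub, Real.cos_sub, Real.sin_sub, -Complex.ofReal_cos,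
    -Complex.ofReal_sin] <;> ring

theorem dot_add_left (z z' w : ℂ) : dot (z + z') w = dot z w + dot z' w := by
  simp [dot]
  ring

theorem dot_mul_left (a : ℝ) (z w : ℂ) : dot (a * z) w = a * dot z w := by
  simp [dot]
  ring

theorem dot_nv_nv (i j : ℤ) : dot (nv n i) (nv n j) = Real.cos (ang n (i - j)) := by
  simp only [dot, nv, ang_sub, Real.cos_sub]
  ring

/-- Every vector is a non-negative combination of two neighbouring directions. -/
theorem exists_chamber (hn : 2 ≤ n) (z : ℂ) :
    ∃ (e : ℤ) (a b : ℝ), 0 ≤ a ∧ 0 ≤ b ∧ z = a * nv n e + b * nv n (e - 1) := by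
  have hn' : (0 : ℝ) < n := by positivity
  set θ := Real.pi / n with hθ
  have hθ0 : 0 < θ := div_pos Real.pi_pos hn'
  have hs : 0 < Real.sin (ang n 1) := sin_ang_pos (by omega) one_pos (by exact_mod_cast hn)
  -- Multiplication by `I` takes `nv` to `tv`, that is, it turns angles from the downward vertical
  -- into arguments.
  set φ := Complex.arg (Complex.I * z)
  set r := ‖Complex.I * z‖
  set f := ⌊φ / θ⌋
  set ψ := φ - f * θ with hψ
  have h1 : (f : ℝ) ≤ φ / θ := Int.floor_le _
  have h2 : φ / θ < f + 1 := Int.lt_floor_add_one _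
  rw [le_div_iff₀ hθ0] at h1
  rw [div_lt_iff₀ hθ0] at h2
  have h3 : 0 ≤ ψ := by linarith
  have h4 : ψ ≤ θ := by linarith
  have hπ : θ ≤ Real.pi := div_le_self Real.pi_pos.le (by exact_mod_cast (by omega : 1 ≤ n))
  have hz : Complex.I * z = r * (Real.cos φ + Real.sin φ * Complex.I) := by
    rw [Complex.ofReal_cos, Complex.ofReal_sin]
    exact (Complex.norm_mul_cos_add_sin_mul_I (Complex.I * z)).symm
  have hzre := congrArg Complex.re hz
  have hzim := congrArg Complex.im hz
  simp only [Complex.mul_re, Complex.mul_im, Complex.I_re, Complex.I_im, Complex.add_re,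
    Complex.add_im, Complex.ofReal_re, Complex.ofReal_im] at hzre hzim
  have hφ : φ = ang n f + ψ := by
    simp only [hψ, ang]
    ring
  have h1a : ang n 1 = θ := ang_one n
  -- The coordinates along the two walls are given by the sine rule.
  refine ⟨f + 1, r * Real.sin ψ / Real.sin (ang n 1), r * Real.sin (θ - ψ) / Real.sin (ang n 1),
    ?_, ?_, ?_⟩
  · have := Real.sin_nonneg_of_nonneg_of_le_pi h3 (h4.trans hπ)
    positivity
  · have := Real.sin_nonneg_of_nonneg_of_le_pi (x := θ - ψ) (by linarith) (by linarith)
    positivity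
  · rw [add_sub_cancel_right]
    rw [hφ, Real.cos_add] at hzre
    rw [hφ, Real.sin_add] at hzim
    apply Complex.ext
    · simp only [nv, Complex.add_re, Complex.mul_re, Complex.ofReal_re, Complex.ofReal_im, zero_mul,
        sub_zero, ang_add, Real.sin_add, h1a, Real.sin_sub]
      rw [h1a] at hs
      field_simp
      linear_combination Real.sin θ * hzim
    · simp only [nv, Complex.add_im, Complex.mul_im, Complex.ofReal_re, Complex.ofReal_im, zero_mul,
        add_zero, ang_add, Real.cos_add, h1a, Real.sin_sub]
      rw [h1a] at hs
      field_simp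
      linear_combination (-Real.sin θ) * hzre

/-- The cross product of the plane. -/
def cross (z w : ℂ) : ℝ := z.re * w.im - z.im * w.re

theorem cross_nv_nv (i j : ℤ) : cross (nv n i) (nv n j) = Real.sin (ang n (j - i)) := by
  simp only [cross, nv, ang_sub, Real.sin_sub]
  ring

theorem cross_comb (u v w : ℂ) (a b : ℝ) :
    cross u (a * v + b * w) = a * cross u v + b * cross u w := by
  simp [cross]
  ring

/-- The chamber of `e'` is `d` steps beyond that of `e`, at most half a turn. The cross product with
`nv n (e' - 1)` is then non-positive on one side of the equation and non-negative on the other, so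
every term vanishes. -/
theorem chamber_unique_aux (hn : 3 ≤ n) {e e' d : ℤ} (hd : (2 * n : ℤ) ∣ e' - e - d) (h1 : 1 ≤ d)
    (h2 : d ≤ n) {a b a' b' : ℝ} (ha : 0 ≤ a) (hb : 0 ≤ b) (ha' : 0 ≤ a') (hb' : 0 ≤ b')
    (h : (a * nv n e + b * nv n (e - 1) : ℂ) = a' * nv n e' + b' * nv n (e' - 1)) :
    (a = 0 ∧ b = 0 ∧ a' = 0 ∧ b' = 0) ∨
      ((2 * n : ℤ) ∣ e' - e - 1 ∧ b = 0 ∧ a' = 0 ∧ b' = a) := by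
  have hn0 : 0 < n := by omega
  have hs : 0 < Real.sin (ang n 1) := sin_ang_pos hn0 one_pos (by exact_mod_cast (by omega : 1 < n))
  have h3 := congrArg (cross (nv n (e' - 1))) h
  simp only [cross_comb, cross_nv_nv] at h3
  have hd' : (2 * n : ℤ) ∣ (e - (e' - 1)) - -(d - 1) := by
    rw [show (e - (e' - 1)) - -(d - 1) = -(e' - e - d) by ring]
    exact (dvd_neg).2 hd
  have hd'' : (2 * n : ℤ) ∣ (e - 1 - (e' - 1)) - -d := by
    rw [show (e - 1 - (e' - 1)) - -d = -(e' - e - d) by ring]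
    exact (dvd_neg).2 hd
  rw [sin_ang_congr hn0 hd', sin_ang_congr hn0 hd'', ang_neg, ang_neg, Real.sin_neg, Real.sin_neg,
    show e' - (e' - 1) = 1 by ring, sub_self, ang_zero, Real.sin_zero] at h3
  have t1 : 0 ≤ a * Real.sin (ang n (d - 1)) :=
    mul_nonneg ha (sin_ang_nonneg hn0 (by omega) (by omega))
  have t2 : 0 ≤ b * Real.sin (ang n d) := mul_nonneg hb (sin_ang_nonneg hn0 (by omega) h2)
  have t3 : 0 ≤ a' * Real.sin (ang n 1) := mul_nonneg ha' hs.le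
  have z1 : a * Real.sin (ang n (d - 1)) = 0 := by linarith
  have z2 : b * Real.sin (ang n d) = 0 := by linarith
  have z3 : a' = 0 := (mul_eq_zero.1 (by linarith : a' * Real.sin (ang n 1) = 0)).resolve_right hs.ne'
  subst z3
  have h4 := congrArg (fun z => dot z (nv n (e' - 1))) h
  simp only [dot_add_left, dot_mul_left, dot_nv_nv, sub_self, ang_zero, Real.cos_zero] at h4
  rw [cos_ang_congr hn0 hd', cos_ang_congr hn0 hd'', ang_neg, ang_neg, Real.cos_neg,
    Real.cos_neg] at h4
  rcases h1.eq_or_lt with rfl | h1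
  · have hb0 : b = 0 := (mul_eq_zero.1 z2).resolve_right hs.ne'
    subst hb0
    rw [sub_self, ang_zero, Real.cos_zero] at h4
    exact Or.inr ⟨hd, rfl, rfl, by linarith⟩
  · have ha0 : a = 0 := (mul_eq_zero.1 z1).resolve_right
      (sin_ang_pos hn0 (by omega) (by omega)).ne'
    subst ha0
    left
    rcases h2.eq_or_lt with rfl | h2
    · rw [ang_self hn0, Real.cos_pi] at h4
      exact ⟨rfl, by linarith, rfl, by linarith⟩
    · have hb0 : b = 0 := (mul_eq_zero.1 z2).resolve_right (sin_ang_pos hn0 (by omega) h2).ne'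
      subst hb0
      exact ⟨rfl, rfl, rfl, by linarith⟩

/-- The chamber coordinates of a vector are unique up to the walls of the chambers. -/
theorem chamber_unique (hn : 3 ≤ n) {e e' : ℤ} {a b a' b' : ℝ} (ha : 0 ≤ a) (hb : 0 ≤ b)
    (ha' : 0 ≤ a') (hb' : 0 ≤ b')
    (h : (a * nv n e + b * nv n (e - 1) : ℂ) = a' * nv n e' + b' * nv n (e' - 1)) :
    (a = 0 ∧ b = 0 ∧ a' = 0 ∧ b' = 0) ∨ ((2 * n : ℤ) ∣ e' - e ∧ a' = a ∧ b' = b) ∨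
      ((2 * n : ℤ) ∣ e' - e - 1 ∧ b = 0 ∧ a' = 0 ∧ b' = a) ∨
      ((2 * n : ℤ) ∣ e - e' - 1 ∧ b' = 0 ∧ a = 0 ∧ b = a') := by
  have hn0 : 0 < n := by omega
  have hpos : (0 : ℤ) < 2 * n := by omega
  have h0 : 0 ≤ (e' - e) % (2 * n) := Int.emod_nonneg _ hpos.ne'
  have h1 : (e' - e) % (2 * n) < 2 * n := Int.emod_lt_of_pos _ hpos
  have h3 : (2 * n : ℤ) ∣ (e' - e) - (e' - e) % (2 * n) := Int.dvd_self_sub_emod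
  rcases h0.eq_or_lt with h0 | h0
  · rw [← h0, sub_zero] at h3
    right; left
    have hs : 0 < Real.sin (ang n 1) :=
      sin_ang_pos hn0 one_pos (by exact_mod_cast (by omega : 1 < n))
    rw [nv_congr hn0 h3, nv_congr hn0 (i := e' - 1) (j := e - 1) (by simpa using h3)] at h
    have c1 := congrArg (cross (nv n (e - 1))) h
    have c2 := congrArg (cross (nv n e)) h
    simp only [cross_comb, cross_nv_nv, sub_self, ang_zero, Real.sin_zero,
      show e - (e - 1) = 1 by ring, show e - 1 - e = -1 by ring, ang_neg, Real.sin_neg,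
      mul_zero, add_zero, zero_add] at c1 c2
    exact ⟨h3, (mul_right_cancel₀ hs.ne' c1).symm,
      (mul_right_cancel₀ (neg_ne_zero.2 hs.ne') c2).symm⟩
  · rcases le_or_gt ((e' - e) % (2 * n)) n with h4 | h4
    · rcases chamber_unique_aux hn h3 h0 h4 ha hb ha' hb' h with h5 | h5
      · exact Or.inl h5
      · exact Or.inr (Or.inr (Or.inl h5))
    · have h6 : (2 * n : ℤ) ∣ e - e' - (2 * n - (e' - e) % (2 * n)) := by
        obtain ⟨m, hm⟩ := h3
        exact ⟨-m - 1, by linear_combination -hm⟩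
      rcases chamber_unique_aux hn h6 (by omega) (by omega) ha' hb' ha hb h.symm with
        ⟨z1, z2, z3, z4⟩ | ⟨h5, z1, z2, z3⟩
      · exact Or.inl ⟨z3, z4, z1, z2⟩
      · exact Or.inr (Or.inr (Or.inr ⟨h5, z1, z2, z3⟩))

end

/-! ### The four semi-regular polygons -/

/-- The relative lengths of the sides of the polygons. -/
noncomputable def wt : ℕ → ℝ
  | 1 => 1
  | 2 => √2
  | 3 => 1
  | _ => 0

theorem wt_nonneg (i : ℕ) : 0 ≤ wt i := by
  rcases i with _ | _ | _ | _ | i <;> simp [wt]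

theorem wt_pos {i : ℕ} (h0 : 0 < i) (h1 : i < 4) : 0 < wt i := by
  interval_cases i <;> simp [wt]

theorem wt_pos_of_succ {i : ℕ} (hi : i < 4) (h : wt (i + 1) = 0) : 0 < wt i := by
  interval_cases i <;> simp [wt] at h ⊢

theorem wt_succ_pos_of {i : ℕ} (hi : i < 4) (h : wt i = 0) : 0 < wt (i + 1) := by
  interval_cases i <;> simp [wt] at h ⊢

/-- The weights are an eigenvector of the path with three vertices for the eigenvalue `√2 = 2
cos(π/4)`. This relation gives all horizontal cylinders the same modulus. -/
theorem wt_add_wt {i : ℕ} (hi : i < 3) : wt i + wt (i + 2) = √2 * wt (i + 1) := by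
  interval_cases i
  · simp [wt]
  · simp [wt]
    norm_num
  · simp [wt]

section Polygons

variable (n : ℕ)

/-- The distance of the `j`-th side of the `i`-th polygon from the centre. -/
noncomputable def apo (i : ℕ) (j : ℤ) : ℝ :=
  if Even j then wt i + wt (i + 1) * Real.cos (ang n 1) else wt i * Real.cos (ang n 1) + wt (i + 1)

/-- Half the length of the `j`-th side of the `i`-th polygon. -/
noncomputable def hl (i : ℕ) (j : ℤ) : ℝ :=
  (if Even j then wt (i + 1) else wt i) * Real.sin (ang n 1)

/-- The `i`-th polygon. -/
def poly (i : ℕ) : Set ℂ := {z | ∀ j : ℤ, dot z (nv n j) ≤ apo n i j}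

variable {n}

theorem apo_congr (i : ℕ) {j j' : ℤ} (h : Even j ↔ Even j') : apo n i j = apo n i j' := by
  simp only [apo, h]

theorem hl_congr (i : ℕ) {j j' : ℤ} (h : Even j ↔ Even j') : hl n i j = hl n i j' := by
  simp only [hl, h]

/-- The vertex shared by neighbouring sides is expressed in the frames of both sides, which differ
by a turn through `π/n`; `hl_step` is the other coordinate. -/
theorem apo_step {j j' : ℤ} (i : ℕ) (h : Even j' ↔ ¬ Even j) :
    apo n i j' = apo n i j * Real.cos (ang n 1) + hl n i j * Real.sin (ang n 1) := by
  have := Real.sin_sq_add_cos_sq (ang n 1)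
  by_cases hj : Even j
  · simp only [apo, hl, h, hj, not_true_eq_false, if_true, if_false]
    linear_combination (-wt (i + 1)) * this
  · simp only [apo, hl, h, hj, not_false_eq_true, if_true, if_false]
    linear_combination (-wt i) * this

theorem hl_step {j j' : ℤ} (i : ℕ) (h : Even j' ↔ ¬ Even j) :
    hl n i j' = apo n i j * Real.sin (ang n 1) - hl n i j * Real.cos (ang n 1) := by
  by_cases hj : Even j
  · simp only [apo, hl, h, hj, not_true_eq_false, if_true, if_false]
    ring
  · simp only [apo, hl, h, hj, not_false_eq_true, if_true, if_false]
    ring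

theorem even_sub_one_iff (j : ℤ) : Even (j - 1) ↔ ¬ Even j := by
  rw [Int.even_sub']
  simp

theorem even_add_one_iff (j : ℤ) : Even (j + 1) ↔ ¬ Even j := Int.even_add_one

theorem even_iff_of_dvd {i j : ℤ} (h : (2 * n : ℤ) ∣ i - j) : Even i ↔ Even j := by
  have h2 : Even (i - j) := even_iff_two_dvd.2 (dvd_trans (Dvd.intro _ rfl) h)
  exact Int.even_sub.1 h2

theorem even_iff_of_dvd_add {i j : ℤ} (h : (2 * n : ℤ) ∣ i + j) : Even i ↔ Even j := by
  have h2 : Even (i + j) := even_iff_two_dvd.2 (dvd_trans (Dvd.intro _ rfl) h)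
  exact Int.even_add.1 h2

theorem hl_nonneg (hn : 0 < n) (i : ℕ) (j : ℤ) : 0 ≤ hl n i j := by
  have hs : 0 ≤ Real.sin (ang n 1) := sin_ang_nonneg hn (by omega) (by exact_mod_cast hn)
  unfold hl
  split_ifs <;> exact mul_nonneg (wt_nonneg _) hs

theorem isClosed_poly (i : ℕ) : IsClosed (poly n i) := by
  have : poly n i = ⋂ j : ℤ, {z | dot z (nv n j) ≤ apo n i j} := by
    ext z
    simp [poly]
  rw [this]
  refine isClosed_iInter fun j => isClosed_le ?_ continuous_const
  unfold dot
  fun_prop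

/-- Apothems depend only on parity. Among the sides of the parity of `e`, the projection is largest
for the side `e` itself, and likewise for `e - 1`; so in a chamber only the sides at its two walls
matter. -/
theorem poly_mem_iff_of_chamber (hn : 0 < n) (i : ℕ) {e : ℤ} {a b : ℝ} (ha : 0 ≤ a) (hb : 0 ≤ b) :
    (a * nv n e + b * nv n (e - 1) : ℂ) ∈ poly n i ↔
      a + b * Real.cos (ang n 1) ≤ apo n i e ∧
        a * Real.cos (ang n 1) + b ≤ apo n i (e - 1) := by
  have hd : ∀ j, dot (a * nv n e + b * nv n (e - 1)) (nv n j) =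
      a * Real.cos (ang n (e - j)) + b * Real.cos (ang n (e - 1 - j)) := by
    intro j
    rw [dot_add_left, dot_mul_left, dot_mul_left, dot_nv_nv, dot_nv_nv]
  constructor
  · intro h
    have h1 := h e
    have h2 := h (e - 1)
    rw [hd] at h1 h2
    rw [sub_self, ang_zero, Real.cos_zero, show e - 1 - e = -1 by ring, ang_neg, Real.cos_neg] at h1
    rw [sub_self, ang_zero, Real.cos_zero, show e - (e - 1) = 1 by ring] at h2
    exact ⟨by linarith, by linarith⟩
  · rintro ⟨h1, h2⟩ j
    rw [hd]
    by_cases hj : Even (e - j)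
    · rw [apo_congr i (Int.even_sub.1 hj).symm]
      have o : Odd (e - 1 - j) := by
        rw [show e - 1 - j = e - j - 1 by ring]
        exact hj.sub_odd odd_one
      have c1 := mul_le_mul_of_nonneg_left (Real.cos_le_one (ang n (e - j))) ha
      have c2 := mul_le_mul_of_nonneg_left (cos_ang_le_of_odd hn o) hb
      linarith
    · have o : Odd (e - j) := Int.not_even_iff_odd.1 hj
      have hj' : Even j ↔ Even (e - 1) := by
        rw [even_sub_one_iff]
        rw [Int.even_sub] at hj
        tauto
      rw [apo_congr i hj']
      have c1 := mul_le_mul_of_nonneg_left (Real.cos_le_one (ang n (e - 1 - j))) hb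
      have c2 := mul_le_mul_of_nonneg_left (cos_ang_le_of_odd hn o) ha
      linarith

/-- The points of the sides. -/
theorem side_mem_poly (hn : 2 ≤ n) (i : ℕ) (j : ℤ) {t : ℝ} (ht : |t| ≤ hl n i j) :
    (apo n i j * nv n j + t * tv n j : ℂ) ∈ poly n i := by
  have hn0 : 0 < n := by omega
  have hs : 0 < Real.sin (ang n 1) := sin_ang_pos hn0 one_pos (by exact_mod_cast hn)
  set s := Real.sin (ang n 1) with hsdef
  set c := Real.cos (ang n 1) with hcdef
  have hcs : s ^ 2 + c ^ 2 = 1 := Real.sin_sq_add_cos_sq _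
  have hst := hl_step (n := n) i (even_sub_one_iff j)
  have hnn := hl_nonneg hn0 i (j - 1)
  have hc : 0 ≤ c := by
    rw [hcdef, ang_one]
    have : 0 ≤ Real.pi / n := div_nonneg Real.pi_pos.le (Nat.cast_nonneg n)
    exact Real.cos_nonneg_of_neg_pi_div_two_le_of_le (by linarith [Real.pi_pos])
      (div_le_div_of_nonneg_left Real.pi_pos.le two_pos (by exact_mod_cast hn))
  rw [abs_le] at ht
  have aux : ∀ b : ℝ, 0 ≤ b → b * s ≤ hl n i j → 0 ≤ apo n i j - b * c := by
    intro b hb hbs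
    have h1 : 0 ≤ (apo n i j - b * c) * s := by
      rw [hst, ← hsdef, ← hcdef] at hnn
      nlinarith
    exact nonneg_of_mul_nonneg_left h1 hs
  rcases le_total t 0 with h0 | h0
  · set b := -t / s with hb
    have hb0 : 0 ≤ b := div_nonneg (by linarith) hs.le
    have hbs : b * s = -t := by
      rw [hb]
      field_simp
    have hz : (apo n i j * nv n j + t * tv n j : ℂ) =
        ((apo n i j - b * c : ℝ) : ℂ) * nv n j + b * nv n (j - 1) := by
      rw [nv_sub_one, ← hsdef, ← hcdef]
      have hbs' : (b : ℂ) * s = -t := by exact_mod_cast hbs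
      push_cast
      linear_combination (tv n j) * hbs'
    rw [hz, poly_mem_iff_of_chamber hn0 i (aux b hb0 (by linarith)) hb0]
    refine ⟨by linarith, ?_⟩
    rw [apo_step i (even_sub_one_iff j), ← hsdef, ← hcdef]
    have : b * s * s ≤ hl n i j * s := mul_le_mul_of_nonneg_right (by linarith) hs.le
    nlinarith
  · set b := t / s with hb
    have hb0 : 0 ≤ b := div_nonneg (by linarith) hs.le
    have hbs : b * s = t := by
      rw [hb]
      field_simp
    have hz : (apo n i j * nv n j + t * tv n j : ℂ) =
        b * nv n (j + 1) + ((apo n i j - b * c : ℝ) : ℂ) * nv n (j + 1 - 1) := by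
      rw [add_sub_cancel_right, nv_add_one, ← hsdef, ← hcdef]
      have hbs' : (b : ℂ) * s = t := by exact_mod_cast hbs
      push_cast
      linear_combination -(tv n j) * hbs'
    rw [hz, poly_mem_iff_of_chamber hn0 i hb0 (aux b hb0 (by linarith))]
    rw [add_sub_cancel_right]
    refine ⟨?_, by linarith⟩
    rw [apo_step i (even_add_one_iff j), ← hsdef, ← hcdef]
    have : b * s * s ≤ hl n i j * s := mul_le_mul_of_nonneg_right (by linarith) hs.le
    nlinarith

/-! ### Horizontal slices of the polygons -/

/-- The height of the upper end of the `j`-th side on the right of the `i`-th polygon. -/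
noncomputable def level (n : ℕ) (i : ℕ) (j : ℤ) : ℝ :=
  -(apo n i j * Real.cos (ang n j)) + hl n i j * Real.sin (ang n j)

/-- The upper end of side `j - 1` is the lower end of side `j`. -/
theorem level_sub_one (i : ℕ) (j : ℤ) :
    level n i (j - 1) = -(apo n i j * Real.cos (ang n j)) - hl n i j * Real.sin (ang n j) := by
  have h1 := apo_step (n := n) i (even_sub_one_iff j)
  have h2 := hl_step (n := n) i (even_sub_one_iff j)
  rw [level, h1, h2, ang_sub, Real.cos_sub, Real.sin_sub]
  linear_combination (-apo n i j * Real.cos (ang n j) - hl n i j * Real.sin (ang n j)) *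
    (Real.sin_sq_add_cos_sq (ang n 1))

theorem level_mono (hn : 0 < n) (i : ℕ) {j j' : ℤ} (h0 : -1 ≤ j) (h : j ≤ j') (h1 : j' ≤ n) :
    level n i j ≤ level n i j' := by
  induction j', h using Int.leInduction with
  | base => exact le_rfl
  | succ m hm ih =>
    refine (ih (by omega)).trans ?_
    have h2 := level_sub_one (n := n) i (m + 1)
    rw [add_sub_cancel_right] at h2
    rw [h2, level]
    have := mul_nonneg (hl_nonneg hn i (m + 1)) (sin_ang_nonneg hn (j := m + 1) (by omega) h1)
    linarith

/-- The closed `k`-th slice. -/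
def slice (n : ℕ) (i : ℕ) (k : ℤ) : Set ℂ :=
  {z | |z.im + apo n i k * Real.cos (ang n k)| ≤ hl n i k * Real.sin (ang n k)}

theorem mem_slice_iff {i : ℕ} {k : ℤ} {z : ℂ} :
    z ∈ slice n i k ↔ level n i (k - 1) ≤ z.im ∧ z.im ≤ level n i k := by
  rw [level_sub_one, level, slice, Set.mem_ofPred_eq, abs_le]
  constructor <;> rintro ⟨h1, h2⟩ <;> constructor <;> linarith

theorem isClosed_slice (i : ℕ) (k : ℤ) : IsClosed (slice n i k) := by
  refine isClosed_le ?_ continuous_const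
  fun_prop

theorem slice_unique (hn : 0 < n) {i : ℕ} {k k' : ℤ} (hk : 0 < k ∧ k < n) (hk' : 0 ≤ k' ∧ k' ≤ n)
    {y : ℝ} (h : |y + apo n i k * Real.cos (ang n k)| < hl n i k * Real.sin (ang n k))
    (h' : level n i (k' - 1) ≤ y ∧ y ≤ level n i k') : k' = k := by
  have h1 : level n i (k - 1) < y ∧ y < level n i k := by
    rw [level_sub_one, level]
    rw [abs_lt] at h
    constructor <;> linarith [h.1, h.2]
  rcases lt_trichotomy k' k with h2 | h2 | h2
  · have := level_mono hn i (j := k') (j' := k - 1) (by omega) (by omega) (by omega)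
    linarith [h1.1, h'.2]
  · exact h2
  · have := level_mono hn i (j := k) (j' := k' - 1) (by omega) (by omega) (by omega)
    linarith [h1.2, h'.1]

/-- Every point of a polygon lies in a slice of positive height. -/
theorem exists_slice (hn : 3 ≤ n) {i : ℕ} (hi : i < 4) {z : ℂ} (hz : z ∈ poly n i) :
    ∃ k : ℤ, (0 < k ∧ k < n) ∧ z ∈ slice n i k ∧ 0 < hl n i k := by
  have hn0 : 0 < n := by omega
  have hs : 0 < Real.sin (ang n 1) := sin_ang_pos hn0 one_pos (by exact_mod_cast (by omega : 1 < n))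
  have hbot : level n i 0 ≤ z.im := by
    have := hz 0
    simp only [dot, nv, ang_zero, Real.sin_zero, Real.cos_zero] at this
    simp only [level, ang_zero, Real.sin_zero, Real.cos_zero]
    linarith
  have htop : z.im ≤ level n i (n - 1) := by
    have := hz n
    simp only [dot, nv, ang_self hn0, Real.sin_pi, Real.cos_pi] at this
    simp only [level_sub_one, ang_self hn0, Real.sin_pi, Real.cos_pi]
    linarith
  have hex : ∃ m : ℕ, z.im ≤ level n i (m + 1) := ⟨n - 2, by
    have : ((n - 2 : ℕ) : ℤ) + 1 = n - 1 := by omega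
    rw [this]
    exact htop⟩
  classical
  -- `m + 1` is the first side whose upper end is not below `z`.
  let m := Nat.find hex
  have hm : z.im ≤ level n i (m + 1) := Nat.find_spec hex
  have hmn : m ≤ n - 2 := Nat.find_min' hex (by
    have : ((n - 2 : ℕ) : ℤ) + 1 = n - 1 := by omega
    rw [this]
    exact htop)
  have hlow : level n i m ≤ z.im := by
    rcases Nat.eq_zero_or_pos m with h | h
    · rw [h]
      exact hbot
    · have := Nat.find_min hex (m := m - 1) (by omega)
      have e : ((m - 1 : ℕ) : ℤ) + 1 = m := by omega
      rw [e] at this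
      exact (not_le.1 this).le
  have hmem : z ∈ slice n i (m + 1) := mem_slice_iff.2 ⟨by simpa using hlow, hm⟩
  by_cases hpos : 0 < hl n i (m + 1)
  · exact ⟨m + 1, ⟨by omega, by omega⟩, hmem, hpos⟩
  -- A side of length zero is the boundary between two slices, and its neighbours have positive
  -- length. Then `z` is moved to the slice above, or to the one below when `m + 2 = n`.
  have hother : ∀ k : ℤ, (Even k ↔ ¬ Even ((m : ℤ) + 1)) → 0 < hl n i k := by
    intro k hk
    have h1 : (if Even ((m : ℤ) + 1) then wt (i + 1) else wt i) = 0 := by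
      have h2 : hl n i (m + 1) = 0 := le_antisymm (not_lt.1 hpos) (hl_nonneg hn0 i _)
      exact (mul_eq_zero.1 h2).resolve_right hs.ne'
    unfold hl
    refine mul_pos ?_ hs
    by_cases he : Even ((m : ℤ) + 1)
    · rw [if_pos he] at h1
      rw [if_neg (by tauto)]
      exact wt_pos_of_succ hi h1
    · rw [if_neg he] at h1
      rw [if_pos (by tauto)]
      exact wt_succ_pos_of hi h1
  have heq : level n i m = level n i (m + 1) := by
    have h2 : hl n i (m + 1) = 0 := le_antisymm (not_lt.1 hpos) (hl_nonneg hn0 i _)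
    have h3 := level_sub_one (n := n) i (m + 1)
    rw [add_sub_cancel_right] at h3
    rw [h3, level, h2]
    ring
  by_cases hm2 : (m : ℤ) + 2 < n
  · refine ⟨m + 2, ⟨by omega, hm2⟩, mem_slice_iff.2 ⟨?_, ?_⟩, hother _ ?_⟩
    · rw [show (m : ℤ) + 2 - 1 = m + 1 by ring, ← heq]
      exact hlow
    · exact hm.trans (level_mono hn0 i (by omega) (by omega) (by omega))
    · rw [show (m : ℤ) + 2 = m + 1 + 1 by ring, even_add_one_iff]
  · refine ⟨m, ⟨by omega, by omega⟩, mem_slice_iff.2 ⟨?_, ?_⟩, hother _ ?_⟩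
    · exact (level_mono hn0 i (by omega) (by omega) (by omega)).trans hlow
    · rw [heq]
      exact hm
    · rw [even_add_one_iff, not_not]

/-- The width condition for the points of a slice. -/
theorem abs_re_le_of_mem_poly {i : ℕ} {z : ℂ} (hz : z ∈ poly n i) (k : ℤ) :
    |z.re| * Real.sin (ang n k) ≤ apo n i k + z.im * Real.cos (ang n k) := by
  have h1 := hz k
  have h2 := hz (-k)
  rw [apo_congr i even_neg] at h2
  simp only [dot, nv, ang_neg, Real.sin_neg, Real.cos_neg] at h1 h2
  rcases abs_cases z.re with ⟨h, _⟩ | ⟨h, _⟩ <;> rw [h] <;> linarith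

/-- At the height of `z`, the points `±x` on the sides `k` and `-k` belong to the polygon. As `z`
lies between them, it satisfies every defining inequality. -/
theorem mem_poly_of_slice (hn : 2 ≤ n) {i : ℕ} {k : ℤ} (hk : 0 < Real.sin (ang n k)) {z : ℂ}
    (h1 : z ∈ slice n i k)
    (h2 : |z.re| * Real.sin (ang n k) ≤ apo n i k + z.im * Real.cos (ang n k)) :
    z ∈ poly n i := by
  set S := Real.sin (ang n k) with hS
  set C := Real.cos (ang n k) with hC
  have hSC : S ^ 2 + C ^ 2 = 1 := Real.sin_sq_add_cos_sq _
  set A := apo n i k with hA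
  set t := (z.im + A * C) / S with ht
  have htS : t * S = z.im + A * C := by
    rw [ht]
    field_simp
  have ht' : |t| ≤ hl n i k := by
    have h3 : |t| * S = |z.im + A * C| := by
      rw [← htS, abs_mul, abs_of_pos hk]
    have h4 : |z.im + A * C| ≤ hl n i k * S := h1
    nlinarith
  set x := A * S + t * C with hx
  have hxS : x * S = A + z.im * C := by
    rw [hx]
    linear_combination A * hSC + C * htS
  have hzx : |z.re| ≤ x := by
    rw [← hxS] at h2
    exact le_of_mul_le_mul_right h2 hk
  have hR := side_mem_poly hn i k ht'
  have hL := side_mem_poly hn i (-k) (t := -t) (by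
    rw [abs_neg, hl_congr i even_neg]
    exact ht')
  rw [apo_congr i even_neg] at hL
  intro j
  have hR' := hR j
  have hL' := hL j
  simp only [dot_add_left, dot_mul_left] at hR' hL'
  simp only [dot, nv, tv, ang_neg, Real.sin_neg, Real.cos_neg, ← hS, ← hC, ← hA] at hR' hL' ⊢
  rw [abs_le] at hzx
  have eR : x * Real.sin (ang n j) + z.im * -Real.cos (ang n j) ≤ apo n i j := by
    have : z.im = t * S - A * C := by linarith
    rw [this, hx]
    linarith
  have eL : -x * Real.sin (ang n j) + z.im * -Real.cos (ang n j) ≤ apo n i j := by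
    have : z.im = t * S - A * C := by linarith
    rw [this, hx]
    linarith
  rcases le_total 0 (Real.sin (ang n j)) with h | h
  · nlinarith
  · nlinarith

/-- A point on a side that lies in an open slice lies on one of the two sides of this slice. -/
theorem side_index_of_slice (hn : 3 ≤ n) {i : ℕ} {j k : ℤ} (hk : 0 < k ∧ k < n) {t : ℝ}
    (ht : |t| ≤ hl n i j)
    (h : |(apo n i j * nv n j + t * tv n j : ℂ).im + apo n i k * Real.cos (ang n k)| <
      hl n i k * Real.sin (ang n k)) :
    (2 * n : ℤ) ∣ j - k ∨ (2 * n : ℤ) ∣ j + k := by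
  have hn0 : 0 < n := by omega
  have hpos : (0 : ℤ) < 2 * n := by omega
  have him : (apo n i j * nv n j + t * tv n j : ℂ).im =
      -(apo n i j * Real.cos (ang n j)) + t * Real.sin (ang n j) := by
    simp [nv, tv]
  rw [him] at h
  have h0 : 0 ≤ j % (2 * n) := Int.emod_nonneg _ hpos.ne'
  have h1 : j % (2 * n) < 2 * n := Int.emod_lt_of_pos _ hpos
  have h3 : (2 * n : ℤ) ∣ j - j % (2 * n) := Int.dvd_self_sub_emod
  have key : ∀ r : ℤ, 0 ≤ r → r ≤ n → ∀ t' : ℝ, |t'| ≤ hl n i r →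
      |-(apo n i r * Real.cos (ang n r)) + t' * Real.sin (ang n r) +
        apo n i k * Real.cos (ang n k)| < hl n i k * Real.sin (ang n k) → r = k := by
    intro r hr0 hr1 t' ht' hlt
    refine slice_unique hn0 hk ⟨hr0, hr1⟩ hlt ?_
    rw [level_sub_one, level]
    rw [abs_le] at ht'
    have hsn := sin_ang_nonneg hn0 hr0 hr1
    have a1 := mul_le_mul_of_nonneg_right ht'.1 hsn
    have a2 := mul_le_mul_of_nonneg_right ht'.2 hsn
    constructor <;> linarith
  rcases le_or_gt (j % (2 * n)) n with h4 | h4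
  · left
    have he := even_iff_of_dvd h3
    rw [apo_congr i he, cos_ang_congr hn0 h3, sin_ang_congr hn0 h3] at h
    rw [hl_congr i he] at ht
    rw [← key _ h0 h4 t ht h]
    exact h3
  · right
    have h5 : (2 * n : ℤ) ∣ j - -(2 * n - j % (2 * n)) := by
      obtain ⟨m, hm⟩ := h3
      exact ⟨m + 1, by linear_combination hm⟩
    have he : Even j ↔ Even (2 * n - j % (2 * n) : ℤ) := (even_iff_of_dvd h5).trans even_neg
    rw [apo_congr i he, cos_ang_congr hn0 h5, sin_ang_congr hn0 h5, ang_neg, Real.cos_neg,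
      Real.sin_neg] at h
    rw [hl_congr i he] at ht
    rw [← key (2 * n - j % (2 * n)) (by omega) (by omega) (-t) (by rwa [abs_neg])
      (by rw [neg_mul]; rwa [mul_neg] at h)]
    rwa [sub_neg_eq_add] at h5

end Polygons

/-! ### Gluing the polygons -/

/-- The side of the `i`-th polygon with normal vector `nv j`, for even `j`, is glued by a translation
to the opposite side of the polygon with index `i + 1`. -/
def Glue (n i : ℕ) (z z' : ℂ) : Prop :=
  ∃ (j : ℤ) (t : ℝ), Even j ∧ |t| ≤ hl n i j ∧ z = apo n i j * nv n j + t * tv n j ∧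
    z' = z - ((apo n i j + apo n (i + 1) (j + 1) : ℝ) : ℂ) * nv n j

/-- The gluing relation on the disjoint union of the four polygons. -/
def GlueRel (n : ℕ) (a b : ℕ × ℂ) : Prop := a.1 < 3 ∧ b.1 = a.1 + 1 ∧ Glue n a.1 a.2 b.2

/-! ### Stations along a strip

The strip with indices `i` and `k` passes alternately through the `k`-th slice of the polygon `i`
and the slice with index `n - k` of the polygon `i + 1`. -/

/-- The polygon at the `m`-th station. -/
def stPoly (i : ℕ) (m : ℤ) : ℕ := if Even m then i else i + 1

/-- The slice at the `m`-th station. -/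
def stSlice (n : ℕ) (k m : ℤ) : ℤ := if Even m then k else n - k

/-- The horizontal distance of consecutive stations. -/
noncomputable def stDist (n i : ℕ) (k : ℤ) : ℝ :=
  (apo n i k + apo n (i + 1) (n - k)) * Real.sin (ang n k)

/-- The centre of the polygon at the `m`-th station. -/
noncomputable def stCenter (n i : ℕ) (k m : ℤ) : ℂ :=
  ⟨m * stDist n i k,
    apo n (stPoly i m) (stSlice n k m) * Real.cos (ang n (stSlice n k m))⟩

/-- Half the height of the strip. -/
noncomputable def halfHeight (n i : ℕ) (k : ℤ) : ℝ :=
  wt (i + 1) * Real.sin (ang n 1) * Real.sin (ang n k)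

/-- The half width (times the sine of the angle of the sides) of the `m`-th station at height `v`. -/
noncomputable def stWidth (n i : ℕ) (k m : ℤ) (v : ℝ) : ℝ :=
  apo n (stPoly i m) (stSlice n k m) * Real.sin (ang n k) ^ 2 +
    v * Real.cos (ang n (stSlice n k m))

section Stations

variable {n i : ℕ} {k : ℤ}

theorem even_self_sub_iff (hodd : Odd n) (k : ℤ) : Even ((n : ℤ) - k) ↔ ¬ Even k := by
  have h : ¬ Even (n : ℤ) := by
    rw [Int.even_coe_nat]
    exact Nat.not_even_iff_odd.2 hodd
  rw [Int.even_sub]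
  tauto

theorem even_self_add_iff (hodd : Odd n) (k : ℤ) : Even (k + (n : ℤ)) ↔ ¬ Even k := by
  have h : ¬ Even (n : ℤ) := by
    rw [Int.even_coe_nat]
    exact Nat.not_even_iff_odd.2 hodd
  rw [Int.even_add]
  tauto

theorem stPoly_even {m : ℤ} (hm : Even m) : stPoly i m = i := if_pos hm

theorem stPoly_odd {m : ℤ} (hm : ¬ Even m) : stPoly i m = i + 1 := if_neg hm

theorem stSlice_even {m : ℤ} (hm : Even m) : stSlice n k m = k := if_pos hm

theorem stSlice_odd {m : ℤ} (hm : ¬ Even m) : stSlice n k m = n - k := if_neg hm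

theorem stSlice_mem (hk : 0 < k ∧ k < n) (m : ℤ) : 0 < stSlice n k m ∧ stSlice n k m < n := by
  unfold stSlice
  split_ifs <;> omega

theorem even_stSlice_iff (hodd : Odd n) (hk : Even k) (m : ℤ) : Even (stSlice n k m) ↔ Even m := by
  by_cases hm : Even m
  · simp [stSlice_even hm, hk, hm]
  · rw [stSlice_odd hm, even_self_sub_iff hodd]
    simp [hk, hm]

theorem sin_stSlice (hn : 0 < n) (m : ℤ) :
    Real.sin (ang n (stSlice n k m)) = Real.sin (ang n k) := by
  unfold stSlice
  split_ifs
  · rfl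
  · exact sin_ang_self_sub hn k

theorem hl_stSlice (hodd : Odd n) (hk : Even k) (m : ℤ) :
    hl n (stPoly i m) (stSlice n k m) = wt (i + 1) * Real.sin (ang n 1) := by
  by_cases hm : Even m
  · rw [stSlice_even hm, stPoly_even hm, hl, if_pos hk]
  · rw [stSlice_odd hm, stPoly_odd hm, hl, if_neg]
    rw [even_self_sub_iff hodd]
    simpa using hk

/-- The centres are placed so that the middle line of every slice of the strip has height zero. -/
theorem sub_stCenter_im (ζ : ℂ) (m : ℤ) : (ζ - stCenter n i k m).im +
    apo n (stPoly i m) (stSlice n k m) * Real.cos (ang n (stSlice n k m)) = ζ.im := by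
  simp [stCenter]

theorem halfHeight_eq (hn : 0 < n) (hodd : Odd n) (hk : Even k) (m : ℤ) :
    hl n (stPoly i m) (stSlice n k m) * Real.sin (ang n (stSlice n k m)) = halfHeight n i k := by
  rw [hl_stSlice hodd hk, sin_stSlice hn]
  rfl

/-- The bound of `abs_re_le_of_mem_poly` is applied to the point of the slanted side at height `v`.
-/
theorem stWidth_nonneg (hn : 3 ≤ n) (hodd : Odd n) (hk : Even k) (hk' : 0 < k ∧ k < n) (m : ℤ)
    {v : ℝ} (hv : |v| ≤ halfHeight n i k) : 0 ≤ stWidth n i k m v := by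
  have hn0 : 0 < n := by omega
  have hS := sin_ang_pos hn0 hk'.1 hk'.2
  have hS' := sin_stSlice (k := k) hn0 m
  have hSC := Real.sin_sq_add_cos_sq (ang n (stSlice n k m))
  have ht : |v / Real.sin (ang n k)| ≤ hl n (stPoly i m) (stSlice n k m) := by
    rw [abs_div, abs_of_pos hS, div_le_iff₀ hS, ← hS', halfHeight_eq hn0 hodd hk]
    exact hv
  have h1 := abs_re_le_of_mem_poly (side_mem_poly (by omega) _ _ ht) (stSlice n k m)
  have h2 : 0 ≤ apo n (stPoly i m) (stSlice n k m) +
      (apo n (stPoly i m) (stSlice n k m) * nv n (stSlice n k m) +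
        ((v / Real.sin (ang n k) : ℝ) : ℂ) * tv n (stSlice n k m)).im *
          Real.cos (ang n (stSlice n k m)) := by
    refine le_trans (mul_nonneg (abs_nonneg _) ?_) h1
    rw [hS']
    exact hS.le
  have h3 : (apo n (stPoly i m) (stSlice n k m) * nv n (stSlice n k m) +
        ((v / Real.sin (ang n k) : ℝ) : ℂ) * tv n (stSlice n k m)).im =
      -(apo n (stPoly i m) (stSlice n k m) * Real.cos (ang n (stSlice n k m))) + v := by
    rw [Complex.add_im, Complex.im_ofReal_mul, Complex.im_ofReal_mul]
    simp [nv, tv, hS', hS.ne']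
  rw [h3] at h2
  rw [hS'] at hSC
  rw [stWidth]
  linear_combination h2 - apo n (stPoly i m) (stSlice n k m) * hSC

theorem mem_station_iff (hn : 3 ≤ n) (hodd : Odd n) (hk : Even k) (hk' : 0 < k ∧ k < n) (m : ℤ)
    {ζ : ℂ} (hv : |ζ.im| ≤ halfHeight n i k) :
    ζ - stCenter n i k m ∈ poly n (stPoly i m) ↔
      |ζ.re - m * stDist n i k| * Real.sin (ang n k) ≤ stWidth n i k m ζ.im := by
  have hn0 : 0 < n := by omega
  have hS := sin_ang_pos hn0 hk'.1 hk'.2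
  have hS' := sin_stSlice (k := k) hn0 m
  have hSC := Real.sin_sq_add_cos_sq (ang n (stSlice n k m))
  rw [hS'] at hSC
  have him := sub_stCenter_im (n := n) (i := i) (k := k) ζ m
  have hre : (ζ - stCenter n i k m).re = ζ.re - m * stDist n i k := by simp [stCenter]
  have hw : apo n (stPoly i m) (stSlice n k m) + (ζ - stCenter n i k m).im *
      Real.cos (ang n (stSlice n k m)) = stWidth n i k m ζ.im := by
    rw [stWidth, ← him]
    linear_combination (-apo n (stPoly i m) (stSlice n k m)) * hSC
  constructor
  · intro h
    have := abs_re_le_of_mem_poly h (stSlice n k m)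
    rwa [hS', hre, hw] at this
  · intro h
    refine mem_poly_of_slice (by omega) (k := stSlice n k m) (by rwa [hS']) ?_ ?_
    · rw [slice, Set.mem_ofPred_eq, him, halfHeight_eq hn0 hodd hk]
      exact hv
    · rw [hS', hre, hw]
      exact h

/-- The dependence on `v` cancels because `cos(π - x) = -cos x`: consecutive stations are bounded by
parallel sides and tile the strip without gap or overlap. -/
theorem stWidth_add (hn : 0 < n) (m : ℤ) (v : ℝ) :
    stWidth n i k m v + stWidth n i k (m + 1) v = stDist n i k * Real.sin (ang n k) := by
  have hc := cos_ang_self_sub hn k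
  by_cases hm : Even m
  · have hm' : ¬ Even (m + 1) := by simpa [Int.even_add_one] using hm
    simp only [stWidth, stDist, stPoly_even hm, stSlice_even hm, stPoly_odd hm', stSlice_odd hm',
      hc]
    ring
  · have hm' : Even (m + 1) := by simpa [Int.even_add_one] using hm
    simp only [stWidth, stDist, stPoly_even hm', stSlice_even hm', stPoly_odd hm, stSlice_odd hm,
      hc]
    ring

theorem stCenter_succ_of_even (hn : 0 < n) {m : ℤ} (hm : Even m) :
    stCenter n i k (m + 1) = stCenter n i k m +
      ((apo n i k + apo n (i + 1) (n - k) : ℝ) : ℂ) * nv n k := by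
  have hm' : ¬ Even (m + 1) := by simpa [Int.even_add_one] using hm
  have hc := cos_ang_self_sub hn k
  apply Complex.ext
  · rw [Complex.add_re, Complex.re_ofReal_mul]
    simp only [stCenter, nv, stDist]
    push_cast
    ring
  · rw [Complex.add_im, Complex.im_ofReal_mul]
    simp only [stCenter, nv, stPoly_even hm, stSlice_even hm, stPoly_odd hm', stSlice_odd hm', hc]
    ring

theorem stCenter_succ_of_odd (hn : 0 < n) {m : ℤ} (hm : ¬ Even m) :
    stCenter n i k (m + 1) = stCenter n i k m -
      ((apo n i k + apo n (i + 1) (n - k) : ℝ) : ℂ) * nv n (-k) := by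
  have hm' : Even (m + 1) := by simpa [Int.even_add_one] using hm
  have hc := cos_ang_self_sub hn k
  apply Complex.ext
  · rw [Complex.sub_re, Complex.re_ofReal_mul]
    simp only [stCenter, nv, stDist, ang_neg, Real.sin_neg]
    push_cast
    ring
  · rw [Complex.sub_im, Complex.im_ofReal_mul]
    simp only [stCenter, nv, stPoly_even hm', stSlice_even hm', stPoly_odd hm, stSlice_odd hm, hc,
      ang_neg, Real.cos_neg]
    ring

/-- Every point of the strip lies in one of the stations. -/
theorem exists_station (hn : 3 ≤ n) (hodd : Odd n) (hk : Even k) (hk' : 0 < k ∧ k < n)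
    (hd : 0 < stDist n i k) {ζ : ℂ} (hv : |ζ.im| ≤ halfHeight n i k) :
    ∃ m : ℤ, ζ - stCenter n i k m ∈ poly n (stPoly i m) := by
  have hn0 : 0 < n := by omega
  have hS := sin_ang_pos hn0 hk'.1 hk'.2
  set m := ⌊ζ.re / stDist n i k⌋ with hm
  have h1 : (m : ℝ) ≤ ζ.re / stDist n i k := Int.floor_le _
  have h2 : ζ.re / stDist n i k < m + 1 := Int.lt_floor_add_one _
  rw [le_div_iff₀ hd] at h1
  rw [div_lt_iff₀ hd] at h2
  have hadd := stWidth_add (i := i) (k := k) hn0 m ζ.im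
  by_cases h : (ζ.re - m * stDist n i k) * Real.sin (ang n k) ≤ stWidth n i k m ζ.im
  · refine ⟨m, (mem_station_iff hn hodd hk hk' m hv).2 ?_⟩
    rwa [abs_of_nonneg (by linarith)]
  · refine ⟨m + 1, (mem_station_iff hn hodd hk hk' (m + 1) hv).2 ?_⟩
    push_cast
    rw [abs_of_nonpos (by linarith)]
    nlinarith

/-- Points on the common side of consecutive stations are glued. -/
theorem glueRel_station (hn : 3 ≤ n) (hodd : Odd n) (hk : Even k) (hk' : 0 < k ∧ k < n)
    (hi : i < 3) (m : ℤ) {ζ : ℂ} (hv : |ζ.im| ≤ halfHeight n i k)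
    (h : ζ - stCenter n i k m ∈ poly n (stPoly i m))
    (h' : ζ - stCenter n i k (m + 1) ∈ poly n (stPoly i (m + 1))) :
    GlueRel n (stPoly i m, ζ - stCenter n i k m)
        (stPoly i (m + 1), ζ - stCenter n i k (m + 1)) ∨
      GlueRel n (stPoly i (m + 1), ζ - stCenter n i k (m + 1))
        (stPoly i m, ζ - stCenter n i k m) := by
  have hn0 : 0 < n := by omega
  have hS := sin_ang_pos hn0 hk'.1 hk'.2
  have hadd := stWidth_add (i := i) (k := k) hn0 m ζ.im
  rw [mem_station_iff hn hodd hk hk' m hv] at h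
  rw [mem_station_iff hn hodd hk hk' (m + 1) hv] at h'
  push_cast at h'
  have e1 := mul_le_mul_of_nonneg_right (le_abs_self (ζ.re - m * stDist n i k)) hS.le
  have e2 := mul_le_mul_of_nonneg_right (neg_le_abs (ζ.re - (m + 1) * stDist n i k)) hS.le
  -- The half widths of the two stations add up to their distance, so a point of both is at the
  -- extreme position in each.
  have heq : (ζ.re - m * stDist n i k) * Real.sin (ang n k) = stWidth n i k m ζ.im := by
    nlinarith
  have hSC := Real.sin_sq_add_cos_sq (ang n k)
  set S := Real.sin (ang n k) with hSdef
  set C := Real.cos (ang n k) with hCdef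
  have ht : |ζ.im / S| ≤ wt (i + 1) * Real.sin (ang n 1) := by
    rw [abs_div, abs_of_pos hS, div_le_iff₀ hS]
    exact hv
  have hodd' : Even (k + 1) ↔ Even ((n : ℤ) - k) := by
    rw [even_add_one_iff, even_self_sub_iff hodd]
  have hodd'' : Even (-k + 1) ↔ Even ((n : ℤ) - k) := by
    rw [even_add_one_iff, even_self_sub_iff hodd, even_neg]
  by_cases hm : Even m
  · have hm' : ¬ Even (m + 1) := by simpa [Int.even_add_one] using hm
    left
    refine ⟨by rwa [stPoly_even hm], by simp only [stPoly_even hm, stPoly_odd hm'], ?_⟩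
    simp only [stPoly_even hm]
    refine ⟨k, ζ.im / S, hk, by rwa [hl, if_pos hk], ?_, ?_⟩
    · have hw : stWidth n i k m ζ.im = apo n i k * S ^ 2 + ζ.im * C := by
        simp only [stWidth, stPoly_even hm, stSlice_even hm, ← hSdef, ← hCdef]
      rw [hw] at heq
      apply Complex.ext
      · rw [Complex.add_re, Complex.re_ofReal_mul, Complex.re_ofReal_mul, Complex.sub_re]
        simp only [stCenter, nv, tv, ← hSdef, ← hCdef]
        field_simp
        linarith
      · rw [Complex.add_im, Complex.im_ofReal_mul, Complex.im_ofReal_mul, Complex.sub_im]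
        simp only [stCenter, nv, tv, ← hSdef, ← hCdef, stPoly_even hm, stSlice_even hm]
        field_simp
        ring
    · rw [stCenter_succ_of_even hn0 hm, apo_congr (i + 1) hodd']
      ring
  · have hm' : Even (m + 1) := by simpa [Int.even_add_one] using hm
    right
    refine ⟨by rwa [stPoly_even hm'], by simp only [stPoly_even hm', stPoly_odd hm], ?_⟩
    simp only [stPoly_even hm']
    -- After an odd station the gluing is along the left side `-k` of polygon `i`. There `tv` points
    -- downwards, whence the sign of the parameter.
    refine ⟨-k, -(ζ.im / S), even_neg.2 hk, by rwa [hl, if_pos (even_neg.2 hk), abs_neg], ?_, ?_⟩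
    · have hw : stWidth n i k (m + 1) ζ.im = apo n i k * S ^ 2 + ζ.im * C := by
        simp only [stWidth, stPoly_even hm', stSlice_even hm', ← hSdef, ← hCdef]
      have heq' : (ζ.re - (m + 1) * stDist n i k) * S = -stWidth n i k (m + 1) ζ.im := by
        nlinarith
      rw [hw] at heq'
      rw [apo_congr i even_neg]
      apply Complex.ext
      · rw [Complex.add_re, Complex.re_ofReal_mul, Complex.re_ofReal_mul, Complex.sub_re]
        simp only [stCenter, nv, tv, ang_neg, Real.sin_neg, Real.cos_neg, ← hSdef, ← hCdef]
        push_cast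
        field_simp
        linarith
      · rw [Complex.add_im, Complex.im_ofReal_mul, Complex.im_ofReal_mul, Complex.sub_im]
        simp only [stCenter, nv, tv, ang_neg, Real.sin_neg, Real.cos_neg, ← hSdef, ← hCdef,
          stPoly_even hm', stSlice_even hm']
        field_simp
        ring
    · rw [stCenter_succ_of_odd hn0 hm, apo_congr (i + 1) hodd'', apo_congr i even_neg]
      ring

/-- The value at a point of the strip does not depend on the station. -/
theorem station_indep {X : Type*} {q : ℕ → ℂ → X} (hn : 3 ≤ n) (hodd : Odd n) (hk : Even k)
    (hk' : 0 < k ∧ k < n) (hi : i < 3) (hd : 0 < stDist n i k)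
    (hq : ∀ a b, GlueRel n a b → q a.1 a.2 = q b.1 b.2) {m m' : ℤ} (hmm : m ≤ m') {ζ : ℂ}
    (hv : |ζ.im| ≤ halfHeight n i k) (h : ζ - stCenter n i k m ∈ poly n (stPoly i m))
    (h' : ζ - stCenter n i k m' ∈ poly n (stPoly i m')) :
    q (stPoly i m) (ζ - stCenter n i k m) = q (stPoly i m') (ζ - stCenter n i k m') := by
  have hn0 : 0 < n := by omega
  have hS := sin_ang_pos hn0 hk'.1 hk'.2
  have adj : ∀ m : ℤ, ζ - stCenter n i k m ∈ poly n (stPoly i m) →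
      ζ - stCenter n i k (m + 1) ∈ poly n (stPoly i (m + 1)) →
      q (stPoly i m) (ζ - stCenter n i k m) =
        q (stPoly i (m + 1)) (ζ - stCenter n i k (m + 1)) := by
    intro m h h'
    rcases glueRel_station hn hodd hk hk' hi m hv h h' with h1 | h1
    · exact hq _ _ h1
    · exact (hq _ _ h1).symm
  have hle : ∀ m, stWidth n i k m ζ.im ≤ stDist n i k * Real.sin (ang n k) := fun m => by
    have h1 := stWidth_add (i := i) (k := k) hn0 m ζ.im
    have h2 := stWidth_nonneg hn hodd hk hk' (m + 1) hv
    linarith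
  have hnn := fun m => stWidth_nonneg hn hodd hk hk' m hv
  have main : ∀ m' : ℤ, m ≤ m' → ζ - stCenter n i k m' ∈ poly n (stPoly i m') →
      q (stPoly i m) (ζ - stCenter n i k m) = q (stPoly i m') (ζ - stCenter n i k m') := by
    intro m' hmm
    induction m', hmm using Int.leInduction with
    | base => exact fun _ => rfl
    | succ r hr ih =>
      intro h'
      -- Each half width is at most the station distance, so a point common to stations `m` and `r +
      -- 1` also lies in the stations between them.
      have hmem : ζ - stCenter n i k r ∈ poly n (stPoly i r) := by
        rcases hr.eq_or_lt with rfl | hr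
        · exact h
        rw [mem_station_iff hn hodd hk hk' _ hv] at h h' ⊢
        have hadd := stWidth_add (i := i) (k := k) hn0 r ζ.im
        have e1 := mul_le_mul_of_nonneg_right (le_abs_self (ζ.re - m * stDist n i k)) hS.le
        have e2 := mul_le_mul_of_nonneg_right
          (neg_le_abs (ζ.re - (r + 1 : ℤ) * stDist n i k)) hS.le
        push_cast at h' e2
        have e3 := hle m
        have e4 := hnn r
        have hr' : (m : ℝ) + 1 ≤ r := by exact_mod_cast hr
        have hdS := mul_pos hd hS
        have e5 : (m + 1) * (stDist n i k * Real.sin (ang n k)) ≤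
            r * (stDist n i k * Real.sin (ang n k)) := mul_le_mul_of_nonneg_right hr' hdS.le
        have e6 : (ζ.re - r * stDist n i k) * Real.sin (ang n k) ≤ 0 := by linarith
        have e7 : ζ.re - r * stDist n i k ≤ 0 := by
          by_contra hcon
          have := mul_pos (not_le.1 hcon) hS
          linarith
        rw [abs_of_nonpos e7]
        linarith
      exact (ih hmem).trans (adj r hmem h')
  exact main m' hmm h'

end Stations

/-! ### The strip decomposition of a surface glued from the four polygons -/

/-- Of finitely many closed sets, those missing `z` also miss a neighbourhood of `z`. This yields
covers of the kind required by `Refines`, where the nearby point and the base point share a cell. -/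
theorem eventually_closed_cover {ι : Type*} {F : Set ι} (hF : F.Finite) {K : ι → Set ℂ}
    (hK : ∀ f ∈ F, IsClosed (K f)) {S : Set ℂ} {z : ℂ}
    (hcov : ∀ᶠ z' in 𝓝[S] z, ∃ f ∈ F, z' ∈ K f) :
    ∀ᶠ z' in 𝓝[S] z, ∃ f ∈ F, z ∈ K f ∧ z' ∈ K f := by
  have h : ∀ᶠ z' in 𝓝 z, ∀ f ∈ F, z' ∈ K f → z ∈ K f := by
    rw [Filter.eventually_all_finite hF]
    intro f hf
    by_cases hz : z ∈ K f
    · exact Filter.Eventually.of_forall fun _ _ => hz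
    · filter_upwards [(hK f hf).isOpen_compl.mem_nhds hz] with z' hz' h using absurd h hz'
  filter_upwards [hcov, nhdsWithin_le_nhds h] with z' ⟨f, hf, h1⟩ h2
  exact ⟨f, hf, h2 f hf h1, h1⟩

/-- The point belongs to the strip, at the position `ζ`. -/
def OnStrip (n i : ℕ) (k : ℤ) (ζ : ℂ) (a : ℕ × ℂ) : Prop :=
  ∃ m : ℤ, a.1 = stPoly i m ∧ a.2 = ζ - stCenter n i k m

section

variable {n i : ℕ} {k : ℤ}

theorem halfHeight_pos (hn : 3 ≤ n) (hk' : 0 < k ∧ k < n) (hi : i < 3) : 0 < halfHeight n i k := by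
  have hn0 : 0 < n := by omega
  exact mul_pos (mul_pos (wt_pos (by omega) (by omega)) (sin_ang_pos hn0 (by omega) (by omega)))
    (sin_ang_pos hn0 (by omega) (by omega))

/-- Two stations make up one period. The two apothems add up to `wt i + wt (i + 2) + 2 * wt (i + 1)
* cos(π/n)`, and `wt_add_wt` makes this a multiple of `wt (i + 1)`, as is the height. The quotient
depends on neither `i` nor `k`. -/
theorem two_mul_stDist (hn : 3 ≤ n) (hodd : Odd n) (hk : Even k) (hi : i < 3) :
    2 * stDist n i k = (matT n).1 0 1 * (2 * halfHeight n i k) := by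
  have hn0 : 0 < n := by omega
  have hs : 0 < Real.sin (ang n 1) := sin_ang_pos hn0 (by omega) (by omega)
  have hT : (matT n).1 0 1 =
      2 * ((Real.cos (ang n 1) + Real.cos (Real.pi / 4)) / Real.sin (ang n 1)) := by
    rw [ang_one]
    rfl
  have hw := wt_add_wt hi
  have hk2 : ¬ Even ((n : ℤ) - k) := by
    rw [even_self_sub_iff hodd]
    simpa using hk
  rw [hT, stDist, halfHeight, apo, apo, if_pos hk, if_neg hk2, Real.cos_pi_div_four]
  field_simp
  linear_combination Real.sin (ang n k) * hw

theorem matT_entry_pos (hn : 3 ≤ n) : 0 < (matT n).1 0 1 := by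
  have hn0 : 0 < n := by omega
  have hs : 0 < Real.sin (Real.pi / n) := by
    rw [← ang_one]
    exact sin_ang_pos hn0 (by omega) (by omega)
  have hc : 0 ≤ Real.cos (Real.pi / n) := by
    have : 0 ≤ Real.pi / n := div_nonneg Real.pi_pos.le (Nat.cast_nonneg n)
    exact Real.cos_nonneg_of_neg_pi_div_two_le_of_le (by linarith [Real.pi_pos])
      (div_le_div_of_nonneg_left Real.pi_pos.le two_pos (by exact_mod_cast (by omega : 2 ≤ n)))
  have hT : (matT n).1 0 1 =
      2 * ((Real.cos (Real.pi / n) + Real.cos (Real.pi / 4)) / Real.sin (Real.pi / n)) := rfl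
  rw [hT, Real.cos_pi_div_four]
  positivity

theorem stDist_pos (hn : 3 ≤ n) (hodd : Odd n) (hk : Even k) (hk' : 0 < k ∧ k < n) (hi : i < 3) :
    0 < stDist n i k := by
  have h1 := two_mul_stDist hn hodd hk hi
  have h2 := mul_pos (matT_entry_pos hn) (halfHeight_pos hn hk' hi)
  linarith

theorem stPoly_congr {m m' : ℤ} (h : Even m ↔ Even m') : stPoly i m = stPoly i m' := by
  simp only [stPoly, h]

theorem stCenter_sub {m m' : ℤ} (h : Even m ↔ Even m') :
    stCenter n i k m' - stCenter n i k m = (((m' - m) * stDist n i k : ℝ) : ℂ) := by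
  have h1 : stSlice n k m = stSlice n k m' := by simp only [stSlice, h]
  have h2 : stPoly i m = stPoly i m' := stPoly_congr h
  apply Complex.ext
  · simp [stCenter]
    ring
  · simp [stCenter, h1, h2]

/-- Inside an open slice the only boundary points are on its left and right sides. Gluing along them
leads to the neighbouring station without changing `ζ`. -/
theorem onStrip_of_glueRel (hn : 3 ≤ n) (hodd : Odd n) (hk : Even k) (hk' : 0 < k ∧ k < n) {ζ : ℂ}
    (hv : |ζ.im| < halfHeight n i k) {a b : ℕ × ℂ} (hab : GlueRel n a b)
    (h : OnStrip n i k ζ a) : OnStrip n i k ζ b := by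
  have hn0 : 0 < n := by omega
  obtain ⟨I, z⟩ := a
  obtain ⟨I', z'⟩ := b
  obtain ⟨-, hI', j, t, hj, ht, hz, hz'⟩ := hab
  obtain ⟨m, hm1, hm2⟩ := h
  simp only at hI' hz hz' hm1 hm2 ht
  subst hm1
  have him := sub_stCenter_im (n := n) (i := i) (k := k) ζ m
  have hlt : |z.im + apo n (stPoly i m) (stSlice n k m) * Real.cos (ang n (stSlice n k m))| <
      hl n (stPoly i m) (stSlice n k m) * Real.sin (ang n (stSlice n k m)) := by
    rw [hm2, him, halfHeight_eq hn0 hodd hk]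
    exact hv
  have hidx := side_index_of_slice hn (stSlice_mem hk' m) ht (hz ▸ hlt)
  have hev : Even m := by
    rw [← even_stSlice_iff hodd hk m]
    rcases hidx with h1 | h1
    · exact (even_iff_of_dvd h1).1 hj
    · exact (even_iff_of_dvd_add h1).1 hj
  rw [stPoly_even hev] at hz hz' hI'
  rw [stSlice_even hev] at hidx
  have hA' : apo n (i + 1) (j + 1) = apo n (i + 1) (n - k) := apo_congr _ (by
    rw [even_add_one_iff, even_self_sub_iff hodd]
    simp [hj, hk])
  have hA : apo n i j = apo n i k := apo_congr _ (by simp [hj, hk])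
  rw [hA, hA', hm2] at hz'
  rcases hidx with h1 | h1
  · refine ⟨m + 1, ?_, ?_⟩
    · rw [stPoly_odd (by simpa [Int.even_add_one] using hev)]
      exact hI'
    · rw [stCenter_succ_of_even hn0 hev]
      simp only [hz', nv_congr hn0 h1]
      ring
  · have hm' : ¬ Even (m - 1) := by
      rw [even_sub_one_iff]
      simpa using hev
    refine ⟨m - 1, ?_, ?_⟩
    · rw [stPoly_odd hm']
      exact hI'
    · have hc := stCenter_succ_of_odd (i := i) (k := k) hn0 hm'
      rw [sub_add_cancel] at hc
      rw [hc, nv_congr hn0 (i := j) (j := -k) (by rwa [sub_neg_eq_add])] at hz'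
      simp only [hz']
      ring

theorem onStrip_of_glueRel' (hn : 3 ≤ n) (hodd : Odd n) (hk : Even k) (hk' : 0 < k ∧ k < n) {ζ : ℂ}
    (hv : |ζ.im| < halfHeight n i k) {a b : ℕ × ℂ} (hab : GlueRel n a b)
    (h : OnStrip n i k ζ b) : OnStrip n i k ζ a := by
  have hn0 : 0 < n := by omega
  obtain ⟨I, z⟩ := a
  obtain ⟨I', z'⟩ := b
  obtain ⟨-, hI', j, t, hj, ht, hz, hz'⟩ := hab
  obtain ⟨m, hm1, hm2⟩ := h
  simp only at hI' hz hz' hm1 hm2 ht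
  subst hm1
  have him := sub_stCenter_im (n := n) (i := i) (k := k) ζ m
  have hlt : |z'.im + apo n (stPoly i m) (stSlice n k m) * Real.cos (ang n (stSlice n k m))| <
      hl n (stPoly i m) (stSlice n k m) * Real.sin (ang n (stSlice n k m)) := by
    rw [hm2, him, halfHeight_eq hn0 hodd hk]
    exact hv
  have hjn : ¬ Even (j + n) := by
    rw [even_self_add_iff hodd]
    simpa using hj
  have hj1 : ¬ Even (j + 1) := by
    rw [even_add_one_iff]
    simpa using hj
  -- Seen from the second polygon the common side is the opposite one, with index `j + n` and
  -- reversed parameter.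
  have hside : z' = apo n (stPoly i m) (j + n) * nv n (j + n) + ((-t : ℝ) : ℂ) * tv n (j + n) := by
    rw [nv_add_self hn0, tv_add_self hn0, hz', hz, hI',
      apo_congr (I + 1) (j := j + n) (j' := j + 1) (by simp [hjn, hj1])]
    push_cast
    ring
  have ht' : |(-t : ℝ)| ≤ hl n (stPoly i m) (j + n) := by
    rw [abs_neg, hI', hl, if_neg hjn]
    rwa [hl, if_pos hj] at ht
  have hidx := side_index_of_slice hn (stSlice_mem hk' m) ht' (hside ▸ hlt)
  have hev : ¬ Even m := by
    rw [← even_stSlice_iff hodd hk m]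
    rcases hidx with h1 | h1
    · exact fun h2 => hjn ((even_iff_of_dvd h1).2 h2)
    · exact fun h2 => hjn ((even_iff_of_dvd_add h1).2 h2)
  rw [stPoly_odd hev] at hI'
  have hI : I = i := by omega
  subst hI
  rw [stSlice_odd hev] at hidx
  have hA' : apo n (I + 1) (j + 1) = apo n (I + 1) (n - k) := apo_congr _ (by
    rw [even_add_one_iff, even_self_sub_iff hodd]
    simp [hj, hk])
  have hA : apo n I j = apo n I k := apo_congr _ (by simp [hj, hk])
  rw [hA, hA', hm2] at hz'
  rcases hidx with h1 | h1
  · refine ⟨m + 1, ?_, ?_⟩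
    · rw [stPoly_even (by simpa [Int.even_add_one] using hev)]
    · rw [stCenter_succ_of_odd hn0 hev]
      have h2 : (2 * n : ℤ) ∣ j - -k := by
        rwa [show j - -k = j + n - (n - k) by ring]
      rw [nv_congr hn0 h2] at hz'
      linear_combination -hz'
  · have hm' : Even (m - 1) := by
      rw [even_sub_one_iff]
      exact hev
    refine ⟨m - 1, ?_, ?_⟩
    · rw [stPoly_even hm']
    · have hc := stCenter_succ_of_even (i := I) (k := k) hn0 hm'
      rw [sub_add_cancel] at hc
      have h2 : (2 * n : ℤ) ∣ j - k := by
        obtain ⟨r, hr⟩ := h1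
        exact ⟨r - 1, by linear_combination hr⟩
      rw [nv_congr hn0 h2, hc] at hz'
      linear_combination -hz'

theorem onStrip_of_eqvGen (hn : 3 ≤ n) (hodd : Odd n) (hk : Even k) (hk' : 0 < k ∧ k < n) {ζ : ℂ}
    (hv : |ζ.im| < halfHeight n i k) {a b : ℕ × ℂ} (hab : Relation.EqvGen (GlueRel n) a b) :
    OnStrip n i k ζ a ↔ OnStrip n i k ζ b := by
  induction hab with
  | rel a b h => exact ⟨onStrip_of_glueRel hn hodd hk hk' hv h, onStrip_of_glueRel' hn hodd hk hk' hv h⟩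
  | refl => exact Iff.rfl
  | symm _ _ _ ih => exact ih.symm
  | trans _ _ _ _ _ ih1 ih2 => exact ih1.trans ih2

/-- An interior point determines its slice, and the parity of the slice is the parity of the
station. This fixes the strip, and the station up to an even number of steps, that is, up to whole
periods. -/
theorem onStrip_unique (hn : 3 ≤ n) (hodd : Odd n) {i' : ℕ} {k' : ℤ} (hk : Even k)
    (hk1 : 0 < k ∧ k < n) (hk' : Even k') (hk1' : 0 < k' ∧ k' < n) {ζ ζ' : ℂ}
    (hv : |ζ.im| < halfHeight n i k) (hv' : |ζ'.im| ≤ halfHeight n i' k') {a : ℕ × ℂ}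
    (h : OnStrip n i k ζ a) (h' : OnStrip n i' k' ζ' a) :
    i = i' ∧ k = k' ∧ ∃ r : ℤ, ζ' = ζ + ((r * (2 * stDist n i k) : ℝ) : ℂ) := by
  have hn0 : 0 < n := by omega
  obtain ⟨I, z⟩ := a
  obtain ⟨m, hm1, hm2⟩ := h
  obtain ⟨m', hm1', hm2'⟩ := h'
  simp only at hm1 hm2 hm1' hm2'
  have him := sub_stCenter_im (n := n) (i := i) (k := k) ζ m
  have him' := sub_stCenter_im (n := n) (i := i') (k := k') ζ' m'
  have hsl : stSlice n k' m' = stSlice n k m := by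
    refine slice_unique (i := I) (y := z.im) hn0 (stSlice_mem hk1 m)
      ⟨(stSlice_mem hk1' m').1.le, (stSlice_mem hk1' m').2.le⟩ ?_ (mem_slice_iff.1 ?_)
    · rw [hm1, hm2, him, halfHeight_eq hn0 hodd hk]
      exact hv
    · rw [slice, Set.mem_ofPred_eq, hm1', hm2', him', halfHeight_eq hn0 hodd hk']
      exact hv'
  have hpar : Even m ↔ Even m' := by
    rw [← even_stSlice_iff hodd hk m, ← even_stSlice_iff hodd hk' m', hsl]
  have hik : i = i' ∧ k = k' := by
    by_cases hm : Even m
    · have hm' := hpar.1 hm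
      rw [stPoly_even hm] at hm1
      rw [stPoly_even hm'] at hm1'
      rw [stSlice_even hm, stSlice_even hm'] at hsl
      exact ⟨hm1.symm.trans hm1', hsl.symm⟩
    · have hm' : ¬ Even m' := fun h => hm (hpar.2 h)
      rw [stPoly_odd hm] at hm1
      rw [stPoly_odd hm'] at hm1'
      rw [stSlice_odd hm, stSlice_odd hm'] at hsl
      exact ⟨by omega, by omega⟩
  obtain ⟨rfl, rfl⟩ := hik
  refine ⟨rfl, rfl, ?_⟩
  obtain ⟨r, hr⟩ : Even (m' - m) := Int.even_sub.2 hpar.symm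
  refine ⟨r, ?_⟩
  have h1 := stCenter_sub (n := n) (i := i) (k := k) hpar
  have h2 : ((m' - m : ℝ)) = r + r := by exact_mod_cast hr
  rw [h2] at h1
  rw [hm2] at hm2'
  push_cast at h1 ⊢
  linear_combination -hm2' + h1

end

/-! ### The cylinders as `StripData`, and mutual refinement with the four polygons. -/

open Classical in
/-- The map from a strip to the surface. -/
noncomputable def stripMap {X : Type*} (n : ℕ) (q : ℕ → ℂ → X) (i : ℕ) (k : ℤ) (ζ : ℂ) : X :=
  -- On the strip a station exists by `exists_station`, and its choice is irrelevant by
  -- `station_indep`; the default value is never used there.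
  if h : ∃ m : ℤ, ζ - stCenter n i k m ∈ poly n (stPoly i m) then
    q (stPoly i h.choose) (ζ - stCenter n i k h.choose) else q 0 0

/-- The indices of the strips. -/
def StripIdx (n : ℕ) : Type := {s : ℕ × ℤ // s.1 < 3 ∧ Even s.2 ∧ 0 < s.2 ∧ s.2 < n}

section

variable {X : Type*} {n : ℕ} {q : ℕ → ℂ → X}

theorem stripMap_eq (hn : 3 ≤ n) (hodd : Odd n) (hq : ∀ a b, GlueRel n a b → q a.1 a.2 = q b.1 b.2)
    {i : ℕ} {k : ℤ} (hk : Even k) (hk' : 0 < k ∧ k < n) (hi : i < 3) {ζ : ℂ}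
    (hv : |ζ.im| ≤ halfHeight n i k) {m : ℤ} (h : ζ - stCenter n i k m ∈ poly n (stPoly i m)) :
    stripMap n q i k ζ = q (stPoly i m) (ζ - stCenter n i k m) := by
  have hex : ∃ m : ℤ, ζ - stCenter n i k m ∈ poly n (stPoly i m) := ⟨m, h⟩
  have hd := stDist_pos hn hodd hk hk' hi
  rw [stripMap, dif_pos hex]
  rcases le_total m hex.choose with h1 | h1
  · exact (station_indep hn hodd hk hk' hi hd hq h1 hv h hex.choose_spec).symm
  · exact station_indep hn hodd hk hk' hi hd hq h1 hv hex.choose_spec h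

/-- The strips of the surface. -/
noncomputable def stripData (hn : 3 ≤ n) (hodd : Odd n)
    (hq : ∀ a b, GlueRel n a b → q a.1 a.2 = q b.1 b.2)
    (hinj : ∀ i i' z z', i < 4 → i' < 4 → z ∈ poly n i → z' ∈ poly n i' → q i z = q i' z' →
      Relation.EqvGen (GlueRel n) (i, z) (i', z')) :
    StripData X ((matT n).1 0 1) where
  ι := StripIdx n
  hgt s := 2 * halfHeight n s.1.1 s.1.2
  -- Stations are centred at height zero, whereas strips start at height zero.
  c s z := stripMap n q s.1.1 s.1.2 (z - ⟨0, halfHeight n s.1.1 s.1.2⟩)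
  hgt_pos s := by
    have := halfHeight_pos hn s.2.2.2 s.2.1
    linarith
  periodic := by
    rintro ⟨⟨i, k⟩, hi, hk, hk'⟩ z h0 h1
    simp only at hi hk hk' h0 h1 ⊢
    have hv : |(z - ⟨0, halfHeight n i k⟩ : ℂ).im| ≤ halfHeight n i k := by
      rw [Complex.sub_im, abs_le]
      constructor <;> linarith
    obtain ⟨m, hm⟩ := exists_station hn hodd hk hk' (stDist_pos hn hodd hk hk' hi) hv
    have hpar : Even m ↔ Even (m + 2) := by simp
    have hc := stCenter_sub (n := n) (i := i) (k := k) hpar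
    have hτ := two_mul_stDist hn hodd hk hi
    have e : z + (((matT n).1 0 1 * (2 * halfHeight n i k) : ℝ) : ℂ) - ⟨0, halfHeight n i k⟩ -
        stCenter n i k (m + 2) = z - ⟨0, halfHeight n i k⟩ - stCenter n i k m := by
      rw [← hτ]
      push_cast at hc ⊢
      linear_combination -hc
    rw [stripMap_eq hn hodd hq hk hk' hi hv hm,
      stripMap_eq hn hodd hq hk hk' hi (m := m + 2) ?_ ?_, e, stPoly_congr hpar]
    · rw [Complex.sub_im, Complex.add_im, Complex.ofReal_im, add_zero, ← Complex.sub_im]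
      exact hv
    · rw [e, ← stPoly_congr hpar]
      exact hm
  inj := by
    rintro ⟨⟨i, k⟩, hi, hk, hk'⟩ ⟨⟨i', k'⟩, hi', hl, hl'⟩ z w h0 h1 h0' h1' h
    simp only at hi hk hk' hi' hl hl' h0 h1 h0' h1' h ⊢
    have hv : |(z - ⟨0, halfHeight n i k⟩ : ℂ).im| < halfHeight n i k := by
      rw [Complex.sub_im, abs_lt]
      constructor <;> linarith
    have hv' : |(w - ⟨0, halfHeight n i' k'⟩ : ℂ).im| ≤ halfHeight n i' k' := by
      rw [Complex.sub_im, abs_le]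
      constructor <;> linarith
    obtain ⟨m, hm⟩ := exists_station hn hodd hk hk' (stDist_pos hn hodd hk hk' hi) hv.le
    obtain ⟨m', hm'⟩ := exists_station hn hodd hl hl' (stDist_pos hn hodd hl hl' hi') hv'
    rw [stripMap_eq hn hodd hq hk hk' hi hv.le hm,
      stripMap_eq hn hodd hq hl hl' hi' hv' hm'] at h
    have hlt : ∀ (i : ℕ) (m : ℤ), i < 3 → stPoly i m < 4 := by
      intro i m hi
      unfold stPoly
      split_ifs <;> omega
    have heqv := hinj _ _ _ _ (hlt i m hi) (hlt i' m' hi') hm hm' h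
    have hon := (onStrip_of_eqvGen hn hodd hk hk' hv heqv).1 ⟨m, rfl, rfl⟩
    obtain ⟨rfl, rfl, r, hr⟩ := onStrip_unique hn hodd hk hk' hl hl' hv hv' hon ⟨m', rfl, rfl⟩
    refine ⟨rfl, r, ?_⟩
    rw [two_mul_stDist hn hodd hk hi] at hr
    linear_combination hr

/-- The family of the four polygons. -/
def polyCells (n : ℕ) (q : ℕ → ℂ → X) : CellFamily X := ⟨Fin 4, fun i => poly n i, fun i => q i⟩

/-- Even slices are the even stations of a strip starting in the same polygon; odd slices are the
odd stations of one starting in the previous polygon. The missing strips, from polygon 3 upwards and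
from polygon 0 downwards, would belong to sides of length zero. -/
theorem exists_strip_of_slice (hodd : Odd n) {I : ℕ} (hI : I < 4) {κ : ℤ} (hκ : 0 < κ ∧ κ < n)
    (hpos : 0 < hl n I κ) :
    ∃ (s : StripIdx n) (m : ℤ), stPoly s.1.1 m = I ∧ stSlice n s.1.2 m = κ := by
  by_cases he : Even κ
  · have hI3 : I < 3 := by
      by_contra hcon
      have : I = 3 := by omega
      subst this
      simp [hl, he, wt] at hpos
    exact ⟨⟨(I, κ), hI3, he, hκ⟩, 0, rfl, rfl⟩
  · have hI0 : 0 < I := by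
      by_contra hcon
      have : I = 0 := by omega
      subst this
      simp [hl, he, wt] at hpos
    refine ⟨⟨(I - 1, n - κ), by omega, ?_, by dsimp only; omega, by dsimp only; omega⟩, 1, ?_, ?_⟩
    · rw [even_self_sub_iff hodd]
      exact he
    · rw [stPoly_odd (by decide)]
      dsimp only
      omega
    · rw [stSlice_odd (by decide)]
      dsimp only
      omega

theorem polyCells_refines_strips (hn : 3 ≤ n) (hodd : Odd n)
    (hq : ∀ a b, GlueRel n a b → q a.1 a.2 = q b.1 b.2)
    (hinj : ∀ i i' z z', i < 4 → i' < 4 → z ∈ poly n i → z' ∈ poly n i' → q i z = q i' z' →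
      Relation.EqvGen (GlueRel n) (i, z) (i', z')) :
    (polyCells n q).Refines (stripData hn hodd hq hinj).cells := by
  rintro (I : Fin 4) z hz
  have hn0 : 0 < n := by omega
  have key : ∀ κ : ℤ, ∃ f : StripIdx n × ℂ, (0 < κ ∧ κ < n) → 0 < hl n I κ →
      ∀ w ∈ poly n I, w ∈ slice n I κ →
        w + f.2 ∈ (stripData hn hodd hq hinj).strip f.1 ∧
          q I w = (stripData hn hodd hq hinj).c f.1 (w + f.2) := by
    intro κ
    by_cases hκ : (0 < κ ∧ κ < n) ∧ 0 < hl n I κ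
    · obtain ⟨s, m, hs1, hs2⟩ := exists_strip_of_slice hodd I.2 hκ.1 hκ.2
      obtain ⟨⟨i, k⟩, hi, hk, hk'⟩ := s
      simp only at hs1 hs2 hi hk hk'
      refine ⟨⟨⟨(i, k), hi, hk, hk'⟩, stCenter n i k m + ⟨0, halfHeight n i k⟩⟩, fun _ _ w hw hws => ?_⟩
      have him := sub_stCenter_im (n := n) (i := i) (k := k) (w + stCenter n i k m) m
      rw [add_sub_cancel_right, hs1, hs2] at him
      have hv : |(w + stCenter n i k m).im| ≤ halfHeight n i k := by
        rw [← him, ← halfHeight_eq hn0 hodd hk m, hs1, hs2]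
        exact hws
      have e : w + (stCenter n i k m + ⟨0, halfHeight n i k⟩) - ⟨0, halfHeight n i k⟩ =
          w + stCenter n i k m := by ring
      constructor
      · rw [abs_le] at hv
        have e2 : (w + (stCenter n i k m + ⟨0, halfHeight n i k⟩)).im =
            (w + stCenter n i k m).im + halfHeight n i k := by
          rw [← add_assoc]
          rfl
        exact ⟨by rw [e2]; linarith, by rw [e2]; change _ ≤ 2 * halfHeight n i k; linarith⟩
      · change _ = stripMap n q i k (w + (stCenter n i k m + ⟨0, halfHeight n i k⟩) -
          ⟨0, halfHeight n i k⟩)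
        rw [e, stripMap_eq hn hodd hq hk hk' hi hv (m := m), add_sub_cancel_right, hs1]
        rw [add_sub_cancel_right, hs1]
        exact hw
    -- An arbitrary strip, needed only to choose `f` for all `κ`.
    · exact ⟨⟨⟨(0, 2), by omega, even_two, by omega, by dsimp only; omega⟩, 0⟩,
        fun h1 h2 => absurd ⟨h1, h2⟩ hκ⟩
  choose f hf using key
  have hK : (Set.Ioo (0 : ℤ) n ∩ {κ | 0 < hl n I κ}).Finite :=
    (Set.finite_Ioo (0 : ℤ) n).subset Set.inter_subset_left
  refine ⟨f '' (Set.Ioo (0 : ℤ) n ∩ {κ | 0 < hl n I κ}), hK.image f, ?_⟩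
  have hcov : ∀ᶠ z' in 𝓝[poly n I] z, ∃ κ ∈ Set.Ioo (0 : ℤ) n ∩ {κ | 0 < hl n I κ},
      z' ∈ slice n I κ := by
    filter_upwards [eventually_mem_nhdsWithin] with z' hz'
    obtain ⟨κ, h1, h2, h3⟩ := exists_slice hn I.2 hz'
    exact ⟨κ, ⟨h1, h3⟩, h2⟩
  have := eventually_closed_cover hK (fun κ _ => isClosed_slice I κ) hcov
  filter_upwards [this, eventually_mem_nhdsWithin] with z' ⟨κ, hκ, h1, h2⟩ hz'
  obtain ⟨a1, a2⟩ := hf κ hκ.1 hκ.2 z hz h1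
  obtain ⟨b1, b2⟩ := hf κ hκ.1 hκ.2 z' hz' h2
  exact ⟨f κ, ⟨κ, hκ, rfl⟩, a1, b1, a2, b2⟩

theorem strips_refines_polyCells (hn : 3 ≤ n) (hodd : Odd n)
    (hq : ∀ a b, GlueRel n a b → q a.1 a.2 = q b.1 b.2)
    (hinj : ∀ i i' z z', i < 4 → i' < 4 → z ∈ poly n i → z' ∈ poly n i' → q i z = q i' z' →
      Relation.EqvGen (GlueRel n) (i, z) (i', z')) :
    (stripData hn hodd hq hinj).cells.Refines (polyCells n q) := by
  rintro ⟨⟨i, k⟩, hi, hk, hk'⟩ z hz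
  have hn0 : 0 < n := by omega
  simp only at hi hk hk'
  have hd := stDist_pos hn hodd hk hk' hi
  have hS := sin_ang_pos hn0 hk'.1 hk'.2
  have hlt : ∀ m : ℤ, stPoly i m < 4 := by
    intro m
    unfold stPoly
    split_ifs <;> omega
  set o : ℂ := ⟨0, halfHeight n i k⟩ with ho
  let f : ℤ → Fin 4 × ℂ := fun m => (⟨stPoly i m, hlt m⟩, -o - stCenter n i k m)
  have hfeq : ∀ w m, w + (f m).2 = w - o - stCenter n i k m := fun w m => by
    simp only [f]
    ring
  -- A station containing a point of real part `x` has its centre within `stDist` of `x`, so near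
  -- `z` only stations with index at most `M` in absolute value occur.
  let M : ℤ := ⌈(|z.re| + 1) / stDist n i k⌉ + 1
  have hstrip : ∀ w : ℂ, (0 ≤ w.im ∧ w.im ≤ 2 * halfHeight n i k) →
      |(w - o).im| ≤ halfHeight n i k := by
    intro w hw
    rw [Complex.sub_im, abs_le]
    simp only [ho]
    constructor <;> linarith [hw.1, hw.2]
  let K : ℤ → Set ℂ := fun m => {w | w - o - stCenter n i k m ∈ poly n (stPoly i m)}
  have hK : ∀ m ∈ Set.Icc (-M) M, IsClosed (K m) := fun m _ =>
    (isClosed_poly (n := n) (stPoly i m)).preimage (by fun_prop)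
  set S : Set ℂ := (stripData hn hodd hq hinj).cells.S ⟨(i, k), hi, hk, hk'⟩ with hSdef
  have hSmem : ∀ w, w ∈ S → 0 ≤ w.im ∧ w.im ≤ 2 * halfHeight n i k := fun w hw => hw
  have hcov : ∀ᶠ w in 𝓝[S] z, ∃ m ∈ Set.Icc (-M) M, w ∈ K m := by
    have hnear : ∀ᶠ w in 𝓝[S] z, |w.re| < |z.re| + 1 := by
      refine nhdsWithin_le_nhds ?_
      have hc : Continuous fun w : ℂ => |w.re| := by fun_prop
      exact hc.continuousAt.eventually (gt_mem_nhds (by linarith))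
    filter_upwards [hnear, eventually_mem_nhdsWithin] with w hw hwS
    have hv := hstrip w (hSmem w hwS)
    obtain ⟨m, hm⟩ := exists_station hn hodd hk hk' hd hv
    refine ⟨m, ?_, hm⟩
    rw [mem_station_iff hn hodd hk hk' m hv] at hm
    have h1 := stWidth_add (i := i) (k := k) hn0 m (w - o).im
    have h2 := stWidth_nonneg hn hodd hk hk' (m + 1) hv
    have h3 : |(w - o).re - m * stDist n i k| ≤ stDist n i k :=
      le_of_mul_le_mul_right (by linarith) hS
    have h4 : (w - o).re = w.re := by simp [ho]
    rw [h4, abs_le] at h3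
    rw [abs_lt] at hw
    have h5 : (|z.re| + 1) / stDist n i k ≤ ((M - 1 : ℤ) : ℝ) := by
      simp only [M, add_sub_cancel_right]
      exact Int.le_ceil _
    rw [div_le_iff₀ hd] at h5
    push_cast at h5
    constructor
    · have : (-M : ℝ) ≤ m := by
        by_contra hcon
        nlinarith [not_le.1 hcon]
      exact_mod_cast this
    · have : (m : ℝ) ≤ M := by
        by_contra hcon
        nlinarith [not_le.1 hcon]
      exact_mod_cast this
  refine ⟨f '' Set.Icc (-M) M, (Set.finite_Icc _ _).image f, ?_⟩
  have := eventually_closed_cover (Set.finite_Icc (-M) M) hK hcov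
  filter_upwards [this, eventually_mem_nhdsWithin] with w ⟨m, hm, h1, h2⟩ hwS
  refine ⟨f m, ⟨m, hm, rfl⟩, ?_, ?_, ?_, ?_⟩
  · rw [hfeq]
    exact h1
  · rw [hfeq]
    exact h2
  · rw [hfeq]
    exact stripMap_eq hn hodd hq hk hk' hi (hstrip z (hSmem z hz)) h1
  · rw [hfeq]
    exact stripMap_eq hn hodd hq hk hk' hi (hstrip w (hSmem w hwS)) h2

end

/-! ### The dihedral group -/

section Dihedral

variable {n : ℕ}

theorem tv_mul_tv (i j : ℤ) : tv n i * tv n j = tv n (i + j) := by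
  apply Complex.ext <;> simp [tv, ang_add, Real.cos_add, Real.sin_add]; ring

theorem nv_eq (j : ℤ) : nv n j = -Complex.I * tv n j := by
  apply Complex.ext <;> simp [nv, tv]

theorem conj_tv (j : ℤ) : (starRingEnd ℂ) (tv n j) = tv n (-j) := by
  apply Complex.ext <;> simp [tv, ang_neg]

theorem tv_zero : tv n 0 = 1 := by
  apply Complex.ext <;> simp [tv, ang_zero]

theorem norm_tv (j : ℤ) : ‖tv n j‖ = 1 := by
  rw [← sq_eq_sq₀ (norm_nonneg _) zero_le_one, Complex.sq_norm, Complex.normSq_apply]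
  have := Real.cos_sq_add_sin_sq (ang n j)
  simp only [tv]
  linarith

theorem norm_nv (j : ℤ) : ‖nv n j‖ = 1 := by
  rw [nv_eq]
  simp [norm_tv]

theorem nv_inj (hn : 3 ≤ n) {i j : ℤ} (h : nv n i = nv n j) : (2 * n : ℤ) ∣ j - i := by
  have h2 : ((1 : ℝ) * nv n i + (0 : ℝ) * nv n (i - 1) : ℂ) =
      (1 : ℝ) * nv n j + (0 : ℝ) * nv n (j - 1) := by simp [h]
  rcases chamber_unique hn zero_le_one le_rfl zero_le_one le_rfl h2 with h3 | h3 | h3 | h3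
  · simp at h3
  · exact h3.1
  · simp at h3
  · simp at h3

/-- The rotation by the angle `j π / n`. -/
noncomputable def rot (n : ℕ) (j : ℤ) : ℂ ≃ₗᵢ[ℝ] ℂ :=
  rotation ⟨tv n j, mem_sphere_zero_iff_norm.2 (norm_tv j)⟩

/-- The reflection with `nv i ↦ nv (j - i)`. -/
noncomputable def ref (n : ℕ) (j : ℤ) : ℂ ≃ₗᵢ[ℝ] ℂ :=
  Complex.conjLIE.trans ((rot n j).trans (LinearIsometryEquiv.neg ℝ))

theorem rot_apply (j : ℤ) (z : ℂ) : rot n j z = tv n j * z := rfl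

theorem ref_apply (j : ℤ) (z : ℂ) : ref n j z = -(tv n j * (starRingEnd ℂ) z) := rfl

theorem rot_nv (j i : ℤ) : rot n j (nv n i) = nv n (j + i) := by
  rw [rot_apply, nv_eq, nv_eq, ← tv_mul_tv]
  ring

theorem rot_tv (j i : ℤ) : rot n j (tv n i) = tv n (j + i) := by
  rw [rot_apply, ← tv_mul_tv]

theorem ref_nv (j i : ℤ) : ref n j (nv n i) = nv n (j - i) := by
  rw [ref_apply, nv_eq, nv_eq, sub_eq_add_neg, ← tv_mul_tv, map_mul, conj_tv]
  simp
  ring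

theorem ref_tv (j i : ℤ) : ref n j (tv n i) = -tv n (j - i) := by
  rw [ref_apply, sub_eq_add_neg, ← tv_mul_tv, conj_tv]

theorem rot_mul_rot (i j : ℤ) : rot n i * rot n j = rot n (i + j) := by
  ext z
  rw [LinearIsometryEquiv.coe_mul, Function.comp, rot_apply, rot_apply, rot_apply, ← tv_mul_tv]
  ring

theorem rot_mul_ref (i j : ℤ) : rot n i * ref n j = ref n (i + j) := by
  ext z
  rw [LinearIsometryEquiv.coe_mul, Function.comp, rot_apply, ref_apply, ref_apply, ← tv_mul_tv]
  ring

theorem ref_mul_rot (i j : ℤ) : ref n i * rot n j = ref n (i - j) := by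
  ext z
  rw [LinearIsometryEquiv.coe_mul, Function.comp, rot_apply, ref_apply, ref_apply, sub_eq_add_neg,
    ← tv_mul_tv, map_mul, conj_tv]
  ring

theorem ref_mul_ref (i j : ℤ) : ref n i * ref n j = rot n (i - j) := by
  ext z
  rw [LinearIsometryEquiv.coe_mul, Function.comp, rot_apply, ref_apply, ref_apply, sub_eq_add_neg,
    ← tv_mul_tv, map_neg, map_mul, conj_tv, Complex.conj_conj]
  ring

theorem rot_zero : rot n 0 = 1 := by
  ext z
  rw [rot_apply, tv_zero, one_mul]
  rfl

theorem rot_inv (j : ℤ) : (rot n j)⁻¹ = rot n (-j) := by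
  rw [inv_eq_iff_mul_eq_one, rot_mul_rot, add_neg_cancel, rot_zero]

theorem ref_inv (j : ℤ) : (ref n j)⁻¹ = ref n j := by
  rw [inv_eq_iff_mul_eq_one, ref_mul_ref, sub_self, rot_zero]

theorem rot_congr (hn : 0 < n) {i j : ℤ} (h : (2 * n : ℤ) ∣ i - j) : rot n i = rot n j := by
  ext z
  rw [rot_apply, rot_apply, tv_congr hn h]

theorem ref_congr (hn : 0 < n) {i j : ℤ} (h : (2 * n : ℤ) ∣ i - j) : ref n i = ref n j := by
  ext z
  rw [ref_apply, ref_apply, tv_congr hn h]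

/-- The reflection in the line spanned by a multiple of a unit vector `u`. -/
theorem reflection_span_apply {u : ℂ} (hu : ‖u‖ = 1) {r : ℝ} (hr : r ≠ 0) (z : ℂ) :
    (Submodule.span ℝ {(r : ℂ) * u}).reflection z = u * u * (starRingEnd ℂ) z := by
  have h2 : u.re * u.re + u.im * u.im = 1 := by
    rw [← Complex.normSq_apply, ← Complex.sq_norm, hu, one_pow]
  have h3 : ((‖(r : ℂ) * u‖ : ℝ) : ℝ) ^ 2 = r ^ 2 := by
    rw [norm_mul, hu, mul_one, Complex.norm_real, Real.norm_eq_abs, sq_abs]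
  have h4 : r * (inner ℝ ((r : ℂ) * u) z / r ^ 2) = u.re * z.re + u.im * z.im := by
    simp only [Complex.inner, map_mul, Complex.conj_ofReal, Complex.mul_re,
      Complex.mul_im, Complex.conj_re, Complex.conj_im, Complex.ofReal_re, Complex.ofReal_im]
    field_simp
    ring
  rw [Submodule.reflection_singleton_apply, RCLike.ofReal_real_eq_id, id, h3]
  generalize inner ℝ ((r : ℂ) * u) z / r ^ 2 = κ at h4 ⊢
  apply Complex.ext
  · simp
    linear_combination z.re * h2 + 2 * u.re * h4
  · simp
    linear_combination z.im * h2 + 2 * u.im * h4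

theorem reflection_span_nv {r : ℝ} (hr : r ≠ 0) (k : ℤ) {v : ℂ} (hv : v = r * nv n k) :
    (Submodule.span ℝ {v}).reflection = ref n (2 * k) := by
  subst hv
  ext z
  rw [reflection_span_apply (norm_nv k) hr, ref_apply, nv_eq, two_mul, ← tv_mul_tv]
  linear_combination (tv n k * tv n k * (starRingEnd ℂ) z) * Complex.I_mul_I

theorem reflection_span_tv (hn : 0 < n) {r : ℝ} (hr : r ≠ 0) (k : ℤ) {v : ℂ}
    (hv : v = r * tv n k) : (Submodule.span ℝ {v}).reflection = ref n (2 * k + n) := by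
  subst hv
  ext z
  rw [reflection_span_apply (norm_tv k) hr, ref_apply, tv_add_self hn, two_mul, ← tv_mul_tv]
  ring

/-- Membership in the dihedral group of order `4 n`. -/
def IsDih (n : ℕ) (g : ℂ ≃ₗᵢ[ℝ] ℂ) : Prop := ∃ j, g = rot n j ∨ g = ref n j

theorem isDih_rot (j : ℤ) : IsDih n (rot n j) := ⟨j, Or.inl rfl⟩

theorem isDih_ref (j : ℤ) : IsDih n (ref n j) := ⟨j, Or.inr rfl⟩

theorem IsDih.mul {g h : ℂ ≃ₗᵢ[ℝ] ℂ} (hg : IsDih n g) (hh : IsDih n h) : IsDih n (g * h) := by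
  obtain ⟨i, rfl | rfl⟩ := hg <;> obtain ⟨j, rfl | rfl⟩ := hh
  · exact ⟨_, Or.inl (rot_mul_rot i j)⟩
  · exact ⟨_, Or.inr (rot_mul_ref i j)⟩
  · exact ⟨_, Or.inr (ref_mul_rot i j)⟩
  · exact ⟨_, Or.inl (ref_mul_ref i j)⟩

theorem IsDih.inv {g : ℂ ≃ₗᵢ[ℝ] ℂ} (hg : IsDih n g) : IsDih n g⁻¹ := by
  obtain ⟨i, rfl | rfl⟩ := hg
  · exact ⟨_, Or.inl (rot_inv i)⟩
  · exact ⟨_, Or.inr (ref_inv i)⟩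

theorem finite_isDih (hn : 0 < n) : {g | IsDih n g}.Finite := by
  have h : {g | IsDih n g} ⊆ rot n '' Set.Ico 0 (2 * n) ∪ ref n '' Set.Ico 0 (2 * n) := by
    rintro g ⟨j, hj⟩
    have h1 : j % (2 * n) ∈ Set.Ico (0 : ℤ) (2 * n) :=
      ⟨Int.emod_nonneg _ (by omega), Int.emod_lt_of_pos _ (by omega)⟩
    have h2 : (2 * n : ℤ) ∣ j % (2 * n) - j := (Int.mod_modEq j (2 * n)).symm.dvd
    rcases hj with rfl | rfl
    · exact Or.inl ⟨_, h1, rot_congr hn h2⟩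
    · exact Or.inr ⟨_, h1, ref_congr hn h2⟩
  exact (((Set.finite_Ico _ _).image _).union ((Set.finite_Ico _ _).image _)).subset h

/-- The character of the dihedral group that is trivial on `rot j` and `ref j` for even `j`. -/
def EvenDih (n : ℕ) (g : ℂ ≃ₗᵢ[ℝ] ℂ) : Prop := ∃ e, Even e ∧ g (nv n 0) = nv n e

theorem evenDih_rot (hn : 3 ≤ n) (j : ℤ) : EvenDih n (rot n j) ↔ Even j := by
  constructor
  · rintro ⟨e, he, h⟩
    rw [rot_nv, add_zero] at h
    exact (even_iff_of_dvd (nv_inj hn h)).1 he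
  · exact fun h => ⟨j, h, by rw [rot_nv, add_zero]⟩

theorem evenDih_ref (hn : 3 ≤ n) (j : ℤ) : EvenDih n (ref n j) ↔ Even j := by
  constructor
  · rintro ⟨e, he, h⟩
    rw [ref_nv, sub_zero] at h
    exact (even_iff_of_dvd (nv_inj hn h)).1 he
  · exact fun h => ⟨j, h, by rw [ref_nv, sub_zero]⟩

theorem EvenDih.mul_ref_iff (hn : 3 ≤ n) {g : ℂ ≃ₗᵢ[ℝ] ℂ} (hg : IsDih n g) (j : ℤ) :
    EvenDih n (g * ref n j) ↔ (EvenDih n g ↔ Even j) := by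
  obtain ⟨i, rfl | rfl⟩ := hg
  · rw [rot_mul_ref, evenDih_rot hn, evenDih_ref hn, Int.even_add]
  · rw [ref_mul_ref, evenDih_rot hn, evenDih_ref hn, Int.even_sub]

/-- The action on the frames `nv i`, `tv i`. -/
theorem IsDih.exists_frame (hn : 3 ≤ n) {g : ℂ ≃ₗᵢ[ℝ] ℂ} (hg : IsDih n g) (i : ℤ) :
    ∃ (i' : ℤ) (ε : ℝ), (ε = 1 ∨ ε = -1) ∧ g (nv n i) = nv n i' ∧ g (tv n i) = ε * tv n i' ∧
      (Even i' ↔ (EvenDih n g ↔ Even i)) := by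
  obtain ⟨j, rfl | rfl⟩ := hg
  · refine ⟨j + i, 1, Or.inl rfl, rot_nv j i, by simp [rot_tv], ?_⟩
    rw [evenDih_rot hn, Int.even_add]
  · refine ⟨j - i, -1, Or.inr rfl, ref_nv j i, by simp [ref_tv], ?_⟩
    rw [evenDih_ref hn, Int.even_sub]

theorem exists_isDih_frame (hn : 3 ≤ n) (i i' : ℤ) {ε : ℝ} (hε : ε = 1 ∨ ε = -1) :
    ∃ g, IsDih n g ∧ g (nv n i) = nv n i' ∧ g (tv n i) = ε * tv n i' ∧
      (EvenDih n g ↔ (Even i' ↔ Even i)) := by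
  rcases hε with rfl | rfl
  · refine ⟨_, isDih_rot (i' - i), ?_, ?_, ?_⟩
    · rw [rot_nv, sub_add_cancel]
    · rw [rot_tv, sub_add_cancel]
      simp
    · rw [evenDih_rot hn, Int.even_sub]
  · refine ⟨_, isDih_ref (i' + i), ?_, ?_, ?_⟩
    · rw [ref_nv, add_sub_cancel_right]
    · rw [ref_tv, add_sub_cancel_right]
      simp
    · rw [evenDih_ref hn, Int.even_add]

theorem eq_nv_add_tv (k : ℤ) (z : ℂ) : z = dot z (nv n k) * nv n k + dot z (tv n k) * tv n k := by
  have := Real.sin_sq_add_cos_sq (ang n k)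
  apply Complex.ext
  · simp [dot, nv, tv, -Complex.ofReal_cos, -Complex.ofReal_sin]
    linear_combination -z.re * this
  · simp [dot, nv, tv, -Complex.ofReal_cos, -Complex.ofReal_sin]
    linear_combination -z.im * this

theorem map_ofReal_mul (g : ℂ ≃ₗᵢ[ℝ] ℂ) (a : ℝ) (z : ℂ) : g (a * z) = a * g z := by
  rw [← Complex.real_smul, map_smul, Complex.real_smul]

theorem linearIsometryEquiv_ext_frame (k : ℤ) {g g' : ℂ ≃ₗᵢ[ℝ] ℂ} (h1 : g (nv n k) = g' (nv n k))
    (h2 : g (tv n k) = g' (tv n k)) : g = g' := by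
  ext z
  rw [eq_nv_add_tv (n := n) k z, map_add, map_add, map_ofReal_mul, map_ofReal_mul, map_ofReal_mul,
    map_ofReal_mul, h1, h2]

/-- A dihedral map takes the standard chamber to a chamber. -/
theorem IsDih.map_chamber (hn : 3 ≤ n) {g : ℂ ≃ₗᵢ[ℝ] ℂ} (hg : IsDih n g) (k : ℤ) :
    (∃ e, g = rot n (e - k) ∧ (EvenDih n g ↔ (Even e ↔ Even k)) ∧ ∀ a b : ℝ,
      g (a * nv n k + b * nv n (k - 1)) = a * nv n e + b * nv n (e - 1)) ∨
    (∃ e, g = ref n (e + k - 1) ∧ (EvenDih n g ↔ ¬ (Even e ↔ Even k)) ∧ ∀ a b : ℝ,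
      g (a * nv n k + b * nv n (k - 1)) = b * nv n e + a * nv n (e - 1)) := by
  obtain ⟨j, rfl | rfl⟩ := hg
  · refine Or.inl ⟨j + k, by rw [add_sub_cancel_right], ?_, fun a b => ?_⟩
    · rw [evenDih_rot hn, Int.even_add]
      tauto
    · rw [map_add, map_ofReal_mul, map_ofReal_mul, rot_nv, rot_nv]
      congr 3
      ring
  · refine Or.inr ⟨j - k + 1, by congr 1; ring, ?_, fun a b => ?_⟩
    · rw [evenDih_ref hn, even_add_one_iff, Int.even_sub]
      tauto
    · rw [map_add, map_ofReal_mul, map_ofReal_mul, ref_nv, ref_nv, add_comm]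
      congr 3 <;> ring

/-- Equal images lie in the same chamber or on the common wall of two adjacent chambers. As the
parities agree, the same chamber means the same map, and adjacent chambers mean that the maps differ
by the reflection in the shared wall. -/
theorem IsDih.eq_of_chamber (hn : 3 ≤ n) {g g' : ℂ ≃ₗᵢ[ℝ] ℂ} (hg : IsDih n g) (hg' : IsDih n g')
    (hpar : EvenDih n g ↔ EvenDih n g') (k : ℤ) {a b a' b' : ℝ} (ha : 0 ≤ a) (hb : 0 ≤ b)
    (ha' : 0 ≤ a') (hb' : 0 ≤ b')
    (h : g (a * nv n k + b * nv n (k - 1)) = g' (a' * nv n k + b' * nv n (k - 1))) :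
    a' = a ∧ b' = b ∧ ((a = 0 ∧ b = 0) ∨ g' = g ∨ (g' = g * ref n (2 * k) ∧ b = 0) ∨
      (g' = g * ref n (2 * (k - 1)) ∧ a = 0)) := by
  have hn0 : 0 < n := by omega
  have hp : ∀ {e e' : ℤ}, (2 * n : ℤ) ∣ e' - e - 1 → ¬ (Even e ↔ Even e') := by
    intro e e' h1 h2
    have := even_iff_of_dvd (n := n) (i := e' - 1) (j := e) (by convert h1 using 1; ring)
    rw [even_sub_one_iff] at this
    tauto
  have hp' : ∀ {e e' : ℤ}, (2 * n : ℤ) ∣ e - e' - 1 → ¬ (Even e ↔ Even e') := by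
    intro e e' h1 h2
    exact hp h1 h2.symm
  rcases hg.map_chamber hn k with ⟨e, h1, h2, h3⟩ | ⟨e, h1, h2, h3⟩ <;>
    rcases hg'.map_chamber hn k with ⟨e', h1', h2', h3'⟩ | ⟨e', h1', h2', h3'⟩
  all_goals rw [h3, h3'] at h
  · rcases chamber_unique hn ha hb ha' hb' h with ⟨z1, z2, z3, z4⟩ | ⟨z0, z1, z2⟩ | ⟨z0, -⟩ | ⟨z0, -⟩
    · exact ⟨by rw [z3, z1], by rw [z4, z2], Or.inl ⟨z1, z2⟩⟩
    · refine ⟨z1, z2, Or.inr (Or.inl ?_)⟩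
      rw [h1, h1']
      exact rot_congr hn0 (by convert z0 using 1; ring)
    · have := hp z0
      tauto
    · have := hp' z0
      tauto
  · rcases chamber_unique hn ha hb hb' ha' h with ⟨z1, z2, z3, z4⟩ | ⟨z0, -⟩ | ⟨z0, z1, z2, z3⟩ |
      ⟨z0, z1, z2, z3⟩
    · exact ⟨by rw [z4, z1], by rw [z3, z2], Or.inl ⟨z1, z2⟩⟩
    · have := even_iff_of_dvd z0
      tauto
    · refine ⟨z3, by rw [z2, z1], Or.inr (Or.inr (Or.inl ⟨?_, z1⟩))⟩
      rw [h1, h1', rot_mul_ref]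
      exact ref_congr hn0 (by convert z0 using 1; ring)
    · refine ⟨by linarith, by linarith, Or.inr (Or.inr (Or.inr ⟨?_, by linarith⟩))⟩
      rw [h1, h1', rot_mul_ref]
      refine ref_congr hn0 ((dvd_neg.2 z0).trans (dvd_of_eq ?_))
      ring
  · rcases chamber_unique hn hb ha ha' hb' h with ⟨z1, z2, z3, z4⟩ | ⟨z0, -⟩ | ⟨z0, z1, z2, z3⟩ |
      ⟨z0, z1, z2, z3⟩
    · exact ⟨by rw [z3, z2], by rw [z4, z1], Or.inl ⟨z2, z1⟩⟩
    · have := even_iff_of_dvd z0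
      tauto
    · refine ⟨by linarith, by linarith, Or.inr (Or.inr (Or.inr ⟨?_, by linarith⟩))⟩
      rw [h1, h1', ref_mul_ref]
      exact rot_congr hn0 (z0.trans (dvd_of_eq (by ring)))
    · refine ⟨by linarith, by linarith, Or.inr (Or.inr (Or.inl ⟨?_, by linarith⟩))⟩
      rw [h1, h1', ref_mul_ref]
      refine rot_congr hn0 ((dvd_neg.2 z0).trans (dvd_of_eq ?_))
      ring
  · rcases chamber_unique hn hb ha hb' ha' h with ⟨z1, z2, z3, z4⟩ | ⟨z0, z1, z2⟩ | ⟨z0, -⟩ | ⟨z0, -⟩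
    · exact ⟨by rw [z4, z2], by rw [z3, z1], Or.inl ⟨z2, z1⟩⟩
    · refine ⟨z2, z1, Or.inr (Or.inl ?_)⟩
      rw [h1, h1']
      exact ref_congr hn0 (by convert z0 using 1; ring)
    · have := hp z0
      tauto
    · have := hp' z0
      tauto

/-- Two dihedral maps of the same parity differ by a product of the reflections in the walls of a
chamber. -/
theorem IsDih.inv_mul_mem_closure (hn : 3 ≤ n) {g g' : ℂ ≃ₗᵢ[ℝ] ℂ} (hg : IsDih n g)
    (hg' : IsDih n g') (hpar : EvenDih n g ↔ EvenDih n g') (k : ℤ)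
    {H : Subgroup (ℂ ≃ₗᵢ[ℝ] ℂ)} (h1 : ref n (2 * k) ∈ H) (h2 : ref n (2 * (k - 1)) ∈ H) :
    g⁻¹ * g' ∈ H := by
  -- The product of the two wall reflections is the rotation by two steps. Its powers and one
  -- reflection give all even elements.
  have hr2 : rot n 2 ∈ H := by
    have := H.mul_mem h1 h2
    rwa [ref_mul_ref, show 2 * k - 2 * (k - 1) = 2 by ring] at this
  have hpow : ∀ m : ℕ, rot n (2 * m) ∈ H := by
    intro m
    induction m with
    | zero => simp [rot_zero, H.one_mem]
    | succ m ih =>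
      have := H.mul_mem ih hr2
      rw [rot_mul_rot] at this
      convert this using 2
      push_cast
      ring
  have hrot : ∀ m : ℤ, Even m → rot n m ∈ H := by
    rintro m ⟨l, rfl⟩
    rcases Int.eq_nat_or_neg l with ⟨t, rfl | rfl⟩
    · rw [← two_mul]
      exact hpow t
    · have := H.inv_mem (hpow t)
      rw [rot_inv] at this
      convert this using 2
      ring
  have href : ∀ m : ℤ, Even m → ref n m ∈ H := by
    intro m hm
    have := H.mul_mem (hrot (m - 2 * k) (hm.sub (even_two_mul k))) h1
    rwa [rot_mul_ref, sub_add_cancel] at this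
  obtain ⟨i, rfl | rfl⟩ := hg <;> obtain ⟨j, rfl | rfl⟩ := hg'
  · rw [evenDih_rot hn, evenDih_rot hn] at hpar
    rw [rot_inv, rot_mul_rot]
    exact hrot _ (by rw [Int.even_add, even_neg]; exact hpar)
  · rw [evenDih_rot hn, evenDih_ref hn] at hpar
    rw [rot_inv, rot_mul_ref]
    exact href _ (by rw [Int.even_add, even_neg]; exact hpar)
  · rw [evenDih_ref hn, evenDih_rot hn] at hpar
    rw [ref_inv, ref_mul_rot]
    exact href _ (by rw [Int.even_sub]; exact hpar)
  · rw [evenDih_ref hn, evenDih_ref hn] at hpar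
    rw [ref_inv, ref_mul_ref]
    exact hrot _ (by rw [Int.even_sub]; exact hpar)

end Dihedral

/-! ### The table in a frame -/

theorem mem_convexHull_triple_iff {A B C x : ℂ} : x ∈ convexHull ℝ {A, B, C} ↔
    ∃ α β : ℝ, 0 ≤ α ∧ 0 ≤ β ∧ α + β ≤ 1 ∧ x = C + (α * (A - C) + β * (B - C)) := by
  constructor
  · rw [← convexJoin_singleton_segment, mem_convexJoin]
    rintro ⟨_, rfl, _, ⟨s, t, hs, ht, hst, rfl⟩, a, b, ha, hb, hab, rfl⟩
    refine ⟨a, b * s, ha, mul_nonneg hb hs, by nlinarith, ?_⟩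
    obtain rfl : b = 1 - a := by linarith
    obtain rfl : t = 1 - s := by linarith
    simp only [Complex.real_smul]
    push_cast
    ring
  · rintro ⟨α, β, hα, hβ, hs, rfl⟩
    have h := (convex_convexHull ℝ {A, B, C}).sum_mem (t := Finset.univ) (w := ![α, β, 1 - α - β])
      (z := ![A, B, C]) (by intro i _; fin_cases i <;> simp <;> linarith)
      (by simp [Fin.sum_univ_three])
      (by intro i _; fin_cases i <;> exact subset_convexHull ℝ _ (by simp))
    convert h using 1
    simp [Fin.sum_univ_three]
    ring

/-- The vertices of the table, expressed in a frame `nv d`, `nv (d - 1)` based at `p 2`. -/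
structure IsFramed (n : ℕ) (d : ℤ) (p : Fin 4 → ℂ) : Prop where
  vert_zero : p 0 = p 2 + (nv n d + (√2 : ℝ) * nv n (d - 1))
  vert_one : p 1 = p 2 + ((1 + √2 * Real.cos (ang n 1) : ℝ) : ℂ) * nv n d
  vert_three : p 3 = p 2 + ((2 * Real.cos (ang n 1) + √2 : ℝ) : ℂ) * nv n (d - 1)

/-- A quadrangular corner with vertex `v` between the directions `nv k` and `nv (k - 1)`. -/
def corner (n : ℕ) (k : ℤ) (v : ℂ) (H H' : ℝ) : Set ℂ :=
  {x | ∃ a b : ℝ, 0 ≤ a ∧ 0 ≤ b ∧ a + b * Real.cos (ang n 1) ≤ H ∧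
    a * Real.cos (ang n 1) + b ≤ H' ∧ x = v + (a * nv n k + b * nv n (k - 1))}

section

variable {n : ℕ} {d : ℤ} {p : Fin 4 → ℂ}

theorem cos_ang_one_nonneg (hn : 2 ≤ n) : 0 ≤ Real.cos (ang n 1) := by
  have : 0 ≤ Real.pi / n := div_nonneg Real.pi_pos.le (Nat.cast_nonneg n)
  rw [ang_one]
  exact Real.cos_nonneg_of_neg_pi_div_two_le_of_le (by linarith [Real.pi_pos])
    (div_le_div_of_nonneg_left Real.pi_pos.le two_pos (by exact_mod_cast hn))

theorem cos_ang_one_lt_one (hn : 2 ≤ n) : Real.cos (ang n 1) < 1 := by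
  have h1 := Real.sin_sq_add_cos_sq (ang n 1)
  have h2 : 0 < Real.sin (ang n 1) := sin_ang_pos (by omega) one_pos (by omega)
  nlinarith [Real.cos_le_one (ang n 1)]

/-- This is `cos(π/4) < cos(π/n)`, the place where `n > 4` is used to exclude symmetries of the
table. -/
theorem one_lt_sqrt_two_mul_cos (hn : 5 ≤ n) : 1 < √2 * Real.cos (ang n 1) := by
  have h : Real.cos (Real.pi / 4) < Real.cos (ang n 1) := by
    rw [ang_one]
    have hn' : (4 : ℝ) < n := by exact_mod_cast hn
    refine Real.cos_lt_cos_of_nonneg_of_le_pi (by positivity) (by linarith [Real.pi_pos]) ?_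
    exact div_lt_div_of_pos_left Real.pi_pos (by norm_num) hn'
  rw [Real.cos_pi_div_four] at h
  have h2 : √2 * √2 = 2 := Real.mul_self_sqrt (by norm_num)
  nlinarith [Real.sqrt_pos.2 (zero_lt_two' ℝ)]

theorem isCompact_corner (hn : 2 ≤ n) (k : ℤ) (v : ℂ) (H H' : ℝ) : IsCompact (corner n k v H H') := by
  have hc := cos_ang_one_nonneg hn
  have h : corner n k v H H' = (fun t : ℝ × ℝ => v + (t.1 * nv n k + t.2 * nv n (k - 1))) ''
      {t | 0 ≤ t.1 ∧ 0 ≤ t.2 ∧ t.1 + t.2 * Real.cos (ang n 1) ≤ H ∧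
        t.1 * Real.cos (ang n 1) + t.2 ≤ H'} := by
    ext x
    constructor
    · rintro ⟨a, b, h1, h2, h3, h4, rfl⟩
      exact ⟨(a, b), ⟨h1, h2, h3, h4⟩, rfl⟩
    · rintro ⟨⟨a, b⟩, ⟨h1, h2, h3, h4⟩, rfl⟩
      exact ⟨a, b, h1, h2, h3, h4, rfl⟩
  rw [h]
  refine IsCompact.image ?_ (by fun_prop)
  refine (isCompact_Icc (a := ((0 : ℝ), (0 : ℝ))) (b := (H, H'))).of_isClosed_subset ?_ ?_
  · have h1 : IsClosed {t : ℝ × ℝ | 0 ≤ t.1} := isClosed_le (by fun_prop) (by fun_prop)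
    have h2 : IsClosed {t : ℝ × ℝ | 0 ≤ t.2} := isClosed_le (by fun_prop) (by fun_prop)
    have h3 : IsClosed {t : ℝ × ℝ | t.1 + t.2 * Real.cos (ang n 1) ≤ H} :=
      isClosed_le (by fun_prop) (by fun_prop)
    have h4 : IsClosed {t : ℝ × ℝ | t.1 * Real.cos (ang n 1) + t.2 ≤ H'} :=
      isClosed_le (by fun_prop) (by fun_prop)
    exact h1.inter (h2.inter (h3.inter h4))
  · rintro ⟨a, b⟩ ⟨h1, h2, h3, h4⟩
    exact ⟨⟨h1, h2⟩, by nlinarith [mul_nonneg h2 hc], by nlinarith [mul_nonneg h1 hc]⟩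

theorem nv_two_mul (k : ℤ) : nv n (k - 1) = 2 * Real.cos (ang n 1) * nv n k - nv n (k + 1) := by
  rw [nv_add_one, nv_sub_one]
  ring

theorem nv_sub_two (k : ℤ) : nv n (k - 2) = 2 * Real.cos (ang n 1) * nv n (k - 1) - nv n k := by
  have := nv_two_mul (n := n) (k - 1)
  rwa [sub_add_cancel, sub_sub, one_add_one_eq_two] at this

theorem comb_inj (hn : 3 ≤ n) {k : ℤ} {a b a' b' : ℝ}
    (h : (a * nv n k + b * nv n (k - 1) : ℂ) = a' * nv n k + b' * nv n (k - 1)) :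
    a = a' ∧ b = b' := by
  have hs : 0 < Real.sin (ang n 1) := sin_ang_pos (by omega) one_pos (by omega)
  have c1 := congrArg (cross (nv n (k - 1))) h
  have c2 := congrArg (cross (nv n k)) h
  simp only [cross_comb, cross_nv_nv, sub_self, ang_zero, Real.sin_zero,
    show k - (k - 1) = 1 by ring, show k - 1 - k = -1 by ring, ang_neg, Real.sin_neg,
    mul_zero, add_zero, zero_add] at c1 c2
  exact ⟨mul_right_cancel₀ hs.ne' c1, mul_right_cancel₀ (neg_ne_zero.2 hs.ne') c2⟩

namespace IsFramed

/-- Seen from `p 3`, the sides point in the directions `d - 1 + n` (to `p 2`) and `d - 2 + n` (to `p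
0`). The corner at `p 3` thus has the same form as the one at `p 2`, with another direction index.
-/
theorem vert_zero' (hp : IsFramed n d p) (hn : 0 < n) : p 0 = p 3 + nv n (d - 1 + n - 1) := by
  rw [show d - 1 + n - 1 = d - 2 + n by ring, nv_add_self hn, nv_sub_two, hp.vert_zero,
    hp.vert_three]
  push_cast
  ring

theorem sub_zero_one (hp : IsFramed n d p)
    : p 1 - p 0 = ((√2 * Real.sin (ang n 1) : ℝ) : ℂ) * tv n d := by
  rw [hp.vert_zero, hp.vert_one, nv_sub_one]
  push_cast
  ring

theorem sideReflection_zero (hp : IsFramed n d p)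
    (hn : 2 ≤ n) : sideReflection p 0 = ref n (2 * d + n) := by
  have hs : 0 < Real.sin (ang n 1) := sin_ang_pos (by omega) one_pos (by omega)
  exact reflection_span_tv (by omega) (by positivity) d hp.sub_zero_one

theorem sideReflection_one (hp : IsFramed n d p)
    (hn : 2 ≤ n) : sideReflection p 1 = ref n (2 * d) := by
  have hc := cos_ang_one_nonneg hn
  have h0 : 0 ≤ √2 * Real.cos (ang n 1) := by positivity
  refine reflection_span_nv (r := -(1 + √2 * Real.cos (ang n 1))) (by linarith) d ?_
  change p 2 - p 1 = _
  rw [hp.vert_one]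
  push_cast
  ring

theorem sideReflection_two (hp : IsFramed n d p)
    (hn : 2 ≤ n) : sideReflection p 2 = ref n (2 * (d - 1)) := by
  have hc := cos_ang_one_nonneg hn
  refine reflection_span_nv (r := 2 * Real.cos (ang n 1) + √2) (by positivity) (d - 1) ?_
  change p 3 - p 2 = _
  rw [hp.vert_three]
  ring

theorem sideReflection_three (hp : IsFramed n d p)
    (hn : 2 ≤ n) : sideReflection p 3 = ref n (2 * (d - 1 + n - 1)) := by
  refine reflection_span_nv one_ne_zero _ ?_
  change p 0 - p 3 = _
  rw [hp.vert_zero' (by omega)]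
  simp

theorem isDih_of_mem (hp : IsFramed n d p)
    (hn : 2 ≤ n) {g : ℂ ≃ₗᵢ[ℝ] ℂ} (hg : g ∈ reflectionGroup p) : IsDih n g := by
  unfold reflectionGroup at hg
  induction hg using Subgroup.closure_induction with
  | mem x hx =>
    obtain ⟨i, rfl⟩ := hx
    fin_cases i
    · exact ⟨_, Or.inr (hp.sideReflection_zero hn)⟩
    · exact ⟨_, Or.inr (hp.sideReflection_one hn)⟩
    · exact ⟨_, Or.inr (hp.sideReflection_two hn)⟩
    · exact ⟨_, Or.inr (hp.sideReflection_three hn)⟩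
  | one => exact ⟨0, Or.inl rot_zero.symm⟩
  | mul x y _ _ hx hy => exact hx.mul hy
  | inv x _ hx => exact hx.inv

theorem ref_even_mem (hp : IsFramed n d p)
    (hn : 3 ≤ n) {g : ℂ ≃ₗᵢ[ℝ] ℂ} (hg : IsDih n g) (he : EvenDih n g) :
    g ∈ reflectionGroup p := by
  have h1 : ref n (2 * d) ∈ reflectionGroup p :=
    Subgroup.subset_closure ⟨1, hp.sideReflection_one (by omega)⟩
  have h2 : ref n (2 * (d - 1)) ∈ reflectionGroup p :=
    Subgroup.subset_closure ⟨2, hp.sideReflection_two (by omega)⟩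
  have := IsDih.inv_mul_mem_closure hn (isDih_rot 0) hg
    (by rw [evenDih_rot hn]; simp [he]) d h1 h2
  rwa [rot_zero, inv_one, one_mul] at this

/-- The sides meeting at `p 2` already generate the even half. The reflection in side 0 has the
index `2 * d + n`, which is odd because `n` is, and reaches the other half. -/
theorem mem_of_isDih (hp : IsFramed n d p)
    (hn : 3 ≤ n) (hodd : Odd n) {g : ℂ ≃ₗᵢ[ℝ] ℂ} (hg : IsDih n g) :
    g ∈ reflectionGroup p := by
  by_cases he : EvenDih n g
  · exact hp.ref_even_mem hn hg he
  · have h0 : ref n (2 * d + n) ∈ reflectionGroup p :=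
      Subgroup.subset_closure ⟨0, hp.sideReflection_zero (by omega)⟩
    have h1 : g * ref n (2 * d + n) ∈ reflectionGroup p := by
      refine hp.ref_even_mem hn (hg.mul (isDih_ref _)) ?_
      rw [EvenDih.mul_ref_iff hn hg, even_self_add_iff hodd]
      simp [he]
    have h2 := (reflectionGroup p).mul_mem h1 h0
    rwa [mul_assoc, ref_mul_ref, sub_self, rot_zero, mul_one] at h2

theorem finite_reflectionGroup (hp : IsFramed n d p) (hn : 2 ≤ n) : Finite (reflectionGroup p) :=
  Set.Finite.subset (finite_isDih (by omega)) fun _ hg => hp.isDih_of_mem hn hg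

/-- In frame coordinates the diagonal from `p 2` to `p 0` is `b = √2 * a`. The two other bounds are
the lines through side 0 and side 3. -/
theorem mem_tableRegion_iff (hp : IsFramed n d p)
    (hn : 2 ≤ n) {x : ℂ} : x ∈ tableRegion p ↔ ∃ a b : ℝ, 0 ≤ a ∧ 0 ≤ b ∧
    ((b ≤ √2 * a ∧ a + b * Real.cos (ang n 1) ≤ 1 + √2 * Real.cos (ang n 1)) ∨
      (√2 * a ≤ b ∧ 2 * Real.cos (ang n 1) * a + b ≤ 2 * Real.cos (ang n 1) + √2)) ∧
    x = p 2 + (a * nv n d + b * nv n (d - 1)) := by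
  have hc := cos_ang_one_nonneg hn
  have h2 : √2 * √2 = 2 := Real.mul_self_sqrt (by norm_num)
  have h20 : 0 < √2 := by positivity
  have hh : 0 < 1 + √2 * Real.cos (ang n 1) := by positivity
  have hL : 0 < 2 * Real.cos (ang n 1) + √2 := by positivity
  have e3 : ({p 0, p 2, p 3} : Set ℂ) = {p 0, p 3, p 2} := by
    rw [Set.pair_comm]
  unfold tableRegion
  rw [e3, Set.mem_union, mem_convexHull_triple_iff, mem_convexHull_triple_iff, hp.vert_zero,
    hp.vert_one, hp.vert_three]
  generalize Real.cos (ang n 1) = c at *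
  constructor
  · rintro (⟨α, β, hα, hβ, hs, rfl⟩ | ⟨α, β, hα, hβ, hs, rfl⟩)
    · refine ⟨α + β * (1 + √2 * c), √2 * α, by positivity, by positivity, Or.inl ⟨?_, ?_⟩, ?_⟩
      · nlinarith [mul_nonneg hβ hh.le]
      · nlinarith [mul_nonneg hβ hh.le]
      · push_cast
        ring
    · refine ⟨α, √2 * α + β * (2 * c + √2), hα, by positivity, Or.inr ⟨?_, ?_⟩, ?_⟩
      · nlinarith [mul_nonneg hβ hL.le]
      · nlinarith [mul_nonneg hβ hL.le]
      · push_cast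
        ring
  · rintro ⟨a, b, ha, hb, (⟨h3, h4⟩ | ⟨h3, h4⟩), rfl⟩
    · have e1 : b = √2 * (b / √2) := by field_simp
      have e4 : b / √2 ≤ a := by rw [div_le_iff₀ h20]; linarith
      generalize b / √2 = β at *
      subst e1
      have e2 : a - β = (a - β) / (1 + √2 * c) * (1 + √2 * c) := by field_simp
      have e5 : 0 ≤ (a - β) / (1 + √2 * c) := div_nonneg (by linarith) hh.le
      generalize (a - β) / (1 + √2 * c) = γ at *
      obtain rfl : a = β + γ * (1 + √2 * c) := by linarith
      refine Or.inl ⟨β, γ, nonneg_of_mul_nonneg_right hb h20, e5, ?_, ?_⟩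
      · have : (β + γ) * (1 + √2 * c) ≤ 1 * (1 + √2 * c) := by nlinarith
        exact le_of_mul_le_mul_right this hh
      · push_cast
        ring
    · have e2 : b - √2 * a = (b - √2 * a) / (2 * c + √2) * (2 * c + √2) := by field_simp
      have e5 : 0 ≤ (b - √2 * a) / (2 * c + √2) := div_nonneg (by linarith) hL.le
      generalize (b - √2 * a) / (2 * c + √2) = γ at *
      obtain rfl : b = √2 * a + γ * (2 * c + √2) := by linarith
      refine Or.inr ⟨a, γ, ha, e5, ?_, ?_⟩
      · have : (a + γ) * (2 * c + √2) ≤ 1 * (2 * c + √2) := by nlinarith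
        exact le_of_mul_le_mul_right this hL
      · push_cast
        ring

theorem vert_three_add (hp : IsFramed n d p) (hn : 0 < n) (a b : ℝ) :
    p 3 + (a * nv n (d - 1 + n) + b * nv n (d - 1 + n - 1)) = p 2 + (b * nv n d +
      ((2 * Real.cos (ang n 1) + √2 - a - 2 * Real.cos (ang n 1) * b : ℝ) : ℂ) * nv n (d - 1)) := by
  rw [show d - 1 + n - 1 = d - 2 + n by ring, nv_add_self hn, nv_add_self hn, nv_sub_two,
    hp.vert_three]
  push_cast
  ring

/-- The cut is the perpendicular from `p 0` to side 2, with foot at distance `cos(π/n) + √2` from `p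
2`. In both corners the bounds are the apothems of the polygons they will fill. -/
theorem tableRegion_eq (hp : IsFramed n d p) (hn : 2 ≤ n) : tableRegion p =
    corner n d (p 2) (1 + √2 * Real.cos (ang n 1)) (Real.cos (ang n 1) + √2) ∪
      corner n (d - 1 + n) (p 3) (Real.cos (ang n 1)) 1 := by
  have hc := cos_ang_one_nonneg hn
  have hc1 := cos_ang_one_lt_one hn
  have h2 : √2 * √2 = 2 := Real.mul_self_sqrt (by norm_num)
  have h20 : 0 < √2 := by positivity
  ext x
  rw [hp.mem_tableRegion_iff hn, Set.mem_union]
  constructor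
  · rintro ⟨a, b, ha, hb, h, rfl⟩
    rcases le_or_gt (a * Real.cos (ang n 1) + b) (Real.cos (ang n 1) + √2) with h3 | h3
    · refine Or.inl ⟨a, b, ha, hb, ?_, h3, rfl⟩
      rcases h with h | h
      · exact h.2
      · have : a ≤ 1 := by nlinarith
        nlinarith [mul_nonneg hc (sub_nonneg.2 h3), mul_nonneg (sub_nonneg.2 this)
          (by nlinarith : 0 ≤ 1 - Real.cos (ang n 1) * Real.cos (ang n 1))]
    · have h4 : 2 * Real.cos (ang n 1) * a + b ≤ 2 * Real.cos (ang n 1) + √2 := by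
        rcases h with h | h
        · exfalso
          have h5 : 1 < a := by nlinarith
          nlinarith [mul_nonneg hc (sub_nonneg.2 h3.le), mul_pos (sub_pos.2 h5)
            (by nlinarith : 0 < 1 - Real.cos (ang n 1) * Real.cos (ang n 1))]
        · exact h.2
      refine Or.inr ⟨2 * Real.cos (ang n 1) + √2 - b - 2 * Real.cos (ang n 1) * a, a, by linarith,
        ha, by nlinarith, ?_, ?_⟩
      · have h6 : a * Real.cos (ang n 1) ≤ Real.cos (ang n 1) := by nlinarith
        have h7 : a ≤ 1 := by
          rcases h with h | h
          · nlinarith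
          · by_contra h8
            nlinarith
        nlinarith [mul_nonneg (sub_nonneg.2 h7)
          (by nlinarith : 0 ≤ 1 - Real.cos (ang n 1) * Real.cos (ang n 1))]
      · rw [hp.vert_three_add (by omega)]
        push_cast
        ring
  · rintro (⟨a, b, ha, hb, h3, h4, rfl⟩ | ⟨a, b, ha, hb, h3, h4, rfl⟩)
    · refine ⟨a, b, ha, hb, ?_, rfl⟩
      rcases le_total b (√2 * a) with h5 | h5
      · exact Or.inl ⟨h5, h3⟩
      · have : a ≤ 1 := by nlinarith
        exact Or.inr ⟨h5, by nlinarith⟩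
    · have hb1 : b ≤ 1 := by nlinarith
      refine ⟨b, 2 * Real.cos (ang n 1) + √2 - a - 2 * Real.cos (ang n 1) * b, hb, by nlinarith,
        Or.inr ⟨by nlinarith, by nlinarith⟩, hp.vert_three_add (by omega) a b⟩

end IsFramed

end

/-! ### Sides, seam and corners of the table -/

theorem mem_segment_add_iff {v u x : ℂ} {r : ℝ} (hr : 0 < r) :
    x ∈ segment ℝ v (v + r * u) ↔ ∃ t : ℝ, 0 ≤ t ∧ t ≤ r ∧ x = v + t * u := by
  rw [segment_eq_image']
  constructor
  · rintro ⟨θ, ⟨h0, h1⟩, rfl⟩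
    refine ⟨θ * r, by positivity, by nlinarith, ?_⟩
    simp only [Complex.real_smul]
    push_cast
    ring
  · rintro ⟨t, h0, h1, rfl⟩
    refine ⟨t / r, ⟨by positivity, (div_le_one hr).2 h1⟩, ?_⟩
    simp only [Complex.real_smul]
    have : (r : ℂ) ≠ 0 := by exact_mod_cast hr.ne'
    push_cast
    field_simp
    ring

section

variable {n : ℕ} {d : ℤ} {p : Fin 4 → ℂ}

/-- The direction index of the corner at `p 2` (for `false`) and at `p 3` (for `true`). -/
def cornerDir (n : ℕ) (d : ℤ) (t : Bool) : ℤ := if t then d - 1 + n else d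

/-- The vertices `p 2` and `p 3`. -/
def cornerVert (p : Fin 4 → ℂ) (t : Bool) : ℂ := if t then p 3 else p 2

noncomputable def cornerBound (n : ℕ) (t : Bool) : ℝ :=
  if t then Real.cos (ang n 1) else 1 + √2 * Real.cos (ang n 1)

noncomputable def cornerBound' (n : ℕ) (t : Bool) : ℝ := if t then 1 else Real.cos (ang n 1) + √2

/-- The two corners into which the table is cut. -/
def tableCorner (n : ℕ) (d : ℤ) (p : Fin 4 → ℂ) (t : Bool) : Set ℂ :=
  corner n (cornerDir n d t) (cornerVert p t) (cornerBound n t) (cornerBound' n t)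

open Classical in
/-- The polygon made of corners of type `t` of parity `σ`. -/
noncomputable def cornerPoly (t : Bool) (σ : Prop) : ℕ :=
  if σ then (if t then 0 else 1) else (if t then 3 else 2)

theorem cornerPoly_lt (t : Bool) (σ : Prop) : cornerPoly t σ < 4 := by
  unfold cornerPoly
  split_ifs <;> norm_num

theorem cornerPoly_inj {t t' : Bool} {σ σ' : Prop} (h : cornerPoly t σ = cornerPoly t' σ') :
    t = t' ∧ (σ ↔ σ') := by
  unfold cornerPoly at h
  split_ifs at h <;> simp_all

theorem exists_cornerPoly {i : ℕ} (hi : i < 4) : ∃ t σ, cornerPoly t σ = i := by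
  interval_cases i
  · exact ⟨true, True, by simp [cornerPoly]⟩
  · exact ⟨false, True, by simp [cornerPoly]⟩
  · exact ⟨false, False, by simp [cornerPoly]⟩
  · exact ⟨true, False, by simp [cornerPoly]⟩

theorem apo_cornerPoly (t : Bool) {σ : Prop} {e : ℤ} (h : σ ↔ Even e) :
    apo n (cornerPoly t σ) e = cornerBound n t := by
  cases t <;> by_cases hσ : σ <;>
    simp [cornerPoly, hσ, apo, ← h, cornerBound, wt]
  ring

theorem apo_cornerPoly' (t : Bool) {σ : Prop} {e : ℤ} (h : ¬ (σ ↔ Even e)) :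
    apo n (cornerPoly t σ) e = cornerBound' n t := by
  have h' : Even e ↔ ¬ σ := by tauto
  cases t <;> by_cases hσ : σ <;>
    simp [cornerPoly, hσ, apo, h', cornerBound', wt]
  ring

theorem even_cornerDir_iff (hodd : Odd n) (t : Bool) : Even (cornerDir n d t) ↔ Even d := by
  cases t
  · rfl
  · change Even (d - 1 + n) ↔ _
    rw [even_self_add_iff hodd, even_sub_one_iff, not_not]

/-- The polygon containing the image under `g` of the corner of type `t`. -/
noncomputable def placeIdx (n : ℕ) (d : ℤ) (t : Bool) (g : ℂ ≃ₗᵢ[ℝ] ℂ) : ℕ :=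
  cornerPoly t (EvenDih n g ↔ Even d)

/-- A corner is the part of a polygon in one chamber, so its dihedral images of one parity fill the
polygon; `exists_place` is the converse. -/
theorem map_mem_poly (hn : 3 ≤ n) (hodd : Odd n) {t : Bool} {x : ℂ} (hx : x ∈ tableCorner n d p t)
    {g : ℂ ≃ₗᵢ[ℝ] ℂ} (hg : IsDih n g) : g (x - cornerVert p t) ∈ poly n (placeIdx n d t g) := by
  obtain ⟨a, b, ha, hb, h1, h2, rfl⟩ := hx
  have hk := even_cornerDir_iff (d := d) hodd t
  rw [add_sub_cancel_left]
  rcases hg.map_chamber hn (cornerDir n d t) with ⟨e, -, h3, h4⟩ | ⟨e, -, h3, h4⟩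
  · have hσ : (EvenDih n g ↔ Even d) ↔ Even e := by tauto
    rw [h4, poly_mem_iff_of_chamber (by omega) _ ha hb, placeIdx, apo_cornerPoly t hσ,
      apo_cornerPoly' t (by rw [even_sub_one_iff]; tauto)]
    exact ⟨h1, h2⟩
  · have hσ : ¬ ((EvenDih n g ↔ Even d) ↔ Even e) := by tauto
    rw [h4, poly_mem_iff_of_chamber (by omega) _ hb ha, placeIdx, apo_cornerPoly' t hσ,
      apo_cornerPoly t (by rw [even_sub_one_iff]; tauto)]
    exact ⟨by linarith, by linarith⟩

theorem exists_place (hn : 3 ≤ n) (hodd : Odd n) {i : ℕ} (hi : i < 4) {z : ℂ}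
    (hz : z ∈ poly n i) : ∃ t g x, IsDih n g ∧ x ∈ tableCorner n d p t ∧ placeIdx n d t g = i ∧
      z = g (x - cornerVert p t) := by
  obtain ⟨t, σ, rfl⟩ := exists_cornerPoly hi
  obtain ⟨e, a, b, ha, hb, rfl⟩ := exists_chamber (by omega : 2 ≤ n) z
  have hk := even_cornerDir_iff (d := d) hodd t
  rw [poly_mem_iff_of_chamber (by omega) _ ha hb] at hz
  set k := cornerDir n d t with hkdef
  by_cases hσ : σ ↔ Even e
  · rw [apo_cornerPoly t hσ, apo_cornerPoly' t (by rw [even_sub_one_iff]; tauto)] at hz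
    refine ⟨t, rot n (e - k), cornerVert p t + (a * nv n k + b * nv n (k - 1)), isDih_rot _,
      ⟨a, b, ha, hb, hz.1, hz.2, rfl⟩, ?_, ?_⟩
    · unfold placeIdx
      congr 1
      rw [evenDih_rot hn, Int.even_sub]
      exact propext (by tauto)
    · rw [add_sub_cancel_left, map_add, map_ofReal_mul, map_ofReal_mul, rot_nv, rot_nv]
      congr 3 <;> ring
  · rw [apo_cornerPoly' t hσ, apo_cornerPoly t (by rw [even_sub_one_iff]; tauto)] at hz
    refine ⟨t, ref n (e + k - 1), cornerVert p t + (b * nv n k + a * nv n (k - 1)), isDih_ref _,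
      ⟨b, a, hb, ha, by linarith [hz.2], by linarith [hz.1], rfl⟩, ?_, ?_⟩
    · unfold placeIdx
      congr 1
      rw [evenDih_ref hn, even_sub_one_iff, Int.even_add]
      exact propext (by tauto)
    · rw [add_sub_cancel_left, map_add, map_ofReal_mul, map_ofReal_mul, ref_nv, ref_nv, add_comm]
      congr 3 <;> ring

namespace IsFramed

theorem mem_side_zero_iff (hp : IsFramed n d p) (hn : 2 ≤ n) {x : ℂ} : x ∈ side p 0 ↔
    ∃ t : ℝ, 0 ≤ t ∧ t ≤ √2 * Real.sin (ang n 1) ∧ x = p 1 + t * -tv n d := by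
  have hs : 0 < Real.sin (ang n 1) := sin_ang_pos (by omega) one_pos (by omega)
  rw [← mem_segment_add_iff (by positivity), side, segment_symm]
  change x ∈ segment ℝ (p 1) (p 0) ↔ _
  rw [mul_neg, ← sub_eq_add_neg, ← hp.sub_zero_one, sub_sub_cancel]

theorem mem_side_one_iff (hp : IsFramed n d p) (hn : 2 ≤ n) {x : ℂ} : x ∈ side p 1 ↔
    ∃ t : ℝ, 0 ≤ t ∧ t ≤ 1 + √2 * Real.cos (ang n 1) ∧ x = p 2 + t * nv n d := by
  have hc := cos_ang_one_nonneg hn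
  rw [← mem_segment_add_iff (by positivity), side, segment_symm, ← hp.vert_one]
  rfl

theorem mem_side_two_iff (hp : IsFramed n d p) (hn : 2 ≤ n) {x : ℂ} : x ∈ side p 2 ↔
    ∃ t : ℝ, 0 ≤ t ∧ t ≤ 2 * Real.cos (ang n 1) + √2 ∧ x = p 2 + t * nv n (d - 1) := by
  have hc := cos_ang_one_nonneg hn
  rw [← mem_segment_add_iff (by positivity), side, ← hp.vert_three]
  rfl

theorem mem_side_three_iff (hp : IsFramed n d p) (hn : 2 ≤ n) {x : ℂ} : x ∈ side p 3 ↔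
    ∃ t : ℝ, 0 ≤ t ∧ t ≤ 1 ∧ x = p 3 + t * nv n (d - 1 + n - 1) := by
  rw [← mem_segment_add_iff one_pos, side, Complex.ofReal_one, one_mul, ← hp.vert_zero' (by omega)]
  rfl

theorem corner_subset (hp : IsFramed n d p)
    (hn : 2 ≤ n) (t : Bool) : tableCorner n d p t ⊆ tableRegion p := by
  rw [hp.tableRegion_eq hn]
  cases t
  · exact Set.subset_union_left
  · exact Set.subset_union_right

theorem exists_corner (hp : IsFramed n d p) (hn : 2 ≤ n) {x : ℂ} (hx : x ∈ tableRegion p) :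
    ∃ t, x ∈ tableCorner n d p t := by
  rw [hp.tableRegion_eq hn] at hx
  rcases hx with hx | hx
  · exact ⟨false, hx⟩
  · exact ⟨true, hx⟩

theorem side_zero_subset (hp : IsFramed n d p)
    (hn : 2 ≤ n) {x : ℂ} (hx : x ∈ side p 0) : x ∈ tableCorner n d p false := by
  have hc := cos_ang_one_nonneg hn
  have hs : 0 < Real.sin (ang n 1) := sin_ang_pos (by omega) one_pos (by omega)
  obtain ⟨t, h0, h1, rfl⟩ := (hp.mem_side_zero_iff hn).1 hx
  obtain ⟨b, rfl⟩ : ∃ b, t = b * Real.sin (ang n 1) := ⟨t / Real.sin (ang n 1), by field_simp⟩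
  have hb0 : 0 ≤ b := nonneg_of_mul_nonneg_left h0 hs
  have hb1 : b ≤ √2 := le_of_mul_le_mul_right h1 hs
  have h2 := Real.sin_sq_add_cos_sq (ang n 1)
  refine ⟨1 + √2 * Real.cos (ang n 1) - b * Real.cos (ang n 1), b, ?_, hb0, ?_, ?_, ?_⟩
  · nlinarith
  · simp [cornerBound]
  · simp only [cornerBound', Bool.false_eq_true, if_false]
    have := mul_nonneg (sub_nonneg.2 hb1) (sq_nonneg (Real.sin (ang n 1)))
    have e : (1 + √2 * Real.cos (ang n 1) - b * Real.cos (ang n 1)) * Real.cos (ang n 1) + b =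
        Real.cos (ang n 1) + √2 - (√2 - b) * Real.sin (ang n 1) ^ 2 := by
      linear_combination (√2 - b) * h2
    linarith
  · simp only [cornerVert, cornerDir, Bool.false_eq_true, if_false]
    rw [hp.vert_one, nv_sub_one]
    push_cast
    ring

/-- The seam between the two corners. -/
theorem mem_corners_iff (hp : IsFramed n d p) (hn : 3 ≤ n) {x : ℂ} :
    (x ∈ tableCorner n d p false ∧ x ∈ tableCorner n d p true) ↔
      ∃ t : ℝ, 0 ≤ t ∧ t ≤ Real.sin (ang n 1) ∧
        x = p 2 + (((Real.cos (ang n 1) + √2 : ℝ) : ℂ) * nv n (d - 1) + t * tv n (d - 1)) := by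
  have hc := cos_ang_one_nonneg (by omega : 2 ≤ n)
  have hc1 := cos_ang_one_lt_one (by omega : 2 ≤ n)
  have hs : 0 < Real.sin (ang n 1) := sin_ang_pos (by omega) one_pos (by omega)
  have h2 := Real.sin_sq_add_cos_sq (ang n 1)
  have h20 : 0 < √2 := by positivity
  have hnv : nv n d = Real.cos (ang n 1) * nv n (d - 1) + Real.sin (ang n 1) * tv n (d - 1) := by
    rw [← nv_add_one, sub_add_cancel]
  simp only [tableCorner, corner, cornerVert, cornerDir, cornerBound, cornerBound', if_true,
    Bool.false_eq_true, if_false, Set.mem_ofPred_eq]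
  constructor
  · rintro ⟨⟨a, b, ha, hb, h3, h4, rfl⟩, a', b', ha', hb', h3', h4', h⟩
    rw [hp.vert_three_add (by omega)] at h
    obtain ⟨rfl, h5⟩ := comb_inj (by omega) (add_left_cancel h)
    have h6 : a * Real.cos (ang n 1) + b = Real.cos (ang n 1) + √2 := by linarith
    have ha1 : a ≤ 1 := by nlinarith
    refine ⟨a * Real.sin (ang n 1), by positivity, by nlinarith, ?_⟩
    rw [← h6, hnv]
    push_cast
    ring
  · rintro ⟨t, h0, h1, rfl⟩
    obtain ⟨a, rfl⟩ : ∃ a, t = a * Real.sin (ang n 1) := ⟨t / Real.sin (ang n 1), by field_simp⟩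
    have ha0 : 0 ≤ a := nonneg_of_mul_nonneg_left h0 hs
    have ha1 : a ≤ 1 := le_of_mul_le_mul_right (by linarith) hs
    have e : (1 - a) * (1 - Real.cos (ang n 1) ^ 2) ≥ 0 :=
      mul_nonneg (by linarith) (by nlinarith)
    have e1 : a * Real.cos (ang n 1) ≤ Real.cos (ang n 1) := by nlinarith
    refine ⟨⟨a, Real.cos (ang n 1) + √2 - a * Real.cos (ang n 1), ha0, by linarith, by nlinarith,
      by linarith, ?_⟩, Real.cos (ang n 1) - a * Real.cos (ang n 1), a, by linarith, ha0,
      by linarith, by nlinarith, ?_⟩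
    · rw [hnv]
      push_cast
      ring
    · rw [hp.vert_three_add (by omega), hnv]
      push_cast
      ring

/-- The walls of a corner lie on sides of the table, with the same reflection. Crossing a wall
inside a polygon is therefore one of the gluings of the unfolding. -/
theorem wall_mem (hp : IsFramed n d p)
    (hn : 5 ≤ n) (t : Bool) : ∃ i, sideReflection p i = ref n (2 * cornerDir n d t) ∧
    ∀ a : ℝ, 0 ≤ a → a ≤ cornerBound n t → cornerVert p t + a * nv n (cornerDir n d t) ∈ side p i := by
  have hc := cos_ang_one_nonneg (by omega : 2 ≤ n)
  have h20 : 0 < √2 := by positivity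
  cases t
  · exact ⟨1, hp.sideReflection_one (by omega), fun a h0 h1 =>
      (hp.mem_side_one_iff (by omega)).2 ⟨a, h0, by simpa [cornerBound] using h1, rfl⟩⟩
  · refine ⟨2, ?_, fun a h0 h1 => (hp.mem_side_two_iff (by omega)).2
      ⟨2 * Real.cos (ang n 1) + √2 - a, ?_, by linarith, ?_⟩⟩
    · rw [hp.sideReflection_two (by omega)]
      exact ref_congr (by omega) ⟨-1, by simp [cornerDir]; ring⟩
    · simp only [cornerBound, if_true] at h1
      linarith
    · simp only [cornerVert, cornerDir, if_true]
      rw [nv_add_self (by omega), hp.vert_three]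
      push_cast
      ring

theorem wall_mem' (hp : IsFramed n d p) (hn : 5 ≤ n) (t : Bool) :
    ∃ i, sideReflection p i = ref n (2 * (cornerDir n d t - 1)) ∧ ∀ b : ℝ, 0 ≤ b →
      b ≤ cornerBound' n t → cornerVert p t + b * nv n (cornerDir n d t - 1) ∈ side p i := by
  have hc := cos_ang_one_nonneg (by omega : 2 ≤ n)
  cases t
  · refine ⟨2, hp.sideReflection_two (by omega), fun b h0 h1 =>
      (hp.mem_side_two_iff (by omega)).2 ⟨b, h0, ?_, rfl⟩⟩
    simp only [cornerBound', Bool.false_eq_true, if_false] at h1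
    linarith
  · exact ⟨3, hp.sideReflection_three (by omega), fun b h0 h1 =>
      (hp.mem_side_three_iff (by omega)).2 ⟨b, h0, by simpa [cornerBound'] using h1, rfl⟩⟩

end IsFramed

end

/-! ### The table has no symmetries -/

section

variable {n : ℕ} {d : ℤ} {p : Fin 4 → ℂ}

theorem sq_norm_comb (k : ℤ) (A B : ℝ) : ‖(A * nv n k + B * nv n (k - 1) : ℂ)‖ ^ 2 =
    A ^ 2 + B ^ 2 + 2 * Real.cos (ang n 1) * A * B := by
  have h := dot_nv_nv (n := n) k (k - 1)
  have h1 := Real.sin_sq_add_cos_sq (ang n k)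
  have h2 := Real.sin_sq_add_cos_sq (ang n (k - 1))
  rw [sub_sub_cancel] at h
  simp only [dot, nv] at h
  rw [Complex.sq_norm, Complex.normSq_apply]
  simp only [nv, Complex.add_re, Complex.add_im, Complex.re_ofReal_mul, Complex.im_ofReal_mul]
  linear_combination A ^ 2 * h1 + B ^ 2 * h2 + 2 * A * B * h

/-- The table is contained in a triangle with the single longest side from `p 2` to `p 3`, of length
`L`; `exists_coord` supplies the inequalities used here. Hence the diameter of the table is attained
only by these two vertices. -/
theorem diameter_aux {c L a b a' b' : ℝ} (hc : 1 < √2 * c) (hc1 : c < 1) (hL : 0 < L)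
    (ha : 0 ≤ a) (ha' : 0 ≤ a') (hb' : 0 ≤ b') (hab : √2 * a + b ≤ L)
    (hab' : √2 * a' + b' ≤ L)
    (h : (a - a') ^ 2 + (b - b') ^ 2 + 2 * c * (a - a') * (b - b') = L ^ 2) (hB : 0 ≤ b - b') :
    a = 0 ∧ b = L ∧ a' = 0 ∧ b' = 0 := by
  have h2 : √2 * √2 = 2 := Real.mul_self_sqrt (by norm_num)
  have h20 : 0 < √2 := by positivity
  have h23 : √2 < 3 / 2 := by nlinarith
  have hκ : √2 * c < 3 / 2 := by nlinarith
  have hA : (a - a') ^ 2 = (√2 * (a - a')) ^ 2 / 2 := by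
    rw [mul_pow, pow_two √2, h2]
    ring
  have hA' : 2 * c * (a - a') = √2 * c * (√2 * (a - a')) := by
    linear_combination -(c * (a - a')) * h2
  rw [hA, hA'] at h
  have hX1 : √2 * (a - a') ≤ L - (b - b') := by nlinarith
  have hX0 : -L ≤ √2 * (a - a') := by nlinarith
  have hBL : b - b' ≤ L := by nlinarith [mul_nonneg h20.le ha]
  have haX : √2 * (a - a') = 0 → a = a' := fun h0 => by
    rcases mul_eq_zero.1 h0 with h0 | h0
    · exact absurd h0 h20.ne'
    · linarith
  generalize √2 * (a - a') = X at *
  generalize hBdef : b - b' = B at *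
  -- Both products are non-negative as `-L ≤ X ≤ L - B`. They eliminate `X` from the equation for
  -- the length, leaving `(L - B)` times a positive factor to be non-positive.
  have h4 : 0 ≤ (X + L) * (L - B - X) := mul_nonneg (by linarith) (by linarith)
  have h5 : 0 ≤ (√2 * c - 1 / 2) * B * (L - B - X) :=
    mul_nonneg (mul_nonneg (by linarith) hB) (by linarith)
  have h6 : (L - B) * (L / 2 + (3 / 2 - √2 * c) * B) ≤ 0 := by nlinarith
  have h7 : 0 < L / 2 + (3 / 2 - √2 * c) * B := by
    have := mul_nonneg (sub_nonneg.2 hκ.le) hB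
    linarith
  obtain rfl : B = L := by
    refine le_antisymm hBL ?_
    by_contra h8
    exact absurd h6 (not_le.2 (mul_pos (by linarith) h7))
  have hb0 : b' = 0 := by nlinarith [mul_nonneg h20.le ha]
  have hbL : b = B := by linarith
  have ha0 : a = 0 := by
    have : √2 * a ≤ 0 := by linarith
    by_contra h8
    exact absurd this (not_le.2 (mul_pos h20 (lt_of_le_of_ne ha (Ne.symm h8))))
  have hX : X * (X / 2 + √2 * c * B) = 0 := by linarith
  have hX2 : X = 0 := by
    rcases mul_eq_zero.1 hX with h8 | h8
    · exact h8
    · nlinarith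
  exact ⟨ha0, hbL, by rw [← haX hX2, ha0], hb0⟩

theorem vert_one_mem_tableRegion (p : Fin 4 → ℂ) : p 1 ∈ tableRegion p :=
  Or.inl (subset_convexHull ℝ _ (by simp))

theorem vert_two_mem_tableRegion (p : Fin 4 → ℂ) : p 2 ∈ tableRegion p :=
  Or.inl (subset_convexHull ℝ _ (by simp))

theorem vert_three_mem_tableRegion (p : Fin 4 → ℂ) : p 3 ∈ tableRegion p :=
  Or.inr (subset_convexHull ℝ _ (by simp))

namespace IsFramed

theorem exists_coord (hp : IsFramed n d p)
    (hn : 5 ≤ n) {x : ℂ} (hx : x ∈ tableRegion p) : ∃ a b : ℝ, 0 ≤ a ∧ 0 ≤ b ∧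
    √2 * a + b ≤ 2 * Real.cos (ang n 1) + √2 ∧ x = p 2 + (a * nv n d + b * nv n (d - 1)) := by
  have h2 : √2 * √2 = 2 := Real.mul_self_sqrt (by norm_num)
  have h20 : 0 < √2 := by positivity
  have hc := one_lt_sqrt_two_mul_cos hn
  obtain ⟨a, b, ha, hb, h, rfl⟩ := (hp.mem_tableRegion_iff (by omega)).1 hx
  refine ⟨a, b, ha, hb, ?_, rfl⟩
  rcases h with h | h
  · have h3 := mul_le_mul_of_nonneg_left h.2 h20.le
    nlinarith [mul_nonneg hb (sub_nonneg.2 hc.le)]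
  · have : √2 ≤ 2 * Real.cos (ang n 1) := by nlinarith
    nlinarith [mul_nonneg ha (sub_nonneg.2 this)]

theorem eq_of_norm_sub_eq (hp : IsFramed n d p)
    (hn : 5 ≤ n) {x y : ℂ} (hx : x ∈ tableRegion p) (hy : y ∈ tableRegion p)
    (h : ‖x - y‖ = 2 * Real.cos (ang n 1) + √2) : (x = p 2 ∧ y = p 3) ∨ (x = p 3 ∧ y = p 2) := by
  have hc := one_lt_sqrt_two_mul_cos hn
  have hc0 := cos_ang_one_nonneg (by omega : 2 ≤ n)
  have hc1 := cos_ang_one_lt_one (by omega : 2 ≤ n)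
  have hL : 0 < 2 * Real.cos (ang n 1) + √2 := by positivity
  obtain ⟨a, b, ha, hb, hab, rfl⟩ := hp.exists_coord hn hx
  obtain ⟨a', b', ha', hb', hab', rfl⟩ := hp.exists_coord hn hy
  have h3 : (a - a') ^ 2 + (b - b') ^ 2 + 2 * Real.cos (ang n 1) * (a - a') * (b - b') =
      (2 * Real.cos (ang n 1) + √2) ^ 2 := by
    rw [← h, ← sq_norm_comb (n := n) d]
    congr 2
    push_cast
    ring
  rcases le_total 0 (b - b') with hB | hB
  · obtain ⟨rfl, rfl, rfl, rfl⟩ := diameter_aux hc hc1 hL ha ha' hb' hab hab' h3 hB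
    refine Or.inr ⟨?_, by simp⟩
    rw [hp.vert_three]
    simp
  · obtain ⟨rfl, rfl, rfl, rfl⟩ := diameter_aux hc hc1 hL ha' ha hb hab' hab
      (by rw [← h3]; ring) (by linarith)
    refine Or.inl ⟨by simp, ?_⟩
    rw [hp.vert_three]
    simp

theorem not_mem_of_neg (hp : IsFramed n d p) (hn : 5 ≤ n) {a b : ℝ} (h : a < 0 ∨ b < 0) :
    p 2 + (a * nv n d + b * nv n (d - 1)) ∉ tableRegion p := by
  intro hx
  obtain ⟨a', b', ha, hb, -, h2⟩ := hp.exists_coord hn hx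
  obtain ⟨rfl, rfl⟩ := comb_inj (by omega) (add_left_cancel h2)
  rcases h with h | h <;> linarith

/-- An isometry of the table is the identity. -/
theorem eq_one_of_isometry (hp : IsFramed n d p)
    (hn : 5 ≤ n) {g : ℂ ≃ₗᵢ[ℝ] ℂ} (hg : IsDih n g) {t : ℂ}
    (h : ∀ x ∈ tableRegion p, g x + t ∈ tableRegion p) : g = 1 ∧ t = 0 := by
  have hn2 : 2 ≤ n := by omega
  have hc := one_lt_sqrt_two_mul_cos hn
  have hc0 := cos_ang_one_nonneg hn2
  have hs : 0 < Real.sin (ang n 1) := sin_ang_pos (by omega) one_pos (by omega)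
  have h2 : √2 * √2 = 2 := Real.mul_self_sqrt (by norm_num)
  have h20 : 0 < √2 := by positivity
  have hL : 0 < 2 * Real.cos (ang n 1) + √2 := by positivity
  have hLc : ((2 * Real.cos (ang n 1) + √2 : ℝ) : ℂ) ≠ 0 := by exact_mod_cast hL.ne'
  have hh : 0 < 1 + √2 * Real.cos (ang n 1) := by positivity
  have hnv : nv n d = Real.cos (ang n 1) * nv n (d - 1) + Real.sin (ang n 1) * tv n (d - 1) := by
    rw [← nv_add_one, sub_add_cancel]
  obtain ⟨i', ε, hε, h3, h4, -⟩ := hg.exists_frame (by omega) (d - 1)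
  have htv : ∀ k, tv n k = Complex.I * nv n k := fun k => by
    rw [nv_eq]
    linear_combination tv n k * Complex.I_mul_I
  have h5 : g (p 3 - p 2) = ((2 * Real.cos (ang n 1) + √2 : ℝ) : ℂ) * nv n i' := by
    rw [hp.vert_three, add_sub_cancel_left, map_ofReal_mul, h3]
  have h6 : g (p 1) + t = g (p 2) + t + ((1 + √2 * Real.cos (ang n 1) : ℝ) : ℂ) *
      (Real.cos (ang n 1) * nv n i' + Real.sin (ang n 1) * (ε * tv n i')) := by
    rw [← h3, ← h4, ← map_ofReal_mul, ← map_ofReal_mul, ← map_add, ← hnv, ← map_ofReal_mul,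
      add_right_comm, ← map_add, ← hp.vert_one]
  have h7 := h _ (vert_one_mem_tableRegion p)
  have h8 : ‖(g (p 2) + t) - (g (p 3) + t)‖ = 2 * Real.cos (ang n 1) + √2 := by
    rw [add_sub_add_right_eq_sub, ← map_sub, LinearIsometryEquiv.norm_map, norm_sub_rev,
      hp.vert_three, add_sub_cancel_left, norm_mul, norm_nv, mul_one, Complex.norm_real,
      Real.norm_eq_abs, abs_of_pos hL]
  rw [map_sub] at h5
  -- The map preserves the unique diameter, so it fixes or exchanges its ends. In each of the three
  -- cases other than the identity, the image of `p 1` leaves the angle of the table at `p 2`.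
  rcases hp.eq_of_norm_sub_eq hn (h _ (vert_two_mem_tableRegion p)) (h _ (vert_three_mem_tableRegion p)) h8 with
    ⟨e1, e2⟩ | ⟨e1, e2⟩
  · have e3 : nv n i' = nv n (d - 1) := by
      refine mul_left_cancel₀ hLc ?_
      rw [← h5]
      linear_combination e2 - e1 + hp.vert_three
    have e4 : tv n i' = tv n (d - 1) := by rw [htv, htv, e3]
    rcases hε with rfl | rfl
    · have e5 : g = 1 := by
        refine linearIsometryEquiv_ext_frame (n := n) (d - 1) ?_ ?_
        · rw [h3, e3]
          rfl
        · rw [h4, e4]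
          simp
      subst e5
      refine ⟨rfl, ?_⟩
      simpa using e1
    · exfalso
      refine hp.not_mem_of_neg hn (a := -(1 + √2 * Real.cos (ang n 1)))
        (b := 2 * Real.cos (ang n 1) * (1 + √2 * Real.cos (ang n 1))) (Or.inl (by linarith)) ?_
      rw [h6, e1, e3, e4] at h7
      convert h7 using 2
      rw [hnv]
      push_cast
      ring
  · have e3 : nv n i' = -nv n (d - 1) := by
      refine mul_left_cancel₀ hLc ?_
      rw [← h5]
      linear_combination e2 - e1 - hp.vert_three
    have e4 : tv n i' = -tv n (d - 1) := by rw [htv, htv, e3, mul_neg]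
    exfalso
    rw [h6, e1, hp.vert_three, e3, e4] at h7
    rcases hε with rfl | rfl
    · refine hp.not_mem_of_neg hn (a := -(1 + √2 * Real.cos (ang n 1)))
        (b := 2 * Real.cos (ang n 1) + √2) (Or.inl (by linarith)) ?_
      convert h7 using 1
      rw [hnv]
      push_cast
      ring
    · refine hp.not_mem_of_neg hn (a := 1 + √2 * Real.cos (ang n 1))
        (b := 2 * Real.cos (ang n 1) + √2 -
          2 * Real.cos (ang n 1) * (1 + √2 * Real.cos (ang n 1))) (Or.inr ?_) ?_
      · have : 2 * Real.cos (ang n 1) + √2 = √2 * (1 + √2 * Real.cos (ang n 1)) := by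
          linear_combination -Real.cos (ang n 1) * h2
        rw [this]
        have h9 : √2 < 2 * Real.cos (ang n 1) := by nlinarith
        nlinarith
      · convert h7 using 1
        rw [hnv]
        push_cast
        ring

/-- As the table has no symmetries, two copies differ by a translation only if they coincide. The
`translate` identifications are trivial, and only gluings along sides remain. -/
theorem unfoldRel (hp : IsFramed n d p) (hn : 5 ≤ n) (a b : Copies (tableRegion p) p)
    (hab : UnfoldRel (tableRegion p) p a b) :
    a.2 = b.2 ∧ (a.1 = b.1 ∨ ∃ i, a.2.1 ∈ side p i ∧ b.1.1 = a.1.1 * sideReflection p i) := by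
  cases hab with
  | glue g h i hgh x hx => exact ⟨rfl, Or.inr ⟨i, hx, hgh⟩⟩
  | translate g h t ht x y hxy =>
    have key : (h⁻¹ * g).1 = 1 ∧ -(h⁻¹).1 t = 0 := by
      refine hp.eq_one_of_isometry hn (hp.isDih_of_mem (by omega) (h⁻¹ * g).2) fun z hz => ?_
      have h1 : g.1 z ∈ (fun z => h.1 z + t) '' tableRegion p := ht ▸ ⟨z, hz, rfl⟩
      obtain ⟨w, hw, hw'⟩ := h1
      have h2 : (h⁻¹ * g).1 z + -(h⁻¹).1 t = w := by
        change h.1.symm (g.1 z) + -h.1.symm t = w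
        rw [← hw', map_add, LinearIsometryEquiv.symm_apply_apply]
        ring
      rwa [h2]
    have hgh : g = h := by
      have : h⁻¹ * g = 1 := Subtype.ext key.1
      exact (inv_mul_eq_one.1 this).symm
    have ht0 : t = 0 := by
      have := key.2
      rwa [neg_eq_zero, LinearIsometryEquiv.map_eq_zero_iff] at this
    subst hgh ht0
    rw [add_zero] at hxy
    exact ⟨Subtype.ext (g.1.injective hxy), Or.inl rfl⟩

end IsFramed

end

/-! ### The unfolded table as a surface glued from four polygons -/

theorem Unfolding.mk_eq_mk_of_mem_side {N : ℕ} [NeZero N] {P : Set ℂ} {p : Fin N → ℂ}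
    {g h : reflectionGroup p} {i : Fin N} (hgh : h.1 = g.1 * sideReflection p i) {x : P}
    (hx : x.1 ∈ side p i) : (Unfolding.mk g x : Unfolding P p) = Unfolding.mk h x :=
  Quot.sound (UnfoldRel.glue g h i hgh x hx)

/-- The point of the unfolded table at the position `z` in the `i`-th polygon. -/
noncomputable def placeMap (n : ℕ) (d : ℤ) (p : Fin 4 → ℂ) (i : ℕ) (z : ℂ) :
    Unfolding (tableRegion p) p :=
  -- Points on walls have several descriptions; `place_unique` shows that they all name the same
  -- point.
  @Classical.epsilon _ ⟨Unfolding.mk 1 ⟨p 2, vert_two_mem_tableRegion p⟩⟩ fun y =>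
    ∃ (t : Bool) (g : reflectionGroup p) (x : tableRegion p), x.1 ∈ tableCorner n d p t ∧
      placeIdx n d t g.1 = i ∧ z = g.1 (x.1 - cornerVert p t) ∧ y = Unfolding.mk g x

section

variable {n : ℕ} {d : ℤ} {p : Fin 4 → ℂ}

namespace IsFramed

theorem cornerVert_mem_side (hp : IsFramed n d p) (hn : 5 ≤ n) (t : Bool) (i : Fin 4)
    (hi : sideReflection p i = ref n (2 * cornerDir n d t) ∨
      sideReflection p i = ref n (2 * (cornerDir n d t - 1))) :
    ∃ i', sideReflection p i' = sideReflection p i ∧ cornerVert p t ∈ side p i' := by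
  have hc := cos_ang_one_nonneg (by omega : 2 ≤ n)
  rcases hi with hi | hi
  · obtain ⟨i', h1, h2⟩ := hp.wall_mem hn t
    refine ⟨i', h1.trans hi.symm, ?_⟩
    have := h2 0 le_rfl (by unfold cornerBound; split_ifs <;> positivity)
    simpa using this
  · obtain ⟨i', h1, h2⟩ := hp.wall_mem' hn t
    refine ⟨i', h1.trans hi.symm, ?_⟩
    have := h2 0 le_rfl (by unfold cornerBound'; split_ifs <;> positivity)
    simpa using this

/-- The elements of `H` are those whose multiplication on the right does not change the point over
the vertex. They include the reflections in the two sides at the vertex, hence all even elements. -/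
theorem mk_cornerVert (hp : IsFramed n d p) (hn : 5 ≤ n) (t : Bool) (g g' : reflectionGroup p)
    (hpar : EvenDih n g.1 ↔ EvenDih n g'.1) (hv : cornerVert p t ∈ tableRegion p) :
    (Unfolding.mk g ⟨_, hv⟩ : Unfolding (tableRegion p) p) = Unfolding.mk g' ⟨_, hv⟩ := by
  let H : Subgroup (ℂ ≃ₗᵢ[ℝ] ℂ) :=
    { carrier := {h | ∃ hh : h ∈ reflectionGroup p, ∀ g : reflectionGroup p,
        (Unfolding.mk (g * ⟨h, hh⟩) ⟨_, hv⟩ : Unfolding (tableRegion p) p) =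
          Unfolding.mk g ⟨_, hv⟩}
      one_mem' := ⟨Subgroup.one_mem _, fun g => by
        rw [show (⟨1, Subgroup.one_mem _⟩ : reflectionGroup p) = 1 from rfl, mul_one]⟩
      mul_mem' := by
        rintro a b ⟨ha, ha'⟩ ⟨hb, hb'⟩
        refine ⟨Subgroup.mul_mem _ ha hb, fun g => ?_⟩
        rw [← ha' g, ← hb' (g * ⟨a, ha⟩), mul_assoc]
        rfl
      inv_mem' := by
        rintro a ⟨ha, ha'⟩
        refine ⟨Subgroup.inv_mem _ ha, fun g => ?_⟩
        rw [← ha' (g * ⟨a⁻¹, _⟩), mul_assoc]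
        congr 1
        rw [show (⟨a⁻¹, Subgroup.inv_mem _ ha⟩ : reflectionGroup p) = (⟨a, ha⟩)⁻¹ from rfl]
        simp }
  have hH : ∀ i, cornerVert p t ∈ side p i → sideReflection p i ∈ H := fun i hi =>
    ⟨Subgroup.subset_closure ⟨i, rfl⟩, fun g =>
      (Unfolding.mk_eq_mk_of_mem_side (i := i) (x := ⟨_, hv⟩) rfl hi).symm⟩
  obtain ⟨i, h1, -⟩ := hp.wall_mem hn t
  obtain ⟨i', h2, h3⟩ := hp.cornerVert_mem_side hn t i (Or.inl h1)
  obtain ⟨j, h4, -⟩ := hp.wall_mem' hn t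
  obtain ⟨j', h5, h6⟩ := hp.cornerVert_mem_side hn t j (Or.inr h4)
  have key := IsDih.inv_mul_mem_closure (by omega) (hp.isDih_of_mem (by omega) g.2)
    (hp.isDih_of_mem (by omega) g'.2) hpar (cornerDir n d t) (H := H)
    (by rw [← h1, ← h2]; exact hH i' h3) (by rw [← h4, ← h5]; exact hH j' h6)
  obtain ⟨hh, hk⟩ := key
  rw [← hk g]
  congr 1
  apply Subtype.ext
  simp

/-- By `eq_of_chamber` two descriptions agree, differ by a wall reflection at a point of that wall,
or concern the vertex of the corner. The last two cases are a gluing and `mk_cornerVert`. -/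
theorem place_unique (hp : IsFramed n d p) (hn : 5 ≤ n) {t t' : Bool} {g g' : reflectionGroup p}
    {x x' : tableRegion p} (hx : x.1 ∈ tableCorner n d p t) (hx' : x'.1 ∈ tableCorner n d p t')
    (hi : placeIdx n d t g.1 = placeIdx n d t' g'.1)
    (h : g.1 (x.1 - cornerVert p t) = g'.1 (x'.1 - cornerVert p t')) :
    (Unfolding.mk g x : Unfolding (tableRegion p) p) = Unfolding.mk g' x' := by
  obtain ⟨rfl, hpar⟩ := cornerPoly_inj hi
  obtain ⟨x, hxP⟩ := x
  obtain ⟨x', hxP'⟩ := x'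
  have hc := cos_ang_one_nonneg (by omega : 2 ≤ n)
  have hpar' : EvenDih n g.1 ↔ EvenDih n g'.1 := by tauto
  obtain ⟨a, b, ha, hb, h1, h2, rfl⟩ := hx
  obtain ⟨a', b', ha', hb', h1', h2', rfl⟩ := hx'
  simp only [add_sub_cancel_left] at h
  obtain ⟨rfl, rfl, h3⟩ := IsDih.eq_of_chamber (by omega) (hp.isDih_of_mem (by omega) g.2)
    (hp.isDih_of_mem (by omega) g'.2) hpar' _ ha hb ha' hb' h
  rcases h3 with ⟨rfl, rfl⟩ | h3 | ⟨h3, rfl⟩ | ⟨h3, rfl⟩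
  · have e : cornerVert p t + (((0 : ℝ) : ℂ) * nv n (cornerDir n d t) +
        ((0 : ℝ) : ℂ) * nv n (cornerDir n d t - 1)) = cornerVert p t := by simp
    have hv : cornerVert p t ∈ tableRegion p := e ▸ hxP
    have := hp.mk_cornerVert hn t g g' hpar' hv
    convert this
  · rw [Subtype.ext h3]
  · obtain ⟨i, h4, h5⟩ := hp.wall_mem hn t
    refine Unfolding.mk_eq_mk_of_mem_side (i := i) (by rw [h4, h3]) ?_
    have := h5 _ ha' (by simpa using h1')
    simpa using this
  · obtain ⟨i, h4, h5⟩ := hp.wall_mem' hn t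
    refine Unfolding.mk_eq_mk_of_mem_side (i := i) (by rw [h4, h3]) ?_
    have := h5 _ hb' (by simpa using h2')
    simpa using this

theorem placeMap_eq (hp : IsFramed n d p)
    (hn : 5 ≤ n) {t : Bool} {x : tableRegion p} (hx : x.1 ∈ tableCorner n d p t)
    (g : reflectionGroup p) :
    placeMap n d p (placeIdx n d t g.1) (g.1 (x.1 - cornerVert p t)) = Unfolding.mk g x := by
  have h := @Classical.epsilon_spec _ (fun y : Unfolding (tableRegion p) p =>
    ∃ (t' : Bool) (g' : reflectionGroup p) (x' : tableRegion p), x'.1 ∈ tableCorner n d p t' ∧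
      placeIdx n d t' g'.1 = placeIdx n d t g.1 ∧
      g.1 (x.1 - cornerVert p t) = g'.1 (x'.1 - cornerVert p t') ∧ y = Unfolding.mk g' x')
    ⟨_, t, g, x, hx, rfl, rfl, rfl⟩
  obtain ⟨t', g', x', h1, h2, h3, h4⟩ := h
  unfold placeMap
  rw [h4]
  exact hp.place_unique hn h1 hx h2 h3.symm

theorem exists_place_mk (hp : IsFramed n d p)
    (hn : 5 ≤ n) (hodd : Odd n) {i : ℕ} (hi : i < 4) {z : ℂ}
    (hz : z ∈ poly n i) : ∃ (t : Bool) (g : reflectionGroup p) (x : tableRegion p),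
      x.1 ∈ tableCorner n d p t ∧ placeIdx n d t g.1 = i ∧ z = g.1 (x.1 - cornerVert p t) := by
  obtain ⟨t, g, x, h1, h2, h3, h4⟩ := exists_place (d := d) (p := p) (by omega) hodd hi hz
  exact ⟨t, ⟨g, hp.mem_of_isDih (by omega) hodd h1⟩, ⟨x, hp.corner_subset (by omega) t h2⟩, h2, h3, h4⟩

theorem unfoldingCells_refines_polyCells (hp : IsFramed n d p)
    [Nonempty (tableRegion p)] (hn : 5 ≤ n) (hodd : Odd n) :
    (unfoldingCells (tableRegion p) p).Refines (polyCells n (placeMap n d p)) := by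
  rintro (g : reflectionGroup p) _ ⟨x, hx, rfl⟩
  have hg := hp.isDih_of_mem (by omega) g.2
  let F : Bool → Fin 4 × ℂ := fun t =>
    (⟨placeIdx n d t g.1, cornerPoly_lt _ _⟩, -g.1 (cornerVert p t))
  have hF : ∀ t (y : tableRegion p), y.1 ∈ tableCorner n d p t →
      g.1 y + (F t).2 ∈ poly n (F t).1 ∧ (unfoldingCells (tableRegion p) p).c g (g.1 y) =
        placeMap n d p (F t).1 (g.1 y + (F t).2) := by
    intro t y hy
    have e : g.1 y + (F t).2 = g.1 (y.1 - cornerVert p t) := by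
      rw [map_sub, sub_eq_add_neg]
    rw [e]
    refine ⟨map_mem_poly (by omega) hodd hy hg, ?_⟩
    rw [unfoldingCells_c]
    exact (hp.placeMap_eq hn hy g).symm
  refine ⟨Set.range F, Set.finite_range F, ?_⟩
  refine (unfoldingCells_eventually g ⟨x, hx⟩ _).2 ?_
  have hcov : ∀ᶠ z in 𝓝[tableRegion p] x, ∃ t ∈ (Set.univ : Set Bool), x ∈ tableCorner n d p t ∧
      z ∈ tableCorner n d p t := by
    refine eventually_closed_cover Set.finite_univ
      (fun t _ => (isCompact_corner (by omega) _ _ _ _).isClosed) ?_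
    filter_upwards [self_mem_nhdsWithin] with z hz
    obtain ⟨t, ht⟩ := hp.exists_corner (by omega) hz
    exact ⟨t, trivial, ht⟩
  rw [show 𝓝[tableRegion p] x = Filter.map Subtype.val (𝓝 (⟨x, hx⟩ : tableRegion p)) from
    (map_nhds_subtype_val (⟨x, hx⟩ : tableRegion p)).symm, Filter.eventually_map] at hcov
  filter_upwards [hcov] with y ⟨t, _, h1, h2⟩
  obtain ⟨h3, h4⟩ := hF t ⟨x, hx⟩ h1
  obtain ⟨h5, h6⟩ := hF t y h2
  exact ⟨F t, ⟨t, rfl⟩, h3, h5, h4, h6⟩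

theorem polyCells_refines_unfoldingCells (hp : IsFramed n d p)
    [Nonempty (tableRegion p)] (hn : 5 ≤ n) (hodd : Odd n) :
    (polyCells n (placeMap n d p)).Refines (unfoldingCells (tableRegion p) p) := by
  rintro (i : Fin 4) z hz
  have := hp.finite_reflectionGroup (by omega)
  let F : Bool × reflectionGroup p → reflectionGroup p × ℂ := fun f =>
    (f.2, f.2.1 (cornerVert p f.1))
  let K : Bool × reflectionGroup p → Set ℂ := fun f =>
    {z | placeIdx n d f.1 f.2.1 = i ∧ cornerVert p f.1 + f.2.1.symm z ∈ tableCorner n d p f.1}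
  have hF : ∀ f, ∀ w ∈ K f, w + (F f).2 ∈ (unfoldingCells (tableRegion p) p).S (F f).1 ∧
      placeMap n d p i w = (unfoldingCells (tableRegion p) p).c (F f).1 (w + (F f).2) := by
    rintro ⟨t, g⟩ w ⟨h1, h2⟩
    have e : w + (F (t, g)).2 = g.1 (cornerVert p t + g.1.symm w) := by
      rw [map_add, LinearIsometryEquiv.apply_symm_apply, add_comm]
    have hx := hp.corner_subset (by omega) t h2
    rw [e]
    refine ⟨⟨_, hx, rfl⟩, ?_⟩
    have h3 := unfoldingCells_c g ⟨_, hx⟩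
    rw [show (F (t, g)).1 = g from rfl, h3, ← hp.placeMap_eq hn h2 g]
    simp only at h1
    rw [h1, add_sub_cancel_left, LinearIsometryEquiv.apply_symm_apply]
  refine ⟨Set.range F, Set.finite_range F, ?_⟩
  have hcov : ∀ᶠ w in 𝓝[poly n i] z, ∃ f ∈ (Set.univ : Set (Bool × reflectionGroup p)),
      z ∈ K f ∧ w ∈ K f := by
    refine eventually_closed_cover Set.finite_univ (fun f _ => ?_) ?_
    · refine (isClosed_const (p := placeIdx n d f.1 f.2.1 = i)).inter ?_
      have hc : Continuous fun w => cornerVert p f.1 + f.2.1.symm w := by fun_prop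
      exact (isCompact_corner (by omega) _ _ _ _).isClosed.preimage hc
    · filter_upwards [self_mem_nhdsWithin] with w hw
      obtain ⟨t, g, x, h1, h2, rfl⟩ := hp.exists_place_mk hn hodd i.2 hw
      refine ⟨(t, g), trivial, h2, ?_⟩
      simpa using h1
  filter_upwards [hcov] with w ⟨f, _, h1, h2⟩
  obtain ⟨h3, h4⟩ := hF f z h1
  obtain ⟨h5, h6⟩ := hF f w h2
  exact ⟨F f, ⟨f, rfl⟩, h3, h5, h4, h6⟩

end IsFramed

end

/-! ### The gluings of the four polygons and the gluings of the table -/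

section

variable {n : ℕ} {d : ℤ} {p : Fin 4 → ℂ}

/-- Written with the outer normal `nv n j` of polygon 1, like the other gluing that comes from the
seam; from polygon 0 the same side has the even index `j + n`. -/
theorem glueRel_zero (hn : 0 < n) (hodd : Odd n) {j : ℤ} (hj : ¬ Even j) {t : ℝ}
    (ht : |t| ≤ Real.sin (ang n 1)) :
    GlueRel n (0, ((-Real.cos (ang n 1) : ℝ) : ℂ) * nv n j + t * tv n j)
      (1, ((Real.cos (ang n 1) + √2 : ℝ) : ℂ) * nv n j + t * tv n j) := by
  have h1 : Even (j + n) := by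
    rw [even_self_add_iff hodd]
    exact hj
  refine ⟨by norm_num, rfl, j + n, -t, h1, ?_, ?_, ?_⟩
  · simpa [hl, h1, wt] using ht
  · simp only [apo, h1, if_true, wt, nv_add_self hn, tv_add_self hn]
    push_cast
    ring
  · simp only [apo, h1, if_true, wt, nv_add_self hn, even_add_one_iff, not_true_eq_false, if_false]
    push_cast
    ring

theorem glueRel_one {j : ℤ} (hj : Even j) {t : ℝ} (ht : |t| ≤ √2 * Real.sin (ang n 1)) :
    GlueRel n (1, ((1 + √2 * Real.cos (ang n 1) : ℝ) : ℂ) * nv n j + t * tv n j)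
      (2, ((-(1 + √2 * Real.cos (ang n 1)) : ℝ) : ℂ) * nv n j + t * tv n j) := by
  refine ⟨by norm_num, rfl, j, t, hj, ?_, ?_, ?_⟩
  · simpa [hl, hj, wt] using ht
  · simp only [apo, hj, if_true, wt]
  · simp only [apo, hj, if_true, wt, even_add_one_iff, not_true_eq_false, if_false]
    push_cast
    ring

theorem glueRel_two {j : ℤ} (hj : Even j) {t : ℝ} (ht : |t| ≤ Real.sin (ang n 1)) :
    GlueRel n (2, ((Real.cos (ang n 1) + √2 : ℝ) : ℂ) * nv n j + t * tv n j)
      (3, ((-Real.cos (ang n 1) : ℝ) : ℂ) * nv n j + t * tv n j) := by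
  refine ⟨by norm_num, rfl, j, t, hj, ?_, ?_, ?_⟩
  · simpa [hl, hj, wt] using ht
  · simp only [apo, hj, if_true, wt]
    push_cast
    ring
  · simp only [apo, hj, if_true, wt, even_add_one_iff, not_true_eq_false, if_false]
    push_cast
    ring

/-- The three kinds of gluings. -/
theorem GlueRel.cases (hn : 0 < n) (hodd : Odd n) {a b : ℕ × ℂ} (h : GlueRel n a b) :
    ∃ (j : ℤ) (t : ℝ),
      (¬ Even j ∧ |t| ≤ Real.sin (ang n 1) ∧
        a = (0, ((-Real.cos (ang n 1) : ℝ) : ℂ) * nv n j + t * tv n j) ∧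
        b = (1, ((Real.cos (ang n 1) + √2 : ℝ) : ℂ) * nv n j + t * tv n j)) ∨
      (Even j ∧ |t| ≤ √2 * Real.sin (ang n 1) ∧
        a = (1, ((1 + √2 * Real.cos (ang n 1) : ℝ) : ℂ) * nv n j + t * tv n j) ∧
        b = (2, ((-(1 + √2 * Real.cos (ang n 1)) : ℝ) : ℂ) * nv n j + t * tv n j)) ∨
      (Even j ∧ |t| ≤ Real.sin (ang n 1) ∧
        a = (2, ((Real.cos (ang n 1) + √2 : ℝ) : ℂ) * nv n j + t * tv n j) ∧
        b = (3, ((-Real.cos (ang n 1) : ℝ) : ℂ) * nv n j + t * tv n j)) := by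
  obtain ⟨i, z⟩ := a
  obtain ⟨i', z'⟩ := b
  obtain ⟨hi, hi', j, t, hj, ht, hz, hz'⟩ := h
  simp only at hi hi' ht hz hz'
  subst hi' hz hz'
  have hj' : Even (j + 1) ↔ False := by simp [hj]
  have h1 : ¬ Even (j + n) := by
    rw [even_self_add_iff hodd]
    simpa using hj
  interval_cases i
  · refine ⟨j + n, -t, Or.inl ⟨h1, ?_, ?_, ?_⟩⟩
    · simpa [hl, hj, wt] using ht
    · simp only [apo, hj, if_true, wt, nv_add_self hn, tv_add_self hn]
      push_cast
      congr 1
      ring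
    · simp only [apo, hj, hj', if_true, if_false, wt, nv_add_self hn, tv_add_self hn]
      push_cast
      congr 1
      ring
  · refine ⟨j, t, Or.inr (Or.inl ⟨hj, ?_, ?_, ?_⟩)⟩
    · simpa [hl, hj, wt] using ht
    · simp only [apo, hj, if_true, wt]
    · simp only [apo, hj, hj', if_true, if_false, wt]
      push_cast
      congr 1
      ring
  · refine ⟨j, t, Or.inr (Or.inr ⟨hj, ?_, ?_, ?_⟩)⟩
    · simpa [hl, hj, wt] using ht
    · simp only [apo, hj, if_true, wt]
      push_cast
      congr 1
      ring
    · simp only [apo, hj, hj', if_true, if_false, wt]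
      push_cast
      congr 1
      ring

theorem exists_sign_mul_abs (t : ℝ) : ∃ ε : ℝ, (ε = 1 ∨ ε = -1) ∧ ε * |t| = t := by
  rcases le_total 0 t with h | h
  · exact ⟨1, Or.inl rfl, by rw [abs_of_nonneg h, one_mul]⟩
  · exact ⟨-1, Or.inr rfl, by rw [abs_of_nonpos h]; ring⟩

theorem abs_sign_mul {ε : ℝ} (hε : ε = 1 ∨ ε = -1) (t : ℝ) : |ε * t| = |t| := by
  rcases hε with rfl | rfl <;> simp

theorem placeIdx_of_even {t : Bool} {g : ℂ ≃ₗᵢ[ℝ] ℂ} (h : EvenDih n g ↔ Even d) :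
    placeIdx n d t g = if t then 0 else 1 := if_pos h

theorem placeIdx_of_not_even {t : Bool} {g : ℂ ≃ₗᵢ[ℝ] ℂ} (h : ¬ (EvenDih n g ↔ Even d)) :
    placeIdx n d t g = if t then 3 else 2 := if_neg h

theorem placeIdx_mul_ref (hn : 3 ≤ n) {t : Bool} {g : ℂ ≃ₗᵢ[ℝ] ℂ} (hg : IsDih n g) {m : ℤ}
    (hm : Even m) : placeIdx n d t (g * ref n m) = placeIdx n d t g := by
  unfold placeIdx
  congr 1
  rw [EvenDih.mul_ref_iff hn hg]
  simp [hm]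

open Classical in
/-- The class of a point of the copies of the table in the surface glued from four polygons. -/
noncomputable def polyClass (n : ℕ) (d : ℤ) (a : Copies (tableRegion p) p) : Quot (GlueRel n) :=
  if a.2.1 ∈ tableCorner n d p false then
    Quot.mk _ (placeIdx n d false a.1.1, a.1.1 (a.2.1 - cornerVert p false))
  else Quot.mk _ (placeIdx n d true a.1.1, a.1.1 (a.2.1 - cornerVert p true))

namespace IsFramed

theorem map_seam (hp : IsFramed n d p)
    (g : ℂ ≃ₗᵢ[ℝ] ℂ) {j : ℤ} {ε t : ℝ} {x : ℂ} (h1 : g (nv n (d - 1)) = nv n j)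
    (h2 : g (tv n (d - 1)) = ε * tv n j)
    (hx : x = p 2 + (((Real.cos (ang n 1) + √2 : ℝ) : ℂ) * nv n (d - 1) + t * tv n (d - 1))) :
    g (x - cornerVert p false) =
        ((Real.cos (ang n 1) + √2 : ℝ) : ℂ) * nv n j + ((ε * t : ℝ) : ℂ) * tv n j ∧
      g (x - cornerVert p true) =
        ((-Real.cos (ang n 1) : ℝ) : ℂ) * nv n j + ((ε * t : ℝ) : ℂ) * tv n j := by
  have e1 : x - cornerVert p false =
      ((Real.cos (ang n 1) + √2 : ℝ) : ℂ) * nv n (d - 1) + t * tv n (d - 1) := by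
    rw [hx]
    simp [cornerVert]
  have e2 : x - cornerVert p true =
      ((-Real.cos (ang n 1) : ℝ) : ℂ) * nv n (d - 1) + t * tv n (d - 1) := by
    rw [hx]
    simp only [cornerVert, if_true, hp.vert_three]
    push_cast
    ring
  rw [e1, e2, map_add, map_add, map_ofReal_mul, map_ofReal_mul, map_ofReal_mul, h1, h2]
  push_cast
  constructor <;> ring

theorem map_side_zero (hp : IsFramed n d p) (hn : 0 < n) (g : ℂ ≃ₗᵢ[ℝ] ℂ) {j : ℤ} {ε t : ℝ} {x : ℂ}
    (h1 : g (nv n d) = nv n j) (h2 : g (tv n d) = ε * tv n j) (hx : x = p 1 + t * -tv n d) :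
    g (x - cornerVert p false) =
        ((1 + √2 * Real.cos (ang n 1) : ℝ) : ℂ) * nv n j + ((ε * -t : ℝ) : ℂ) * tv n j ∧
      (g * ref n (2 * d + n)) (x - cornerVert p false) =
        ((-(1 + √2 * Real.cos (ang n 1)) : ℝ) : ℂ) * nv n j + ((ε * -t : ℝ) : ℂ) * tv n j := by
  have e1 : x - cornerVert p false =
      ((1 + √2 * Real.cos (ang n 1) : ℝ) : ℂ) * nv n d + ((-t : ℝ) : ℂ) * tv n d := by
    rw [hx, hp.vert_one]
    simp only [cornerVert, Bool.false_eq_true, if_false]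
    push_cast
    ring
  have e2 : ref n (2 * d + n) (x - cornerVert p false) =
      ((-(1 + √2 * Real.cos (ang n 1)) : ℝ) : ℂ) * nv n d + ((-t : ℝ) : ℂ) * tv n d := by
    rw [e1, map_add, map_ofReal_mul, map_ofReal_mul, ref_nv, ref_tv,
      show 2 * d + n - d = d + n by ring, nv_add_self hn, tv_add_self hn]
    push_cast
    ring
  rw [LinearIsometryEquiv.coe_mul, Function.comp, e2, e1, map_add, map_add, map_ofReal_mul,
    map_ofReal_mul, map_ofReal_mul, h1, h2]
  push_cast
  constructor <;> ring

/-- Gluings between polygons 0, 1 and between 2, 3 come from the seam: both places describe one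
point of one copy of the table. The gluing between 1 and 2 comes from side 0, joining the copies `g`
and `g σ₀`. -/
theorem placeMap_glue (hp : IsFramed n d p)
    (hn : 5 ≤ n) (hodd : Odd n) (a b : ℕ × ℂ) (h : GlueRel n a b) :
    placeMap n d p a.1 a.2 = placeMap n d p b.1 b.2 := by
  have hn3 : 3 ≤ n := by omega
  obtain ⟨j, t, ⟨hj, ht, rfl, rfl⟩ | ⟨hj, ht, rfl, rfl⟩ | ⟨hj, ht, rfl, rfl⟩⟩ :=
    h.cases (by omega) hodd
  -- The seam is only half of a side of the polygon, `0 ≤ t`; the other half belongs to the mirror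
  -- image, selected by the sign `ε`.
  · obtain ⟨ε, hε, hεt⟩ := exists_sign_mul_abs t
    obtain ⟨g, hg, h1, h2, h3⟩ := exists_isDih_frame hn3 (d - 1) j hε
    obtain ⟨hx1, hx2⟩ := (hp.mem_corners_iff hn3).2 ⟨|t|, abs_nonneg t, ht, rfl⟩
    obtain ⟨e1, e2⟩ := hp.map_seam g (t := |t|) h1 h2 rfl
    rw [even_sub_one_iff] at h3
    have hσ : EvenDih n g ↔ Even d := by tauto
    have k1 := hp.placeMap_eq hn (x := ⟨_, hp.corner_subset (by omega) _ hx1⟩) hx1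
      ⟨g, hp.mem_of_isDih hn3 hodd hg⟩
    have k2 := hp.placeMap_eq hn (x := ⟨_, hp.corner_subset (by omega) _ hx1⟩) hx2
      ⟨g, hp.mem_of_isDih hn3 hodd hg⟩
    simp only [e1, e2, placeIdx_of_even hσ, hεt] at k1 k2
    exact k2.trans k1.symm
  · obtain ⟨ε, hε, hεt⟩ := exists_sign_mul_abs (-t)
    obtain ⟨g, hg, h1, h2, h3⟩ := exists_isDih_frame hn3 d j hε
    have hx := (hp.mem_side_zero_iff (by omega)).2 ⟨|-t|, abs_nonneg _, by rwa [abs_neg], rfl⟩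
    have hx1 := hp.side_zero_subset (by omega) hx
    obtain ⟨e1, e2⟩ := hp.map_side_zero (by omega) g (t := |-t|) h1 h2 rfl
    have hσ : EvenDih n g ↔ Even d := by tauto
    have hσ' : ¬ (EvenDih n (g * ref n (2 * d + n)) ↔ Even d) := by
      rw [EvenDih.mul_ref_iff hn3 hg, even_self_add_iff hodd]
      simp only [even_two, Even.mul_right, not_true_eq_false, iff_false]
      tauto
    have hgm := hp.mem_of_isDih hn3 hodd hg
    have hgm' := hp.mem_of_isDih hn3 hodd (hg.mul (isDih_ref (2 * d + n)))
    have k1 := hp.placeMap_eq hn (x := ⟨_, hp.corner_subset (by omega) _ hx1⟩) hx1 ⟨g, hgm⟩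
    have k2 := hp.placeMap_eq hn (x := ⟨_, hp.corner_subset (by omega) _ hx1⟩) hx1 ⟨_, hgm'⟩
    have k3 := Unfolding.mk_eq_mk_of_mem_side (g := ⟨g, hgm⟩) (h := ⟨_, hgm'⟩) (i := 0)
      (by rw [hp.sideReflection_zero (by omega)])
      (x := (⟨_, hp.corner_subset (by omega) _ hx1⟩ : tableRegion p)) hx
    rw [mul_neg ε, hεt, neg_neg] at e1 e2
    simp only [e1, e2, placeIdx_of_even hσ, placeIdx_of_not_even hσ'] at k1 k2
    exact k1.trans (k3.trans k2.symm)
  · obtain ⟨ε, hε, hεt⟩ := exists_sign_mul_abs t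
    obtain ⟨g, hg, h1, h2, h3⟩ := exists_isDih_frame hn3 (d - 1) j hε
    obtain ⟨hx1, hx2⟩ := (hp.mem_corners_iff hn3).2 ⟨|t|, abs_nonneg t, ht, rfl⟩
    obtain ⟨e1, e2⟩ := hp.map_seam g (t := |t|) h1 h2 rfl
    rw [even_sub_one_iff] at h3
    have hσ : ¬ (EvenDih n g ↔ Even d) := by tauto
    have k1 := hp.placeMap_eq hn (x := ⟨_, hp.corner_subset (by omega) _ hx1⟩) hx1
      ⟨g, hp.mem_of_isDih hn3 hodd hg⟩
    have k2 := hp.placeMap_eq hn (x := ⟨_, hp.corner_subset (by omega) _ hx1⟩) hx2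
      ⟨g, hp.mem_of_isDih hn3 hodd hg⟩
    simp only [e1, e2, placeIdx_of_not_even hσ, hεt] at k1 k2
    exact k1.trans k2.symm

/-- A point of the seam belongs to both corners, and its two places are related by `glueRel_zero` or
`glueRel_two` according to the parity. -/
theorem polyClass_eq (hp : IsFramed n d p)
    (hn : 3 ≤ n) (hodd : Odd n) {t : Bool} (a : Copies (tableRegion p) p)
    (ha : a.2.1 ∈ tableCorner n d p t) : polyClass n d a =
      Quot.mk _ (placeIdx n d t a.1.1, a.1.1 (a.2.1 - cornerVert p t)) := by
  obtain ⟨g, x, hx⟩ := a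
  simp only at ha
  unfold polyClass
  by_cases hf : x ∈ tableCorner n d p false
  · simp only [hf, if_true]
    cases t
    · rfl
    · obtain ⟨s, hs0, hs1, hxs⟩ := (hp.mem_corners_iff hn).1 ⟨hf, ha⟩
      obtain ⟨j, ε, hε, h1, h2, h3⟩ :=
        (hp.isDih_of_mem (by omega) g.2).exists_frame hn (d - 1)
      obtain ⟨e1, e2⟩ := hp.map_seam g.1 h1 h2 hxs
      have hs : |ε * s| ≤ Real.sin (ang n 1) := by rwa [abs_sign_mul hε, abs_of_nonneg hs0]
      rw [even_sub_one_iff] at h3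
      rw [e1, e2]
      by_cases hσ : EvenDih n g.1 ↔ Even d
      · rw [placeIdx_of_even hσ, placeIdx_of_even hσ]
        exact (Quot.sound (glueRel_zero (by omega) hodd (by tauto) hs)).symm
      · rw [placeIdx_of_not_even hσ, placeIdx_of_not_even hσ]
        exact Quot.sound (glueRel_two (by tauto) hs)
  · simp only [hf, if_false]
    cases t
    · exact absurd ha hf
    · rfl

theorem polyClass_eq_of_fixed (hp : IsFramed n d p)
    (hn : 3 ≤ n) (hodd : Odd n) {t : Bool} {g h : reflectionGroup p}
    {m : ℤ} (hm : Even m) (hgh : h.1 = g.1 * ref n m) {x : tableRegion p}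
    (hx : x.1 ∈ tableCorner n d p t)
    (hfix : ref n m (x.1 - cornerVert p t) = x.1 - cornerVert p t) :
    polyClass n d ⟨g, x⟩ = polyClass n d ⟨h, x⟩ := by
  rw [hp.polyClass_eq hn hodd ⟨g, x⟩ hx, hp.polyClass_eq hn hodd ⟨h, x⟩ hx]
  simp only [hgh, placeIdx_mul_ref hn (hp.isDih_of_mem (by omega) g.2) hm]
  rw [LinearIsometryEquiv.coe_mul, Function.comp, hfix]

theorem polyClass_eq_of_side_zero (hp : IsFramed n d p)
    (hn : 3 ≤ n) (hodd : Odd n) {g h : reflectionGroup p}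
    (hgh : h.1 = g.1 * ref n (2 * d + n)) {x : tableRegion p} (hx : x.1 ∈ side p 0)
    (hσ : EvenDih n g.1 ↔ Even d) : polyClass n d ⟨g, x⟩ = polyClass n d ⟨h, x⟩ := by
  have hx1 := hp.side_zero_subset (by omega) hx
  have hg := hp.isDih_of_mem (by omega) g.2
  have hσ' : ¬ (EvenDih n (g.1 * ref n (2 * d + n)) ↔ Even d) := by
    rw [EvenDih.mul_ref_iff hn hg, even_self_add_iff hodd]
    simp only [even_two, Even.mul_right, not_true_eq_false, iff_false]
    tauto
  obtain ⟨t, h0, ht, hxt⟩ := (hp.mem_side_zero_iff (by omega)).1 hx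
  obtain ⟨j, ε, hε, h1, h2, h3⟩ := hg.exists_frame hn d
  obtain ⟨e1, e2⟩ := hp.map_side_zero (by omega) g.1 h1 h2 hxt
  rw [hp.polyClass_eq hn hodd ⟨g, x⟩ hx1, hp.polyClass_eq hn hodd ⟨h, x⟩ hx1]
  have hj : Even j := by tauto
  simp only [hgh, placeIdx_of_even hσ, placeIdx_of_not_even hσ', e1, e2]
  exact Quot.sound (glueRel_one hj (by rwa [abs_sign_mul hε, abs_neg, abs_of_nonneg h0]))

/-- Sides 1, 2 and 3 lie on lines through the vertex of the corner containing the point, so their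
reflections have even index and leave its position in the polygon unchanged. Only side 0 leads to
another polygon. -/
theorem polyClass_eq_of_unfoldRel (hp : IsFramed n d p)
    (hn : 5 ≤ n) (hodd : Odd n) (a b : Copies (tableRegion p) p)
    (h : UnfoldRel (tableRegion p) p a b) : polyClass n d a = polyClass n d b := by
  have hn3 : 3 ≤ n := by omega
  have hc := cos_ang_one_nonneg (by omega : 2 ≤ n)
  have hc1 := cos_ang_one_lt_one (by omega : 2 ≤ n)
  have h20 : 0 < √2 := by positivity
  obtain ⟨h1, h2⟩ := hp.unfoldRel hn a b h
  obtain ⟨g, x⟩ := a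
  obtain ⟨g', x'⟩ := b
  simp only at h1 h2
  subst h1
  rcases h2 with rfl | ⟨i, hx, hg⟩
  · rfl
  have hfix : ∀ (k : ℤ) (r : ℝ), ref n (2 * k) (r * nv n k) = r * nv n k := by
    intro k r
    rw [map_ofReal_mul, ref_nv, two_mul, add_sub_cancel_right]
  fin_cases i
  · rw [show sideReflection p ((fun i => i) ⟨0, by norm_num⟩) = _ from
      hp.sideReflection_zero (by omega)] at hg
    by_cases hσ : EvenDih n g.1 ↔ Even d
    · exact hp.polyClass_eq_of_side_zero hn3 hodd hg hx hσ
    · refine (hp.polyClass_eq_of_side_zero hn3 hodd ?_ hx ?_).symm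
      · rw [hg, mul_assoc, ref_mul_ref, sub_self, rot_zero, mul_one]
      · rw [hg, EvenDih.mul_ref_iff hn3 (hp.isDih_of_mem (by omega) g.2), even_self_add_iff hodd]
        simp only [even_two, Even.mul_right, not_true_eq_false, iff_false]
        tauto
  · rw [show sideReflection p ((fun i => i) ⟨1, by norm_num⟩) = _ from
      hp.sideReflection_one (by omega)] at hg
    obtain ⟨r, h0, hr, hxr⟩ := (hp.mem_side_one_iff (by omega)).1 hx
    refine hp.polyClass_eq_of_fixed hn3 hodd (t := false) (even_two_mul d) hg
      ⟨r, 0, h0, le_rfl, by simpa [cornerBound] using hr, ?_, ?_⟩ ?_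
    · simp only [cornerBound', Bool.false_eq_true, if_false]
      nlinarith [mul_le_mul_of_nonneg_right hr hc, mul_nonneg h20.le
        (by nlinarith : 0 ≤ 1 - Real.cos (ang n 1) * Real.cos (ang n 1))]
    · rw [hxr]
      simp [cornerVert, cornerDir]
    · rw [hxr]
      simp only [cornerVert, Bool.false_eq_true, if_false, add_sub_cancel_left]
      exact hfix d r
  · rw [show sideReflection p ((fun i => i) ⟨2, by norm_num⟩) = _ from
      hp.sideReflection_two (by omega)] at hg
    obtain ⟨r, h0, hr, hxr⟩ := (hp.mem_side_two_iff (by omega)).1 hx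
    obtain ⟨t, ht⟩ := hp.exists_corner (by omega) x.2
    refine hp.polyClass_eq_of_fixed hn3 hodd (even_two_mul (d - 1)) hg ht ?_
    rw [hxr]
    cases t
    · simp only [cornerVert, Bool.false_eq_true, if_false, add_sub_cancel_left]
      exact hfix _ r
    · simp only [cornerVert, if_true, hp.vert_three, add_sub_add_left_eq_sub, ← sub_mul,
        ← Complex.ofReal_sub]
      exact hfix _ _
  · rw [show sideReflection p ((fun i => i) ⟨3, by norm_num⟩) = _ from
      hp.sideReflection_three (by omega)] at hg
    obtain ⟨r, h0, hr, hxr⟩ := (hp.mem_side_three_iff (by omega)).1 hx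
    refine hp.polyClass_eq_of_fixed hn3 hodd (t := true) (even_two_mul _) hg
      ⟨0, r, le_rfl, h0, ?_, by simpa [cornerBound'] using hr, ?_⟩ ?_
    · simp only [cornerBound, if_true]
      nlinarith
    · rw [hxr]
      simp [cornerVert, cornerDir]
    · rw [hxr]
      simp only [cornerVert, if_true, add_sub_cancel_left]
      exact hfix _ r

/-- `polyClass` descends to the unfolding, where it inverts the placement up to the gluings of the
polygons. -/
theorem eqvGen_of_placeMap_eq (hp : IsFramed n d p)
    (hn : 5 ≤ n) (hodd : Odd n) (i i' : ℕ) (z z' : ℂ) (hi : i < 4)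
    (hi' : i' < 4) (hz : z ∈ poly n i) (hz' : z' ∈ poly n i')
    (h : placeMap n d p i z = placeMap n d p i' z') :
    Relation.EqvGen (GlueRel n) (i, z) (i', z') := by
  let Ψ : Unfolding (tableRegion p) p → Quot (GlueRel n) :=
    Quot.lift (polyClass n d) (hp.polyClass_eq_of_unfoldRel hn hodd)
  have hΨ : ∀ (i : ℕ) (z : ℂ), i < 4 → z ∈ poly n i →
      Ψ (placeMap n d p i z) = Quot.mk _ (i, z) := by
    intro i z hi hz
    obtain ⟨t, g, x, h1, rfl, rfl⟩ := hp.exists_place_mk hn hodd hi hz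
    rw [hp.placeMap_eq hn h1]
    exact hp.polyClass_eq (by omega) hodd ⟨g, x⟩ h1
  have := congrArg Ψ h
  rw [hΨ i z hi hz, hΨ i' z' hi' hz'] at this
  exact Quot.eqvGen_exact this

end IsFramed

end

/-! ### The action of the reflection group on the unfolded surface -/

section LeftMul

variable {N : ℕ} [NeZero N] {P : Set ℂ} {p : Fin N → ℂ}

/-- Gluings multiply by side reflections on the right and so commute with multiplication on the
left. -/
theorem UnfoldRel.leftMul (r : reflectionGroup p) {a b : Copies P p} (h : UnfoldRel P p a b) :
    UnfoldRel P p ⟨r * a.1, a.2⟩ ⟨r * b.1, b.2⟩ := by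
  cases h with
  | glue g h i hgh x hx =>
    refine UnfoldRel.glue (r * g) (r * h) i ?_ x hx
    rw [Subgroup.coe_mul, Subgroup.coe_mul, hgh, mul_assoc]
  | translate g h t ht x y hxy =>
    refine UnfoldRel.translate (r * g) (r * h) (r.1 t) ?_ x y ?_
    · have e1 : (fun z => (r * g).1 z) '' P = r.1 '' ((fun z => g.1 z) '' P) := by
        rw [Set.image_image]
        rfl
      have e2 : (fun z => (r * h).1 z + r.1 t) '' P = r.1 '' ((fun z => h.1 z + t) '' P) := by
        rw [Set.image_image]
        simp only [map_add]
        rfl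
      rw [e1, e2, ht]
    · change r.1 (g.1 x) = r.1 (h.1 y) + r.1 t
      rw [hxy, map_add]

/-- Left multiplication on the unfolded surface. -/
noncomputable def Unfolding.leftMul (r : reflectionGroup p) : Unfolding P p → Unfolding P p :=
  Quot.map (fun a => ⟨r * a.1, a.2⟩) fun _ _ h => h.leftMul r

theorem Unfolding.leftMul_mk (r g : reflectionGroup p) (x : P) :
    Unfolding.leftMul r (Unfolding.mk g x) = Unfolding.mk (r * g) x := rfl

theorem Unfolding.continuous_leftMul (r : reflectionGroup p) :
    Continuous (Unfolding.leftMul r : Unfolding P p → Unfolding P p) := by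
  refine (isQuotientMap_quot_mk (r := UnfoldRel P p)).continuous_iff.2 (continuous_sigma fun g => ?_)
  exact Unfolding.continuous_mk (r * g)

/-- Left multiplication as a homeomorphism. -/
noncomputable def Unfolding.leftMulHomeomorph (r : reflectionGroup p) : Unfolding P p ≃ₜ Unfolding P p where
  toFun := Unfolding.leftMul r
  invFun := Unfolding.leftMul r⁻¹
  left_inv x := by
    obtain ⟨g, y, rfl⟩ := Unfolding.exists_mk x
    rw [Unfolding.leftMul_mk, Unfolding.leftMul_mk, inv_mul_cancel_left]
  right_inv x := by
    obtain ⟨g, y, rfl⟩ := Unfolding.exists_mk x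
    rw [Unfolding.leftMul_mk, Unfolding.leftMul_mk, mul_inv_cancel_left]
  continuous_toFun := Unfolding.continuous_leftMul r
  continuous_invFun := Unfolding.continuous_leftMul r⁻¹

/-- The chart `r⁻¹ ∘ e ∘ r`. -/
noncomputable def leftMulChart (r : reflectionGroup p) (e : OpenPartialHomeomorph (Unfolding P p) ℂ) :
    OpenPartialHomeomorph (Unfolding P p) ℂ :=
  ((Unfolding.leftMulHomeomorph r).toOpenPartialHomeomorph.trans e).trans
    r.1.symm.toHomeomorph.toOpenPartialHomeomorph

theorem leftMulChart_apply (r : reflectionGroup p) (e : OpenPartialHomeomorph (Unfolding P p) ℂ)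
    (x : Unfolding P p) : leftMulChart r e x = r.1.symm (e (Unfolding.leftMul r x)) := rfl

theorem mem_leftMulChart_source (r : reflectionGroup p)
    (e : OpenPartialHomeomorph (Unfolding P p) ℂ) (x : Unfolding P p) :
    x ∈ (leftMulChart r e).source ↔ Unfolding.leftMul r x ∈ e.source := by
  simp [leftMulChart, Unfolding.leftMulHomeomorph]

theorem isTranslationChart_leftMulChart (r : reflectionGroup p)
    {e : OpenPartialHomeomorph (Unfolding P p) ℂ} (he : IsTranslationChart e) :
    IsTranslationChart (leftMulChart r e) := by
  intro g x hx
  rw [mem_leftMulChart_source, Unfolding.leftMul_mk] at hx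
  filter_upwards [he (r * g) x hx] with y hy
  rw [leftMulChart_apply, leftMulChart_apply, Unfolding.leftMul_mk, Unfolding.leftMul_mk, ← map_sub,
    hy, ← map_sub, ← map_sub]
  exact r.1.symm_apply_apply _

/-- In the polygons, left multiplication by `r` is the map `r` itself, so that is its derivative.
Since `A` has determinant one, `hA` restricts the statement to rotations. -/
theorem mem_affineGroup_of_mem_reflectionGroup (r : reflectionGroup p) {A : SL(2, ℝ)}
    (hA : ∀ z, r.1 z = linAct A z) : A ∈ (unfoldingStructure P p).affineGroup := by
  have hreg : ∀ (r : reflectionGroup p) (x : Unfolding P p),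
      (unfoldingStructure P p).IsRegular (Unfolding.leftMul r x) →
        (unfoldingStructure P p).IsRegular x := by
    rintro r x ⟨e, he, hx⟩
    exact ⟨leftMulChart r e, isTranslationChart_leftMulChart r he,
      (mem_leftMulChart_source r e x).2 hx⟩
  refine ⟨Unfolding.leftMulHomeomorph r, fun x => ⟨hreg r x, fun hx => ?_⟩, ?_⟩
  · refine hreg r⁻¹ _ ?_
    rwa [← (Unfolding.leftMulHomeomorph r).symm_apply_apply x] at hx
  · intro e he e' he' x hx hx'
    have h := (unfoldingStructure P p).compatible e he _ (isTranslationChart_leftMulChart r he') x hx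
      ((mem_leftMulChart_source r e' x).2 hx')
    filter_upwards [h] with y hy
    rw [leftMulChart_apply, leftMulChart_apply, ← map_sub] at hy
    rw [← hA, ← hy, LinearIsometryEquiv.apply_symm_apply]
    rfl

end LeftMul

/-! ### The table `T(4, n, ∞)` -/

section

variable {n : ℕ}

theorem tv_one_eq (n : ℕ) : tv n 1 =
    Complex.cos ((Real.pi / n : ℝ) : ℂ) + Complex.sin ((Real.pi / n : ℝ) : ℂ) * Complex.I := by
  rw [← Complex.ofReal_cos, ← Complex.ofReal_sin]
  apply Complex.ext <;> simp [tv, ang_one, -Complex.ofReal_cos, -Complex.ofReal_sin]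

theorem eq_norm_mul_tv_one {z : ℂ} (h : Complex.arg z = Real.pi / n) : z = ‖z‖ * tv n 1 := by
  conv_lhs => rw [← Complex.norm_mul_cos_add_sin_mul_I z, h]
  rw [tv_one_eq]

theorem arg_mul_tv_one (hn : 2 ≤ n) {r : ℝ} (hr : 0 < r) :
    Complex.arg (r * tv n 1) = Real.pi / n := by
  rw [tv_one_eq]
  have h1 : 0 < Real.pi / n := div_pos Real.pi_pos (by positivity)
  refine Complex.arg_mul_cos_add_sin_mul_I hr ⟨by linarith [Real.pi_pos], ?_⟩
  exact div_le_self Real.pi_pos.le (by exact_mod_cast (by omega : 1 ≤ n))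

theorem exists_isTableFour (hn : 5 ≤ n) : ∃ p : Fin 4 → ℂ, IsTableFour n p := by
  have hc := cos_ang_one_nonneg (by omega : 2 ≤ n)
  have hs : 0 < Real.sin (ang n 1) := sin_ang_pos (by omega) one_pos (by omega)
  have h2 : √2 * √2 = 2 := Real.mul_self_sqrt (by norm_num)
  have hh : 0 < 1 + √2 * Real.cos (ang n 1) := by positivity
  have hL : 0 < 2 * Real.cos (ang n 1) + √2 := by positivity
  -- The framed table with `d = 0` and `p 2 = 0`: `nv n 0` points downwards, so the side
  -- perpendicular to it is horizontal.
  let p : Fin 4 → ℂ := ![nv n 0 + (√2 : ℝ) * nv n (0 - 1),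
    ((1 + √2 * Real.cos (ang n 1) : ℝ) : ℂ) * nv n 0, 0,
    ((2 * Real.cos (ang n 1) + √2 : ℝ) : ℂ) * nv n (0 - 1)]
  have hp : IsFramed n 0 p := ⟨by simp [p], by simp [p], by simp [p]⟩
  have hne : ∀ k, nv n k ≠ 0 := fun k h => by
    have := norm_nv (n := n) k
    rw [h, norm_zero] at this
    exact zero_ne_one this
  have htv : ∀ k, nv n k = nv n (k - 1) * tv n 1 := fun k => by
    rw [nv_eq, nv_eq, mul_assoc, tv_mul_tv, sub_add_cancel]
  have e0 : p 0 - p 1 = -(((√2 * Real.sin (ang n 1) : ℝ) : ℂ)) := by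
    rw [← neg_sub, hp.sub_zero_one, tv_zero, mul_one]
  have e1 : p 2 - p 1 = ((1 + √2 * Real.cos (ang n 1) : ℝ) : ℂ) * Complex.I := by
    rw [hp.vert_one, nv_eq, tv_zero]
    ring
  have e2 : p 3 - p 2 = ((2 * Real.cos (ang n 1) + √2 : ℝ) : ℂ) * nv n (0 - 1) := by
    rw [hp.vert_three]
    ring
  have e3 : p 0 - p 3 = -nv n (0 - 2) := by
    rw [hp.vert_zero, hp.vert_three, nv_sub_two]
    push_cast
    ring
  refine ⟨p, ?_, ?_, ?_, ?_, ?_, ?_⟩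
  · have : (p 0 - p 1) / (p 2 - p 1) =
        ((√2 * Real.sin (ang n 1) / (1 + √2 * Real.cos (ang n 1)) : ℝ) : ℂ) * Complex.I := by
      have h3 : ((1 + √2 * Real.cos (ang n 1) : ℝ) : ℂ) ≠ 0 := by exact_mod_cast hh.ne'
      rw [e0, e1, Complex.ofReal_div, div_eq_iff (mul_ne_zero h3 Complex.I_ne_zero)]
      field_simp
      rw [Complex.I_sq]
      ring
    rw [this, Complex.arg_real_mul _ (by positivity), Complex.arg_I]
  · have : (p 1 - p 2) / (p 3 - p 2) = (((1 + √2 * Real.cos (ang n 1)) /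
        (2 * Real.cos (ang n 1) + √2) : ℝ) : ℂ) * tv n 1 := by
      have h3 : ((2 * Real.cos (ang n 1) + √2 : ℝ) : ℂ) ≠ 0 := by exact_mod_cast hL.ne'
      rw [e2, div_eq_iff (mul_ne_zero h3 (hne _)), hp.vert_one, htv 0, Complex.ofReal_div,
        add_sub_cancel_left]
      generalize ((2 * Real.cos (ang n 1) + √2 : ℝ) : ℂ) = L at h3 ⊢
      field_simp
    rw [this, arg_mul_tv_one (by omega) (by positivity)]
  · have : (p 2 - p 3) / (p 0 - p 3) = ((2 * Real.cos (ang n 1) + √2 : ℝ) : ℂ) * tv n 1 := by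
      rw [e3, div_eq_iff (neg_ne_zero.2 (hne _)), ← neg_sub, e2, htv (0 - 1), sub_sub,
        one_add_one_eq_two]
      ring
    rw [this, arg_mul_tv_one (by omega) (by positivity)]
  · rw [e3, norm_neg, norm_nv]
  · rw [e2, norm_mul, norm_nv, mul_one, Complex.norm_real, Real.norm_eq_abs, abs_of_pos hL,
      ang_one, Real.cos_pi_div_four]
    ring
  · rw [← neg_sub, e0, neg_neg, Complex.ofReal_im]

theorem IsTableFour.exists_isFramed (hn : 5 ≤ n) {p : Fin 4 → ℂ} (h : IsTableFour n p) :
    ∃ d, IsFramed n d p := by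
  have hn0 : 0 < n := by omega
  have hc := cos_ang_one_nonneg (by omega : 2 ≤ n)
  have h2 : √2 * √2 = 2 := Real.mul_self_sqrt (by norm_num)
  have hh : 0 < 1 + √2 * Real.cos (ang n 1) := by positivity
  have hL : 0 < 2 * Real.cos (ang n 1) + √2 := by positivity
  have hθ : 0 < Real.pi / n := div_pos Real.pi_pos (by positivity)
  obtain ⟨h1, h3, h4, h5, h6, h7⟩ := h
  have h6' : ‖p 3 - p 2‖ = 2 * Real.cos (ang n 1) + √2 := by
    rw [h6, ang_one, Real.cos_pi_div_four]
    ring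
  have hu0 : p 0 - p 3 ≠ 0 := by
    rw [← norm_ne_zero_iff, h5]
    exact one_ne_zero
  have hv0 : p 3 - p 2 ≠ 0 := by
    rw [← norm_ne_zero_iff, h6']
    exact hL.ne'
  have hne : ∀ {z : ℂ}, Complex.arg z ≠ 0 → z ≠ 0 := by
    rintro z hz rfl
    exact hz Complex.arg_zero
  have hw0 : p 1 - p 2 ≠ 0 := (div_ne_zero_iff.1 (hne (by rw [h3]; exact hθ.ne'))).1
  have k4 := eq_norm_mul_tv_one h4
  rw [norm_div, norm_sub_rev, h6', h5, div_one, div_eq_iff hu0] at k4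
  have k3 := eq_norm_mul_tv_one h3
  rw [div_eq_iff hv0] at k3
  obtain ⟨r, hr, k3⟩ : ∃ r : ℝ, 0 < r ∧ p 1 - p 2 = r * tv n 1 * (p 3 - p 2) :=
    ⟨_, norm_pos_iff.2 (div_ne_zero hw0 hv0), k3⟩
  obtain ⟨s, hs, k1⟩ : ∃ s : ℝ, 0 < s ∧ p 0 - p 1 = s * Complex.I * (p 2 - p 1) := by
    obtain ⟨h8, h9⟩ := Complex.arg_eq_pi_div_two_iff.1 h1
    refine ⟨_, h9, ?_⟩
    rw [← div_eq_iff (by rw [← neg_sub]; exact neg_ne_zero.2 hw0)]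
    apply Complex.ext <;> simp [h8]
  set u := p 0 - p 3 with hu
  set L := 2 * Real.cos (ang n 1) + √2 with hLdef
  -- `m` is the direction from `p 2` to `p 1`
  obtain ⟨m, hm⟩ : ∃ m, m = -(u * tv n 2) := ⟨_, rfl⟩
  have ht2 : tv n 1 * tv n 1 = tv n 2 := by rw [tv_mul_tv]; rfl
  have ht : tv n (-1) * tv n 1 = 1 := by rw [tv_mul_tv]; simp [tv_zero]
  have a1 : p 1 - p 2 = ((r * L : ℝ) : ℂ) * m := by
    rw [k3, ← neg_sub, k4, hm, ← ht2]
    push_cast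
    ring
  have a3 : p 3 - p 2 = L * (m * tv n (-1)) := by
    rw [← neg_sub, k4, hm, ← ht2]
    linear_combination ((L : ℂ) * u * tv n 1) * ht
  have au : u = -(m * (tv n (-1) * tv n (-1))) := by
    rw [hm, ← ht2]
    linear_combination -(u * (tv n (-1) * tv n 1 + 1)) * ht
  have hm1 : ‖m‖ = 1 := by rw [hm, norm_neg, norm_mul, h5, norm_tv, one_mul]
  have hm0 : m ≠ 0 := by
    rw [← norm_ne_zero_iff, hm1]
    exact one_ne_zero
  -- The closing condition of the quadrilateral, divided by `m`. The right angle at `p 1` makes the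
  -- right-hand side imaginary, so the real part determines the length `r * L` of the second side
  -- without knowledge of `s`.
  have key : (-(tv n (-1) * tv n (-1)) + L * tv n (-1) - (r * L : ℝ) : ℂ) =
      s * Complex.I * -(r * L : ℝ) := by
    refine mul_left_cancel₀ hm0 ?_
    linear_combination k1 - a3 + a1 * (1 - s * Complex.I) - au - hu
  have hrL : r * L = 1 + √2 * Real.cos (ang n 1) := by
    have := congrArg Complex.re key
    rw [tv_mul_tv] at this
    simp [tv, ang_neg] at this
    rw [show (2 : ℤ) = 1 + 1 by ring, ang_add, Real.cos_add] at this
    have h8 := Real.sin_sq_add_cos_sq (ang n 1)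
    rw [hLdef] at this ⊢
    linear_combination h8 - this
  have hre : m.re = 0 := by
    have e : p 1 - p 0 = ((s * (r * L) : ℝ) : ℂ) * (Complex.I * m) := by
      push_cast at a1 ⊢
      linear_combination -k1 + s * Complex.I * a1
    rw [e, Complex.im_ofReal_mul, hrL] at h7
    have := (mul_eq_zero.1 h7).resolve_left (by positivity)
    simpa using this
  -- Horizontality of the first side makes `m` vertical: it points down for `d = 0` and up for `d =
  -- n`.
  have hd : ∃ d, m = nv n d := by
    have him : m.im * m.im = 1 := by
      have := Complex.normSq_apply m
      rw [← Complex.sq_norm, hm1, hre] at this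
      linarith
    rcases mul_self_eq_one_iff.1 him with him | him
    · refine ⟨0 + n, ?_⟩
      rw [nv_add_self hn0]
      apply Complex.ext <;> simp [nv, ang_zero, hre, him]
    · refine ⟨0, ?_⟩
      apply Complex.ext <;> simp [nv, ang_zero, hre, him]
  obtain ⟨d, rfl⟩ := hd
  have hnv : nv n d * tv n (-1) = nv n (d - 1) := by
    rw [nv_eq, nv_eq, mul_assoc, tv_mul_tv]
    rfl
  have hnv2 : nv n d * (tv n (-1) * tv n (-1)) = nv n (d - 2) := by
    rw [← mul_assoc, hnv, nv_eq, nv_eq, mul_assoc, tv_mul_tv]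
    congr 2
    ring
  have v3 : p 3 = p 2 + (L : ℂ) * nv n (d - 1) := by
    rw [← hnv]
    linear_combination a3
  refine ⟨d, ?_, ?_, v3⟩
  · rw [hnv2, nv_sub_two] at au
    have : p 0 = p 3 + u := by rw [hu]; ring
    rw [this, v3, au, hLdef]
    push_cast
    ring
  · rw [← hrL]
    linear_combination a1

theorem sin_ang_one_le {k : ℤ} (hk : 0 < k ∧ k < n) :
    Real.sin (ang n 1) ≤ Real.sin (ang n k) := by
  have hn : (0 : ℝ) < n := by exact_mod_cast (by omega : 0 < n)
  have h1 : ang n 1 ≤ ang n k := by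
    unfold ang
    gcongr
    exact_mod_cast hk.1
  have h2 : ang n k ≤ Real.pi - ang n 1 := by
    rw [← ang_self (n := n) (by omega), ← ang_sub]
    unfold ang
    gcongr
    omega
  have h0 : 0 ≤ ang n 1 := by
    rw [ang_one]
    positivity
  rw [← Real.cos_pi_div_two_sub, ← Real.cos_pi_div_two_sub, ← Real.cos_abs (Real.pi / 2 - ang n k)]
  refine Real.cos_le_cos_of_nonneg_of_le_pi (abs_nonneg _) (by linarith [Real.pi_pos]) ?_
  rw [abs_le]
  constructor <;> linarith

theorem rot_one_apply (z : ℂ) : rot n 1 z = linAct (matR n) z := by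
  rw [rot_apply]
  apply Complex.ext <;> simp [tv, ang_one, linAct, matR] <;> ring

theorem linAct_matT (z : ℂ) : linAct (matT n) z = shear ((matT n).1 0 1) z := by
  have h1 : (matT n).1 0 0 = 1 := rfl
  have h2 : (matT n).1 1 0 = 0 := rfl
  have h3 : (matT n).1 1 1 = 1 := rfl
  simp only [linAct, h1, h2, h3]
  generalize (matT n).1 0 1 = τ
  apply Complex.ext <;> simp [shear]

namespace IsFramed

variable {d : ℤ} {p : Fin 4 → ℂ}

theorem matR_mem (hp : IsFramed n d p)
    (hn : 5 ≤ n) (hodd : Odd n) : matR n ∈ (tableSurface p).affineGroup :=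
  mem_affineGroup_of_mem_reflectionGroup
    ⟨rot n 1, hp.mem_of_isDih (by omega) hodd (isDih_rot 1)⟩ rot_one_apply

/-- The polygons of the unfolding and the cylinders refine each other by way of the four polygons,
so the twist and the gap for closed paths transfer to the unfolded surface. -/
theorem matT_mem_and_gap (hp : IsFramed n d p)
    (hn : 5 ≤ n) (hodd : Odd n) : matT n ∈ (tableSurface p).affineGroup ∧
    ∃ ε : ℝ, 0 < ε ∧ ∀ A ∈ (tableSurface p).affineGroup, A.1 1 0 = 0 ∨ ε ≤ |A.1 1 0| := by
  have : Nonempty (tableRegion p) := ⟨⟨p 2, vert_two_mem_tableRegion p⟩⟩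
  have hn3 : 3 ≤ n := by omega
  have := hp.finite_reflectionGroup (by omega)
  have hq := hp.placeMap_glue hn hodd
  have hinj := hp.eqvGen_of_placeMap_eq hn hodd
  have h := (hp.unfoldingCells_refines_polyCells hn hodd).trans
    (polyCells_refines_strips hn3 hodd hq hinj)
  have h' := (strips_refines_polyCells hn3 hodd hq hinj).trans
    (hp.polyCells_refines_unfoldingCells hn hodd)
  refine ⟨StripData.mem_affineGroup_of_refines h h' linAct_matT, ?_⟩
  have hs : 0 < Real.sin (ang n 1) := sin_ang_pos (by omega) one_pos (by omega)
  -- `η` bounds every height from below since `wt (i + 1) ≥ 1` and `sin(kπ/n) ≥ sin(π/n)`.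
  refine StripData.gap_of_refines h h' (hp.unfoldRel hn) (matT_entry_pos hn3)
    (η := 2 * (Real.sin (ang n 1) * Real.sin (ang n 1))) (by positivity) ?_
  rintro ⟨⟨i, k⟩, hi, hk, hk'⟩
  change _ ≤ 2 * halfHeight n i k
  have h1 := sin_ang_one_le hk'
  have h2 : 1 ≤ wt (i + 1) := by
    simp only at hi
    interval_cases i <;> simp [wt]
  have h3 : Real.sin (ang n 1) ≤ wt (i + 1) * Real.sin (ang n 1) := by nlinarith
  have h4 : Real.sin (ang n 1) * Real.sin (ang n 1) ≤ halfHeight n i k :=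
    mul_le_mul h3 h1 hs.le (by linarith)
  linarith

end IsFramed

theorem isFuchsian_projAffineGroup (hn : 5 ≤ n) (hodd : Odd n) {p : Fin 4 → ℂ}
    (h : IsTableFour n p) : IsFuchsian (tableSurface p).projAffineGroup := by
  obtain ⟨d, hp⟩ := h.exists_isFramed hn
  obtain ⟨-, ε, hε, hgap⟩ := hp.matT_mem_and_gap hn hodd
  have hs : 0 < Real.sin (ang n 1) := sin_ang_pos (by omega) one_pos (by omega)
  have hc := one_lt_sqrt_two_mul_cos hn
  rw [ang_one] at hs hc
  refine isFuchsian_map_of_gap hs.ne' (fun h0 => ?_) (hp.matR_mem hn hodd) hε hgap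
  rw [h0, mul_zero] at hc
  linarith

end

theorem theorem6p3 (n : ℕ) (hn : 5 ≤ n) (hodd : Odd n) :
    (∃ p : Fin 4 → ℂ, IsTableFour n p) ∧
    (∀ p : Fin 4 → ℂ, IsTableFour n p →
      matR n ∈ (tableSurface p).affineGroup ∧ matT n ∈ (tableSurface p).affineGroup) ∧
    IsTriangleGroup 4 n ⊤ (Subgroup.closure {toPSL (matR n), toPSL (matT n)}) ∧
    (∀ p : Fin 4 → ℂ, IsTableFour n p → (tableSurface p).IsVeech) := by
  have hs : 0 < Real.sin (Real.pi / n) := by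
    rw [← ang_one]
    exact sin_ang_pos (by omega) one_pos (by omega)
  have hmem : ∀ p : Fin 4 → ℂ, IsTableFour n p →
      matR n ∈ (tableSurface p).affineGroup ∧ matT n ∈ (tableSurface p).affineGroup := by
    intro p h
    obtain ⟨d, hp⟩ := h.exists_isFramed hn
    exact ⟨hp.matR_mem hn hodd, (hp.matT_mem_and_gap hn hodd).1⟩
  refine ⟨exists_isTableFour hn, hmem, ?_, fun p h => ?_⟩
  -- This claim mentions no table, yet its discreteness is inherited from the affine group of an
  -- actual surface, so the existence of a table is used.
  · obtain ⟨p, h⟩ := exists_isTableFour hn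
    refine isTriangleGroup_closure n hs.ne' ?_
    refine IsFuchsian.mono ?_ (isFuchsian_projAffineGroup hn hodd h)
    rw [Subgroup.closure_le]
    rintro _ (rfl | rfl)
    · exact ⟨_, (hmem p h).1, rfl⟩
    · exact ⟨_, (hmem p h).2, rfl⟩
  · refine ⟨isFuchsian_projAffineGroup hn hodd h, cuspRegion ((matT n).1 0 1),
      measurableSet_cuspRegion _, volume_cuspRegion_lt_top _, fun z => ?_⟩
    have hc : Real.cos (Real.pi / 4) ≤ Real.cos (Real.pi / n) := by
      have hn' : (4 : ℝ) ≤ n := by exact_mod_cast (by omega : 4 ≤ n)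
      refine Real.cos_le_cos_of_nonneg_of_le_pi (by positivity) (by linarith [Real.pi_pos]) ?_
      exact div_le_div_of_nonneg_left Real.pi_pos.le (by norm_num) hn'
    obtain ⟨g, hg, hz⟩ := exists_smul_mem_cuspRegion n hs hc (hmem p h).1 (hmem p h).2 z
    exact ⟨g, ⟨g, hg, rfl⟩, hz⟩
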